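/- Let $n\ge 2$, let $\mathbf p=(p_1,\dots,p_n)$ with harmonic average $\overline p=\big(\frac1n\sum_i\frac1{p_i}\big)^{-1}$, and assume $1<p_i<\overline p\,(1+\frac2n)$ for all $i$, $\overline p<n$, and $\overline p\le\frac{2n}{n+2}$. Let $m>\frac n{\overline p}(2-\overline p)$, $\mathcal C>0$ and $D\ge 0$. Then there is a constant $C>0$, depending only on $n,\mathbf p,m,\mathcal C$ and $D$, such that the following holds for all $\delta_1,\dots,\delta_n\in[0,D]$, every bounded domain $\Omega\subset\mathbb R^n$, every $T>0$ and every $u\in L^m_{loc}(\Omega_T)$, where $\Omega_T=\Omega\times(0,T)$. Notation: $s_\pm=\max\{\pm s,0\}$; for $x_0\in\mathbb R^n$, $t_0\in\mathbb R$, $\rho>0$ put $K_\rho(x_0)=\prod_i(x_{0,i}-\rho^{1/p_i},x_{0,i}+\rho^{1/p_i})$ and $Q_\rho(x_0,t_0)=K_\rho(x_0)\times(t_0-\rho,t_0)$; and $P=\max\{2,p_1,\dots,p_n\}$. The function $u$ belongs to $\mathcal{DG}^{+}(\mathbf p,\{\delta_i\},\Omega_T,\mathcal C)$ if $u\in L^P_{loc}(\Omega_T)\cap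 L^1_{loc}(0,T;W^{1,1}_{loc}(\Omega))$ with $\partial_{x_i}u\in L^{p_i}_{loc}(\Omega_T)$ for all $i$ and, for every $k\in\mathbb R$, every $Q_\rho(x_0,t_0)\Subset\Omega_T$ and every cut-off function $\zeta$ as below, $$\operatorname*{ess\,sup}_{t_0-\rho<\tau<t_0}\int_{K_\rho(x_0)}(u-k)_+^2\,\zeta(x,\tau)\,dx+\sum_i\iint_{Q_\rho(x_0,t_0)}(|\partial_{x_i}u|-\delta_i)_+^{p_i}\,\zeta\,\mathbf 1_{\{u>k\}}\,dx\,dt\le\mathcal C\iint_{Q_\rho(x_0,t_0)}(u-k)_+^2\,\partial_t\zeta\,dx\,dt+\mathcal C\sum_i\iint_{Q_\rho(x_0,t_0)}(u-k)_+^{p_i}\,|\partial_{x_i}\zeta^{1/p_i}|^{p_i}\,dx\,dt.$$ The class $\mathcal{DG}^-$ is defined in the same way with $(u-k)_-$ and $\{u<k\}$ in place of $(u-k)_+$ and $\{u>k\}$. The cut-off functions are all $\zeta\in C^\infty(\mathbb R^{n+1})$ of the form $\zeta(x,t)=\psi(t)\prod_i\zeta_i^{p_i}(x_i)$, where $\psi\in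 C^\infty(\mathbb R;[0,1])$ is non-decreasing with $\psi=0$ on $(-\infty,t_0-\rho+\frac\epsilon2]$ and $\psi=1$ on $[t_0-\rho+\epsilon,\infty)$ for some $\epsilon\in(0,\rho)$, and $\zeta_i\in C_0^\infty(\mathbb R;[0,1])$ with $\operatorname{supp}\zeta_i\subset(x_{0,i}-\rho^{1/p_i},x_{0,i}+\rho^{1/p_i})$. If $u\in\mathcal{DG}^{+}(\mathbf p,\{\delta_i\},\Omega_T,\mathcal C)$, then $u$ is locally essentially bounded from above in $\Omega_T$ and, whenever $Q_{2\rho}(x_0,t_0)\Subset\Omega_T$, $$\operatorname*{ess\,sup}_{Q_\rho(x_0,t_0)}u_+\le C\left[\left(\frac1{|Q_{2\rho}(x_0,t_0)|}\iint_{Q_{2\rho}(x_0,t_0)}u_+^m\,dx\,dt\right)^{\frac1{m-\frac n{\overline p}(2-\overline p)}}+1+\sqrt\rho\,\right].$$ If $u\in\mathcal{DG}^{-}(\mathbf p,\{\delta_i\},\Omega_T,\mathcal C)$, then $u$ is locally essentially bounded from below in $\Omega_T$ and, whenever $Q_{2\rho}(x_0,t_0)\Subset\Omega_T$, the same estimate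 holds with $u_-$ in place of $u_+$ on both sides. -/

import Mathlib

open MeasureTheory Set
open scoped ContDiff ENNReal

noncomputable section

namespace AnisoDG

/-- The harmonic average of the exponents `p 0, …, p (n-1)`. -/
def harmonicAvg {n : ℕ} (p : Fin n → ℝ) : ℝ :=
  ((1 / (n : ℝ)) * ∑ i, 1 / p i)⁻¹

/-- The exponent `max {2, p 0, …, p (n-1)}`. -/
def maxExp {n : ℕ} (p : Fin n → ℝ) : ℝ :=
  max 2 (⨆ i, p i)

/-- The space-time cylinder `Ω × (0, T)`. -/
def cyl {n : ℕ} (Ω : Set (Fin n → ℝ)) (T : ℝ) : Set ((Fin n → ℝ) × ℝ) :=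
  Ω ×ˢ Ioo 0 T

/-- The anisotropic open box centred at `x₀` with half-sides `ρ ^ (1 / p i)`. -/
def box {n : ℕ} (p : Fin n → ℝ) (x₀ : Fin n → ℝ) (ρ : ℝ) : Set (Fin n → ℝ) :=
  Set.univ.pi fun i => Ioo (x₀ i - ρ ^ (1 / p i)) (x₀ i + ρ ^ (1 / p i))

/-- The backward anisotropic space-time cylinder with vertex `(x₀, t₀)`. -/
def Q {n : ℕ} (p : Fin n → ℝ) (x₀ : Fin n → ℝ) (t₀ ρ : ℝ) : Set ((Fin n → ℝ) × ℝ) :=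
  box p x₀ ρ ×ˢ Ioo (t₀ - ρ) t₀

/-- `A` is compactly contained in `B`. -/
def CompactlyContained {X : Type*} [TopologicalSpace X] (A B : Set X) : Prop :=
  IsCompact (closure A) ∧ closure A ⊆ B

/-- `f ∈ L^q_loc(U)`. -/
def MemLpLoc {X : Type*} [TopologicalSpace X] [MeasureSpace X]
    (f : X → ℝ) (q : ℝ) (U : Set X) : Prop :=
  ∀ K : Set X, IsCompact K → K ⊆ U → MemLp f (ENNReal.ofReal q) (volume.restrict K)

/-- `f, g ∈ L¹_loc(Ω)`, and `g` is the weak partial derivative of `f` in `Ω` in the `i`-th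
coordinate direction. -/
def HasWeakPartial {n : ℕ} (Ω : Set (Fin n → ℝ)) (i : Fin n)
    (f g : (Fin n → ℝ) → ℝ) : Prop :=
  MemLpLoc f 1 Ω ∧ MemLpLoc g 1 Ω ∧
    ∀ φ : (Fin n → ℝ) → ℝ, ContDiff ℝ ∞ φ → HasCompactSupport φ → tsupport φ ⊆ Ω →
      ∫ x in Ω, f x * fderiv ℝ φ x (Pi.single i 1) = -∫ x in Ω, g x * φ x

/-- `u ∈ L^𝐩_loc(0, T; W^{1,𝐩}_loc(Ω))` with weak spatial gradient `g`: both `u` and `g` are locally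
integrable in `Ω × (0, T)`, `u(·, t) ∈ W^{1,1}_loc(Ω)` with weak gradient `g(·, t)` for almost every
`t ∈ (0, T)`, and `g i ∈ L^{p i}_loc(Ω × (0, T))`. -/
def HasSpatialGradient {n : ℕ} (p : Fin n → ℝ) (Ω : Set (Fin n → ℝ)) (T : ℝ)
    (u : (Fin n → ℝ) × ℝ → ℝ) (g : Fin n → (Fin n → ℝ) × ℝ → ℝ) : Prop :=
  MemLpLoc u 1 (cyl Ω T) ∧
    (∀ i, MemLpLoc (g i) 1 (cyl Ω T) ∧ MemLpLoc (g i) (p i) (cyl Ω T)) ∧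
    ∀ᵐ t ∂(volume.restrict (Ioo 0 T)), ∀ i,
      HasWeakPartial Ω i (fun x => u (x, t)) (fun x => g i (x, t))

/-- The admissible smooth cut-off functions for the cylinder `Q p x₀ t₀ ρ`. -/
def IsCutoff {n : ℕ} (p : Fin n → ℝ) (x₀ : Fin n → ℝ) (t₀ ρ : ℝ)
    (ζ : (Fin n → ℝ) × ℝ → ℝ) : Prop :=
  ContDiff ℝ ∞ ζ ∧
    ∃ (ε : ℝ) (ψ : ℝ → ℝ) (η : Fin n → ℝ → ℝ),
      ε ∈ Ioo 0 ρ ∧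
      ContDiff ℝ ∞ ψ ∧ (∀ t, ψ t ∈ Icc (0 : ℝ) 1) ∧ Monotone ψ ∧
      (∀ t ≤ t₀ - ρ + ε / 2, ψ t = 0) ∧ (∀ t ≥ t₀ - ρ + ε, ψ t = 1) ∧
      (∀ i, ContDiff ℝ ∞ (η i) ∧ HasCompactSupport (η i) ∧ (∀ s, η i s ∈ Icc (0 : ℝ) 1) ∧
        tsupport (η i) ⊆ Ioo (x₀ i - ρ ^ (1 / p i)) (x₀ i + ρ ^ (1 / p i))) ∧
      ∀ z, ζ z = ψ z.2 * ∏ i, η i (z.1 i) ^ p i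

/-- The energy inequality on the cylinder `Q p x₀ t₀ ρ` for a truncation `w` (which is `(u - k)_+` or
`(u - k)_-`), the superlevel or sublevel set `A` on which `w` is positive, the spatial gradient `g`
of `u` and the cut-off function `ζ`. All integrands are nonnegative (`ζ` is nondecreasing in time),
so all integrals are taken in `[0, ∞]`. The supremum in time is an essential supremum. -/
def EnergyIneq {n : ℕ} (p δ : Fin n → ℝ) (c : ℝ) (x₀ : Fin n → ℝ) (t₀ ρ : ℝ)
    (w : (Fin n → ℝ) × ℝ → ℝ) (A : Set ((Fin n → ℝ) × ℝ))
    (g : Fin n → (Fin n → ℝ) × ℝ → ℝ) (ζ : (Fin n → ℝ) × ℝ → ℝ) : Prop :=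
  essSup (fun τ => ∫⁻ x in box p x₀ ρ, ENNReal.ofReal (w (x, τ) ^ 2 * ζ (x, τ)))
      (volume.restrict (Ioo (t₀ - ρ) t₀))
    + ∑ i, ∫⁻ z in Q p x₀ t₀ ρ,
        A.indicator (fun z => ENNReal.ofReal (max (|g i z| - δ i) 0 ^ p i * ζ z)) z
  ≤ ENNReal.ofReal c * (∫⁻ z in Q p x₀ t₀ ρ,
        ENNReal.ofReal (w z ^ 2 * deriv (fun s => ζ (z.1, s)) z.2))
    + ENNReal.ofReal c * ∑ i, ∫⁻ z in Q p x₀ t₀ ρ,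
        ENNReal.ofReal (w z ^ p i *
          |deriv (fun s => ζ (Function.update z.1 i s, z.2) ^ (1 / p i)) (z.1 i)| ^ p i)

/-- The energy class `DG⁺(𝐩, {δ_i}, Ω_T, c)`. -/
def DGplus {n : ℕ} (p δ : Fin n → ℝ) (Ω : Set (Fin n → ℝ)) (T c : ℝ)
    (u : (Fin n → ℝ) × ℝ → ℝ) : Prop :=
  MemLpLoc u (maxExp p) (cyl Ω T) ∧
    ∃ g : Fin n → (Fin n → ℝ) × ℝ → ℝ, HasSpatialGradient p Ω T u g ∧
      ∀ (x₀ : Fin n → ℝ) (t₀ ρ : ℝ), 0 < ρ → CompactlyContained (Q p x₀ t₀ ρ) (cyl Ω T) →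
        ∀ ζ, IsCutoff p x₀ t₀ ρ ζ → ∀ k : ℝ,
          EnergyIneq p δ c x₀ t₀ ρ (fun z => max (u z - k) 0) {z | k < u z} g ζ

/-- The energy class `DG⁻(𝐩, {δ_i}, Ω_T, c)`. -/
def DGminus {n : ℕ} (p δ : Fin n → ℝ) (Ω : Set (Fin n → ℝ)) (T c : ℝ)
    (u : (Fin n → ℝ) × ℝ → ℝ) : Prop :=
  MemLpLoc u (maxExp p) (cyl Ω T) ∧
    ∃ g : Fin n → (Fin n → ℝ) × ℝ → ℝ, HasSpatialGradient p Ω T u g ∧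
      ∀ (x₀ : Fin n → ℝ) (t₀ ρ : ℝ), 0 < ρ → CompactlyContained (Q p x₀ t₀ ρ) (cyl Ω T) →
        ∀ ζ, IsCutoff p x₀ t₀ ρ ζ → ∀ k : ℝ,
          EnergyIneq p δ c x₀ t₀ ρ (fun z => max (-(u z - k)) 0) {z | u z < k} g ζ

/-- `v` is locally essentially bounded from above in `U`. -/
def LocBddAbove {X : Type*} [TopologicalSpace X] [MeasureSpace X]
    (v : X → ℝ) (U : Set X) : Prop :=
  ∀ K : Set X, IsCompact K → K ⊆ U → ∃ M : ℝ, ∀ᵐ z ∂(volume.restrict K), v z ≤ M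

/-- `v` is locally essentially bounded from below in `U`. -/
def LocBddBelow {X : Type*} [TopologicalSpace X] [MeasureSpace X]
    (v : X → ℝ) (U : Set X) : Prop :=
  ∀ K : Set X, IsCompact K → K ⊆ U → ∃ M : ℝ, ∀ᵐ z ∂(volume.restrict K), M ≤ v z

/-- The explicit sup bound for a nonnegative function `v` (which is `u_+` or `u_-`):
`ess sup_{Q_ρ} v ≤ C [(⨍_{Q_{2ρ}} v^m)^{1 / (m - (n / p̄) (2 - p̄))} + 1 + √ρ]`. -/
def SupBound {n : ℕ} (p : Fin n → ℝ) (m C : ℝ) (x₀ : Fin n → ℝ) (t₀ ρ : ℝ)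
    (v : (Fin n → ℝ) × ℝ → ℝ) : Prop :=
  essSup (fun z => ENNReal.ofReal (v z)) (volume.restrict (Q p x₀ t₀ ρ)) ≤
    ENNReal.ofReal (C * ((⨍ z in Q p x₀ t₀ (2 * ρ), v z ^ m) ^
      (1 / (m - n / harmonicAvg p * (2 - harmonicAvg p))) + 1 + √ρ))

end AnisoDG

end

namespace AnisoDG

variable {n : ℕ}

/-! ### Absolutely continuous functions on an interval -/

/-! Write S = Σ 1/p_i = n/p̄. The hypotheses say that S > 1, p_i < 2 and 2 ≤ 2S - n < m, and
`DGminus.neg` reduces lower bounds to upper ones. The proof is a De Giorgi iteration in L^m. With m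
= 2 the gain exponent d below would be (2 + n - 2S)/S ≤ 0, so the energy inequality has to be
reweighted first.

The energy inequality is available at all levels k + s. Integrating it over s against a power of s
(layer cake) puts the weight (u - k)_+^(m-2) in front of the gradients, and turns the supremum of L²
norms into an essential supremum in time of ∫ (u - k)_+^m. This is `power_energy`. These two
quantities are those on the right of the anisotropic Sobolev inequality
`lintegral_truncation_rpow_le`, in essence ∫ w^r ≤ C (∫ w^m)^(1/S) Σ_i ∫ w^(m-2) |∂_i w|^(p_i) with
r = m + d and d = (m - (2S - n))/S. That inequality follows by bounding suitable powers of w by line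
integrals in each direction, multiplying them with the Loomis–Whitney inequality
`lintegral_prod_lintegral_line_rpow_le`, and applying Hölder's inequality.

The condition on m is exactly d > 0. Passing to a higher level then costs a factor h^(-d), and
`deGiorgi_step` gives a recursion Y_(j+1) ≤ C B^j K^(-d) ρ^(-(1+1/S)) Y_j^(1+1/S) on shrinking
cylinders. Fast geometric convergence forces u ≤ K on Q_ρ once K^d dominates a multiple of
avg^(1/S), that is, once K dominates a multiple of avg^(1/(m-(2S-n))). The radius cancels because
|Q_(2ρ)| is a multiple of ρ^(S+1). The term 1 in the bound pays for comparing the powers p_i with 2,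
and √ρ pays for the offsets δ_i, which do not scale with ρ. -/

theorem absolutelyContinuousOnInterval_comp {f F : ℝ → ℝ} {a b K : ℝ} (hK : 0 ≤ K)
    (hf : AbsolutelyContinuousOnInterval f a b)
    (hF : ∀ x ∈ uIcc a b, ∀ y ∈ uIcc a b, |F (f x) - F (f y)| ≤ K * |f x - f y|) :
    AbsolutelyContinuousOnInterval (fun x => F (f x)) a b := by
  rw [absolutelyContinuousOnInterval_iff] at hf ⊢
  intro ε hε
  obtain ⟨d, hd, h⟩ := hf (ε / (K + 1)) (by positivity)
  refine ⟨d, hd, fun E hE hE' => ?_⟩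
  have h1 := h E hE hE'
  calc ∑ i ∈ Finset.range E.1, dist (F (f (E.2 i).1)) (F (f (E.2 i).2))
      ≤ ∑ i ∈ Finset.range E.1, (K + 1) * dist (f (E.2 i).1) (f (E.2 i).2) := by
        refine Finset.sum_le_sum fun i hi => ?_
        have := hF _ (hE.1 i hi).1 _ (hE.1 i hi).2
        rw [Real.dist_eq, Real.dist_eq]
        nlinarith [abs_nonneg (f (E.2 i).1 - f (E.2 i).2)]
    _ = (K + 1) * ∑ i ∈ Finset.range E.1, dist (f (E.2 i).1) (f (E.2 i).2) := by
        rw [Finset.mul_sum]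
    _ < (K + 1) * (ε / (K + 1)) := by gcongr
    _ = ε := by field

theorem abs_rpow_sub_rpow_le {γ M x y : ℝ} (hγ : 1 ≤ γ) (hx : x ∈ Icc 0 M) (hy : y ∈ Icc 0 M) :
    |x ^ γ - y ^ γ| ≤ γ * M ^ (γ - 1) * |x - y| := by
  have hM : 0 ≤ M := hx.1.trans hx.2
  have := Convex.norm_image_sub_le_of_norm_hasDerivWithin_le (f := fun z : ℝ => z ^ γ)
    (f' := fun z => γ * z ^ (γ - 1)) (s := Icc 0 M) (C := γ * M ^ (γ - 1)) (x := y) (y := x)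
    (fun z hz => ?_) (fun z hz => ?_) (convex_Icc _ _) hy hx
  · simpa using this
  · exact (Real.hasDerivAt_rpow_const (Or.inr hγ)).hasDerivWithinAt
  · have h1 : z ^ (γ - 1) ≤ M ^ (γ - 1) := Real.rpow_le_rpow hz.1 hz.2 (by linarith)
    have h0 : 0 ≤ z ^ (γ - 1) := Real.rpow_nonneg hz.1 _
    rw [Real.norm_eq_abs, abs_of_nonneg (by positivity)]
    gcongr

/-- The truncation of `s - k` to the interval `[0, N]`. -/
def trunc (k N s : ℝ) : ℝ := min (max (s - k) 0) N

theorem trunc_nonneg {k N : ℝ} (hN : 0 ≤ N) (s : ℝ) : 0 ≤ trunc k N s :=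
  le_min (le_max_right _ _) hN

theorem trunc_le (k N s : ℝ) : trunc k N s ≤ N := min_le_right _ _

theorem trunc_le_pos (k N s : ℝ) : trunc k N s ≤ max (s - k) 0 := min_le_left _ _

theorem abs_trunc_sub_le (k N s t : ℝ) : |trunc k N s - trunc k N t| ≤ |s - t| := by
  unfold trunc
  refine (abs_min_sub_min_le_max _ _ _ _).trans (max_le ?_ (by simp))
  refine (abs_max_sub_max_le_abs _ _ _).trans ?_
  simp

/-- A primitive `φ` of `g` satisfies a pointwise bound for a power of `trunc φ * θ`. -/
theorem rpow_trunc_mul_le_lintegral {g θ : ℝ → ℝ} {b N k γ c : ℝ} (hb : 0 ≤ b) (hN : 0 ≤ N)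
    (hg : IntervalIntegrable g volume 0 b) (hθ : ContDiff ℝ 1 θ) (hθ0 : ∀ h, 0 ≤ θ h)
    (hθb : θ b = 0) (hγ : 1 ≤ γ) :
    ENNReal.ofReal ((trunc k N c * θ 0) ^ γ) ≤ ∫⁻ h in Ioc 0 b,
      ENNReal.ofReal (γ * (trunc k N (c + ∫ s in (0 : ℝ)..h, g s) * θ h) ^ (γ - 1) *
        (|g h| * θ h + trunc k N (c + ∫ s in (0 : ℝ)..h, g s) * |deriv θ h|)) := by
  set φ : ℝ → ℝ := fun h => c + ∫ s in (0 : ℝ)..h, g s with hφ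
  set T : ℝ → ℝ := fun h => trunc k N (φ h) with hT
  set V : ℝ → ℝ := fun h => T h * θ h with hV
  have hT0 : ∀ h, 0 ≤ T h := fun h => trunc_nonneg hN _
  have hV0 : ∀ h, 0 ≤ V h := fun h => mul_nonneg (hT0 h) (hθ0 h)
  have acI : AbsolutelyContinuousOnInterval (fun h => ∫ s in (0 : ℝ)..h, g s) 0 b :=
    hg.absolutelyContinuousOnInterval_intervalIntegral left_mem_uIcc
  have acT : AbsolutelyContinuousOnInterval T 0 b := by
    refine absolutelyContinuousOnInterval_comp (F := fun y => trunc k N (c + y)) zero_le_one acI ?_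
    intro x _ y _
    refine (abs_trunc_sub_le _ _ _ _).trans ?_
    simp
  have acV : AbsolutelyContinuousOnInterval V 0 b :=
    acT.mul hθ.contDiffOn.absolutelyContinuousOnInterval
  obtain ⟨M, hM⟩ := acV.exists_bound
  have hVM : ∀ x ∈ uIcc 0 b, V x ∈ Icc 0 M := fun x hx =>
    ⟨hV0 x, (le_abs_self _).trans (hM x hx)⟩
  have hM0 : 0 ≤ M := (hVM 0 left_mem_uIcc).1.trans (hVM 0 left_mem_uIcc).2
  have acH : AbsolutelyContinuousOnInterval (fun h => V h ^ γ) 0 b := by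
    refine absolutelyContinuousOnInterval_comp (F := fun y => y ^ γ)
      (K := γ * M ^ (γ - 1)) (by positivity) acV ?_
    intro x hx y hy
    exact abs_rpow_sub_rpow_le hγ (hVM x hx) (hVM y hy)
  have hder : ∀ᵐ h, h ∈ uIcc 0 b → |deriv (fun h => V h ^ γ) h| ≤
      γ * V h ^ (γ - 1) * (|g h| * θ h + T h * |deriv θ h|) := by
    filter_upwards [acT.ae_differentiableAt, hg.ae_hasDerivAt_integral] with h h1 h2 hh
    have dI := h2 hh 0 left_mem_uIcc
    have dT := (h1 hh).hasDerivAt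
    have dφ : HasDerivAt φ (g h) h := dI.const_add c
    -- No chain rule is needed at the kinks of the truncation: it is 1-Lipschitz, so increments of T
    -- are dominated by those of φ, whose derivative is g.
    have hle : |deriv T h| ≤ |g h| := by
      refine le_of_forall_pos_le_add fun ε hε => ?_
      refine dT.le_of_lip' (by positivity) ?_
      have := dφ.isLittleO.def hε
      filter_upwards [this] with y hy
      refine (abs_trunc_sub_le _ _ _ _).trans ?_
      rw [Real.norm_eq_abs] at hy
      have h3 := abs_sub_abs_le_abs_sub (φ y - φ h) ((y - h) * g h)
      simp only [smul_eq_mul] at hy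
      rw [abs_mul] at h3
      simp only [Real.norm_eq_abs] at hy ⊢
      nlinarith
    have dθ : HasDerivAt θ (deriv θ h) h := (hθ.differentiable one_ne_zero h).hasDerivAt
    have dV : HasDerivAt V (deriv T h * θ h + T h * deriv θ h) h := dT.mul dθ
    have dH := dV.rpow_const (p := γ) (Or.inr hγ)
    rw [dH.deriv, abs_mul, abs_mul, abs_of_nonneg (Real.rpow_nonneg (hV0 h) _),
      abs_of_nonneg (by linarith : 0 ≤ γ)]
    have h4 : |deriv T h * θ h + T h * deriv θ h| ≤ |g h| * θ h + T h * |deriv θ h| := by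
      refine (abs_add_le _ _).trans ?_
      rw [abs_mul, abs_mul, abs_of_nonneg (hθ0 h), abs_of_nonneg (hT0 h)]
      gcongr
      exact hθ0 h
    have h5 : 0 ≤ V h ^ (γ - 1) := Real.rpow_nonneg (hV0 h) _
    calc |deriv T h * θ h + T h * deriv θ h| * γ * V h ^ (γ - 1)
        = γ * V h ^ (γ - 1) * |deriv T h * θ h + T h * deriv θ h| := by ring
      _ ≤ _ := by gcongr
  have key := acH.integral_deriv_eq_sub
  have hφ0 : φ 0 = c := by simp [hφ]
  have e1 : V b ^ γ = 0 := by
    simp only [hV, hθb, mul_zero]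
    exact Real.zero_rpow (by linarith)
  rw [e1, zero_sub, intervalIntegral.integral_of_le hb] at key
  have e2 : ENNReal.ofReal ((trunc k N c * θ 0) ^ γ) =
      ‖∫ x in Ioc 0 b, deriv (fun h => V h ^ γ) x‖ₑ := by
    rw [key, enorm_neg, Real.enorm_eq_ofReal (Real.rpow_nonneg (hV0 0) _)]
    simp only [hV, hT, hφ0]
  rw [e2]
  refine (enorm_integral_le_lintegral_enorm _).trans ?_
  refine lintegral_mono_ae ?_
  rw [ae_restrict_iff' measurableSet_Ioc]
  filter_upwards [hder] with h hh hm
  rw [Real.enorm_eq_ofReal_abs]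
  refine ENNReal.ofReal_le_ofReal (hh ?_)
  rw [uIcc_of_le hb]
  exact Ioc_subset_Icc_self hm

/-! ### Weakly differentiable functions along lines -/

/-- Each fibre of this shear is a translation. It makes (s, x) ↦ g (x + s e) jointly integrable,
which justifies the later exchanges of integrals. -/
theorem measurePreserving_add_smul (e : Fin n → ℝ) (μ : Measure ℝ) [SFinite μ] :
    MeasurePreserving (fun q : ℝ × (Fin n → ℝ) => (q.1, q.2 + q.1 • e))
      (μ.prod volume) (μ.prod volume) := by
  refine MeasurePreserving.skew_product (g := fun (s : ℝ) (x : Fin n → ℝ) => x + s • e)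
    (MeasurePreserving.id μ) ?_ ?_
  · exact Continuous.measurable (by fun_prop)
  · exact Filter.Eventually.of_forall fun s => (measurePreserving_add_right volume (s • e)).map_eq

theorem integrable_comp_add_smul {g : (Fin n → ℝ) → ℝ} (hg : Integrable g) (e : Fin n → ℝ)
    (μ : Measure ℝ) [IsFiniteMeasure μ] :
    Integrable (fun q : ℝ × (Fin n → ℝ) => g (q.2 + q.1 • e)) (μ.prod volume) :=
  (measurePreserving_add_smul e μ).integrable_comp_of_integrable (hg.comp_snd μ)

/-- A function with a weak partial derivative is, for a fixed step, the integral of this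
derivative. -/
theorem sub_eq_integral_of_weakPartial {B : Set (Fin n → ℝ)} (hB : IsOpen B) (hBc : Convex ℝ B)
    {f g : (Fin n → ℝ) → ℝ} (hf : Integrable f) (hg : Integrable g) (e : Fin n → ℝ)
    (hw : ∀ φ : (Fin n → ℝ) → ℝ, ContDiff ℝ ∞ φ → HasCompactSupport φ → tsupport φ ⊆ B →
      ∫ x, f x * fderiv ℝ φ x e = -∫ x, g x * φ x) {h : ℝ} (hh : 0 ≤ h) :
    ∀ᵐ x, x ∈ B → x + h • e ∈ B → f (x + h • e) - f x = ∫ s in (0 : ℝ)..h, g (x + s • e) := by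
  set μ : Measure ℝ := volume.restrict (Ioc 0 h)
  have hgp := integrable_comp_add_smul hg e μ
  have hgi : Integrable (fun x => ∫ s, g (x + s • e) ∂μ) := hgp.integral_prod_right
  have hfh : Integrable (fun x => f (x + h • e)) := hf.comp_add_right (h • e)
  have hU : IsOpen (B ∩ (fun x => x + h • e) ⁻¹' B) :=
    hB.inter (hB.preimage (by fun_prop))
  -- The identity is tested against φ supported where both x and x + h e lie in B.
  have main := hU.ae_eq_zero_of_integral_contDiff_smul_eq_zero (μ := volume)
    (f := fun x => f (x + h • e) - f x - ∫ s, g (x + s • e) ∂μ)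
    (((hfh.sub hf).sub hgi).locallyIntegrable.locallyIntegrableOn _) ?_
  · filter_upwards [main] with x hx hxB hxB'
    have := hx ⟨hxB, hxB'⟩
    rw [intervalIntegral.integral_of_le hh]
    linarith
  intro φ hφ hφc hφU
  have hφd : Differentiable ℝ φ := hφ.differentiable (by simp)
  have hφct : Continuous φ := hφ.continuous
  have hdct : Continuous (fun x => fderiv ℝ φ x e) :=
    (hφ.continuous_fderiv (by simp)).clm_apply continuous_const
  obtain ⟨A, hA⟩ : ∃ A, ∀ x, ‖φ x‖ ≤ A := hφct.bounded_above_of_compact_support hφc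
  obtain ⟨A', hA'⟩ : ∃ A, ∀ x, ‖fderiv ℝ φ x e‖ ≤ A :=
    hdct.bounded_above_of_compact_support (hφc.fderiv_apply (𝕜 := ℝ) e)
  -- The translate of φ by s e is an admissible test function: its support lies on segments joining
  -- points x and x + h e of B, and B is convex. Integrating over s ∈ (0, h] then replaces the
  -- derivative by a difference of φ.
  have shift : ∀ s ∈ Ioc 0 h, ∫ x, f x * fderiv ℝ φ (x - s • e) e =
      -∫ x, g (x + s • e) * φ x := by
    intro s hs
    have h1 := hw (fun x => φ (x - s • e)) (hφ.comp (by fun_prop)) ?_ ?_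
    · have e1 : ∀ x, fderiv ℝ (fun x => φ (x - s • e)) x = fderiv ℝ φ (x - s • e) := fun x => by
        rw [fderiv_comp_sub]
      simp only [e1] at h1
      rw [h1, ← integral_add_right_eq_self (fun x => g x * φ (x - s • e)) (s • e)]
      simp
    · exact hφc.comp_homeomorph (Homeomorph.subRight (s • e))
    · have e2 : tsupport (fun x => φ (x - s • e)) =
          (Homeomorph.subRight (s • e)) ⁻¹' tsupport φ := by
        exact tsupport_comp_eq_preimage φ (Homeomorph.subRight (s • e))
      rw [e2]
      intro x hx
      obtain ⟨ha, hb⟩ := hφU hx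
      have hhp : 0 < h := hs.1.trans_le hs.2
      have : x = (1 - s / h) • (x - s • e) + (s / h) • ((x - s • e) + h • e) := by
        ext j
        simp
        field_simp
        ring
      rw [this]
      refine hBc ha hb ?_ (by have := hs.1; positivity) (by ring)
      rw [sub_nonneg, div_le_one hhp]
      exact hs.2
  have i1 : Integrable (fun q : ℝ × (Fin n → ℝ) => f q.2 * fderiv ℝ φ (q.2 - q.1 • e) e)
      (μ.prod volume) := by
    refine (hf.comp_snd μ).mul_bdd (c := A') ?_ ?_
    · exact Continuous.aestronglyMeasurable (hdct.comp (by fun_prop))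
    · exact Filter.Eventually.of_forall fun q => hA' _
  have i2 : Integrable (fun q : ℝ × (Fin n → ℝ) => g (q.2 + q.1 • e) * φ q.2)
      (μ.prod volume) := by
    refine hgp.mul_bdd (c := A) ?_ ?_
    · exact Continuous.aestronglyMeasurable (hφct.comp (by fun_prop))
    · exact Filter.Eventually.of_forall fun q => hA _
  have ftc : ∀ x, ∫ s, fderiv ℝ φ (x - s • e) e ∂μ = φ x - φ (x - h • e) := by
    intro x
    have hd : ∀ s ∈ uIcc 0 h, HasDerivAt (fun s : ℝ => -φ (x - s • e))
        (fderiv ℝ φ (x - s • e) e) s := by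
      intro s _
      have h1 : HasDerivAt (fun s : ℝ => x - s • e) (-e) s := by
        simpa using ((hasDerivAt_id s).smul_const e).const_sub x
      have h2 := (hφd (x - s • e)).hasFDerivAt.comp_hasDerivAt s h1
      have h3 := h2.neg
      rw [map_neg, neg_neg] at h3
      exact h3
    have := intervalIntegral.integral_eq_sub_of_hasDerivAt hd
      (Continuous.intervalIntegrable (hdct.comp (by fun_prop)) _ _)
    rw [intervalIntegral.integral_of_le hh] at this
    rw [this]
    simp
    ring
  have lhs : ∫ s, (∫ x, f x * fderiv ℝ φ (x - s • e) e) ∂μ =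
      ∫ x, f x * (φ x - φ (x - h • e)) := by
    rw [integral_integral_swap i1]
    refine integral_congr_ae (Filter.Eventually.of_forall fun x => ?_)
    simp only
    rw [integral_const_mul, ftc]
  have rhs : ∫ s, (∫ x, g (x + s • e) * φ x) ∂μ = ∫ x, (∫ s, g (x + s • e) ∂μ) * φ x := by
    rw [integral_integral_swap i2]
    refine integral_congr_ae (Filter.Eventually.of_forall fun x => ?_)
    simp only
    rw [integral_mul_const]
  have comb : ∫ x, f x * (φ x - φ (x - h • e)) = -∫ x, (∫ s, g (x + s • e) ∂μ) * φ x := by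
    rw [← lhs, ← rhs, ← integral_neg]
    exact setIntegral_congr_fun measurableSet_Ioc shift
  have b1 : Integrable (fun x => φ x * f (x + h • e)) :=
    hfh.bdd_mul (c := A) hφct.aestronglyMeasurable (Filter.Eventually.of_forall hA)
  have b2 : Integrable (fun x => φ x * f x) :=
    hf.bdd_mul (c := A) hφct.aestronglyMeasurable (Filter.Eventually.of_forall hA)
  have b3 : Integrable (fun x => φ x * ∫ s, g (x + s • e) ∂μ) :=
    hgi.bdd_mul (c := A) hφct.aestronglyMeasurable (Filter.Eventually.of_forall hA)
  have b4 : Integrable (fun x => f x * φ (x - h • e)) :=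
    hf.mul_bdd (c := A) (Continuous.aestronglyMeasurable (hφct.comp (by fun_prop)))
      (Filter.Eventually.of_forall fun x => hA _)
  have b5 : ∫ x, f x * φ (x - h • e) = ∫ x, φ x * f (x + h • e) := by
    rw [← integral_add_right_eq_self (fun x => f x * φ (x - h • e)) (h • e)]
    simp [mul_comm]
  have b6 : ∫ x, f x * (φ x - φ (x - h • e)) = (∫ x, φ x * f x) - ∫ x, φ x * f (x + h • e) := by
    rw [← b5, ← integral_sub b2 b4]
    exact integral_congr_ae (Filter.Eventually.of_forall fun x => by simp only; ring)
  have b7 : ∫ x, (∫ s, g (x + s • e) ∂μ) * φ x = ∫ x, φ x * ∫ s, g (x + s • e) ∂μ := by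
    simp only [mul_comm]
  calc ∫ x, φ x • (f (x + h • e) - f x - ∫ s, g (x + s • e) ∂μ)
      = ∫ x, (φ x * f (x + h • e) - φ x * f x - φ x * ∫ s, g (x + s • e) ∂μ) := by
        exact integral_congr_ae (Filter.Eventually.of_forall fun x => by simp only [smul_eq_mul]; ring)
    _ = 0 := by
        have s1 : ∫ x, (φ x * f (x + h • e) - φ x * f x - φ x * ∫ s, g (x + s • e) ∂μ) =
            (∫ x, (φ x * f (x + h • e) - φ x * f x)) - ∫ x, φ x * ∫ s, g (x + s • e) ∂μ :=
          integral_sub (b1.sub b2) b3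
        rw [s1, integral_sub b1 b2]
        rw [b6, b7] at comb
        linarith

/-- Fubini's theorem needs this to pass from "for each step, almost every point" to "for almost
every point, almost every step". The variable interval is encoded by an indicator so that the
integral is measurable in its parameters. -/
theorem measurableSet_sub_eq_integral {B : Set (Fin n → ℝ)} (hB : MeasurableSet B)
    {f g : (Fin n → ℝ) → ℝ} (hf : Measurable f) (hg : Measurable g) (e : Fin n → ℝ) :
    MeasurableSet {q : ℝ × (Fin n → ℝ) | 0 ≤ q.1 → q.2 ∈ B → q.2 + q.1 • e ∈ B →
      f (q.2 + q.1 • e) - f q.2 = ∫ s in (0 : ℝ)..q.1, g (q.2 + s • e)} := by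
  have hm : Measurable (fun q : ℝ × (Fin n → ℝ) => q.2 + q.1 • e) :=
    Continuous.measurable (by fun_prop)
  have hI : Measurable (fun q : ℝ × (Fin n → ℝ) =>
      ∫ s, (Ioc 0 q.1).indicator (fun s => g (q.2 + s • e)) s) := by
    refine (StronglyMeasurable.integral_prod_right (ν := volume)
      (f := fun (q : ℝ × (Fin n → ℝ)) (s : ℝ) =>
        (Ioc 0 q.1).indicator (fun s => g (q.2 + s • e)) s) ?_).measurable
    refine Measurable.stronglyMeasurable ?_
    have : (Function.uncurry fun (q : ℝ × (Fin n → ℝ)) (s : ℝ) =>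
        (Ioc 0 q.1).indicator (fun s => g (q.2 + s • e)) s) =
        {z : (ℝ × (Fin n → ℝ)) × ℝ | 0 < z.2 ∧ z.2 ≤ z.1.1}.indicator
          (fun z => g (z.1.2 + z.2 • e)) := by
      ext ⟨q, s⟩
      simp [indicator]
    rw [this]
    refine Measurable.indicator ?_ ?_
    · exact hg.comp (Continuous.measurable (by fun_prop))
    · exact (measurableSet_lt measurable_const measurable_snd).inter
        (measurableSet_le measurable_snd (measurable_fst.comp measurable_fst))
  have : {q : ℝ × (Fin n → ℝ) | 0 ≤ q.1 → q.2 ∈ B → q.2 + q.1 • e ∈ B →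
      f (q.2 + q.1 • e) - f q.2 = ∫ s in (0 : ℝ)..q.1, g (q.2 + s • e)} =
      {q | 0 ≤ q.1}ᶜ ∪ ({q | q.2 ∈ B}ᶜ ∪ ({q | q.2 + q.1 • e ∈ B}ᶜ ∪
        {q | f (q.2 + q.1 • e) - f q.2 =
          ∫ s, (Ioc 0 q.1).indicator (fun s => g (q.2 + s • e)) s})) := by
    ext q
    simp only [mem_ofPred_eq, mem_union, mem_compl_iff]
    by_cases h0 : 0 ≤ q.1
    · rw [intervalIntegral.integral_of_le h0, integral_indicator measurableSet_Ioc]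
      tauto
    · simp [h0]
  rw [this]
  refine (measurableSet_le measurable_const measurable_fst).compl.union
    ((measurable_snd hB).compl.union ((hm hB).compl.union ?_))
  exact measurableSet_eq_fun ((hf.comp hm).sub (hf.comp measurable_snd)) hI

/-- The pointwise bound for a power of a truncation times a cut-off by a line integral. -/
theorem ofReal_rpow_trunc_le_lintegral_line {l r : Fin n → ℝ} {f g : (Fin n → ℝ) → ℝ}
    (hf : Integrable f) (hg : Integrable g) (hfm : Measurable f) (hgm : Measurable g) (i : Fin n)
    (hw : ∀ φ : (Fin n → ℝ) → ℝ, ContDiff ℝ ∞ φ → HasCompactSupport φ →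
      tsupport φ ⊆ univ.pi (fun j => Ioo (l j) (r j)) →
      ∫ x, f x * fderiv ℝ φ x (Pi.single i 1) = -∫ x, g x * φ x)
    {χ : (Fin n → ℝ) → ℝ} (hχ : ContDiff ℝ 1 χ) (hχ0 : ∀ x, 0 ≤ χ x)
    (hχB : ∀ x, x ∉ univ.pi (fun j => Ioo (l j) (r j)) → χ x = 0)
    {k N γ : ℝ} (hN : 0 ≤ N) (hγ : 1 ≤ γ) :
    ∀ᵐ x, ENNReal.ofReal ((trunc k N (f x) * χ x) ^ γ) ≤
      ∫⁻ t, (fun y => ENNReal.ofReal (γ * (trunc k N (f y) * χ y) ^ (γ - 1) *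
        (|g y| * χ y + trunc k N (f y) * |fderiv ℝ χ y (Pi.single i 1)|)))
          (Function.update x i t) := by
  set e : Fin n → ℝ := Pi.single i 1 with he
  set B : Set (Fin n → ℝ) := univ.pi (fun j => Ioo (l j) (r j)) with hBdef
  have hBo : IsOpen B := isOpen_set_pi finite_univ fun _ _ => isOpen_Ioo
  have hBc : Convex ℝ B := convex_pi fun _ _ => convex_Ioo _ _
  -- After the exchange of quantifiers, f agrees with an absolutely continuous primitive at almost
  -- every point of the forward half-line inside the box. Its value at x itself is exact.
  have hxy : ∀ᵐ x, ∀ᵐ h : ℝ, 0 ≤ h → x ∈ B → x + h • e ∈ B →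
      f (x + h • e) - f x = ∫ s in (0 : ℝ)..h, g (x + s • e) := by
    refine (Measure.ae_ae_comm (μ := volume) (ν := volume) (p := fun (h : ℝ) (x : Fin n → ℝ) =>
      0 ≤ h → x ∈ B → x + h • e ∈ B → f (x + h • e) - f x = ∫ s in (0 : ℝ)..h, g (x + s • e))
      (measurableSet_sub_eq_integral hBo.measurableSet hfm hgm e)).1 ?_
    refine Filter.Eventually.of_forall fun h => ?_
    by_cases hh : 0 ≤ h
    · filter_upwards [sub_eq_integral_of_weakPartial hBo hBc hf hg e hw hh] with x hx _ using hx
    · exact Filter.Eventually.of_forall fun x h' => absurd h' hh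
  have hint : ∀ᵐ x, ∀ L : ℕ, Integrable (fun s : ℝ => g (x + s • e))
      (volume.restrict (Ioc 0 (L : ℝ))) := by
    rw [ae_all_iff]
    intro L
    exact (integrable_comp_add_smul hg e (volume.restrict (Ioc 0 (L : ℝ)))).prod_left_ae
  filter_upwards [hxy, hint] with x hx hL
  by_cases hxB : x ∈ B
  swap
  · rw [hχB x hxB, mul_zero, Real.zero_rpow (by linarith), ENNReal.ofReal_zero]
    exact zero_le
  have hupd : ∀ h : ℝ, x + h • e = Function.update x i (x i + h) := by
    intro h
    ext j
    by_cases hj : j = i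
    · subst hj; simp [he]
    · simp [he, hj]
  have hmem : ∀ h : ℝ, 0 ≤ h → (x + h • e ∈ B ↔ h < r i - x i) := by
    intro h hh
    have hxi := hxB i (mem_univ i)
    rw [hupd]
    constructor
    · intro h1
      have := (h1 i (mem_univ i)).2
      simp at this
      linarith
    · intro h1 j _
      by_cases hj : j = i
      · subst hj
        simp only [Function.update_self]
        exact ⟨by linarith [hxi.1], by linarith⟩
      · simpa [hj] using hxB j (mem_univ j)
  set b := r i - x i with hbdef
  have hb : 0 < b := sub_pos.2 (hxB i (mem_univ i)).2
  have hgi : IntervalIntegrable (fun s : ℝ => g (x + s • e)) volume 0 b := by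
    rw [intervalIntegrable_iff_integrableOn_Ioc_of_le hb.le]
    obtain ⟨L, hLb⟩ := exists_nat_ge b
    exact (show IntegrableOn _ (Ioc 0 (L : ℝ)) volume from hL L).mono_set
      (Ioc_subset_Ioc_right hLb)
  have hθ : ContDiff ℝ 1 (fun h : ℝ => χ (x + h • e)) := hχ.comp (by fun_prop)
  have h1 := rpow_trunc_mul_le_lintegral (c := f x) (k := k) hb.le hN hgi hθ (fun h => hχ0 _)
    (hχB _ (by rw [hmem b hb.le]; exact lt_irrefl _)) hγ
  simp only [zero_smul, add_zero] at h1
  refine h1.trans ?_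
  have hder : ∀ h : ℝ, deriv (fun h : ℝ => χ (x + h • e)) h = fderiv ℝ χ (x + h • e) e := by
    intro h
    have h2 : HasDerivAt (fun h : ℝ => x + h • e) e h := by
      simpa using ((hasDerivAt_id h).smul_const e).const_add x
    exact (((hχ.differentiable one_ne_zero) (x + h • e)).hasFDerivAt.comp_hasDerivAt h h2).deriv
  -- The endpoint h = b is already outside the open box, where the line identity says nothing.
  have hne : ∀ᵐ h : ℝ, h ≠ b := by simp [ae_iff]
  calc _ ≤ ∫⁻ h in Ioc 0 b, (fun y => ENNReal.ofReal (γ * (trunc k N (f y) * χ y) ^ (γ - 1) *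
        (|g y| * χ y + trunc k N (f y) * |fderiv ℝ χ y e|))) (Function.update x i (x i + h)) := by
        refine lintegral_mono_ae ?_
        rw [ae_restrict_iff' measurableSet_Ioc]
        filter_upwards [hx, hne] with h h3 h4 h5
        have h6 := h3 h5.1.le hxB ((hmem h h5.1.le).2 (lt_of_le_of_ne h5.2 h4))
        have h7 : f x + ∫ s in (0 : ℝ)..h, g (x + s • e) = f (x + h • e) := by
          rw [← h6]; ring
        simp only [← hupd]
        rw [h7, hder]
    _ ≤ ∫⁻ h, (fun y => ENNReal.ofReal (γ * (trunc k N (f y) * χ y) ^ (γ - 1) *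
        (|g y| * χ y + trunc k N (f y) * |fderiv ℝ χ y e|))) (Function.update x i (x i + h)) :=
        setLIntegral_le_lintegral _ _
    _ = _ := lintegral_add_left_eq_self (fun t => (fun y => ENNReal.ofReal
        (γ * (trunc k N (f y) * χ y) ^ (γ - 1) *
        (|g y| * χ y + trunc k N (f y) * |fderiv ℝ χ y e|))) (Function.update x i t)) (x i)

/-! ### An anisotropic Sobolev inequality -/

theorem prod_rpow_eq_rpow_sum {ι : Type*} (s : Finset ι) (x : ℝ≥0∞) (a : ι → ℝ)
    (ha : ∀ i ∈ s, 0 ≤ a i) : ∏ i ∈ s, x ^ a i = x ^ ∑ i ∈ s, a i := by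
  classical
  induction s using Finset.induction_on with
  | empty => simp
  | insert j t hj ih =>
    rw [Finset.prod_insert hj, Finset.sum_insert hj, ih fun i hi => ha i (by simp [hi]),
      ENNReal.rpow_add_of_nonneg _ _ (ha j (by simp))
        (Finset.sum_nonneg fun i hi => ha i (by simp [hi]))]

theorem prod_rpow {ι : Type*} (s : Finset ι) (x : ι → ℝ≥0∞) {a : ℝ} (ha : 0 ≤ a) :
    ∏ i ∈ s, x i ^ a = (∏ i ∈ s, x i) ^ a := (ENNReal.prod_rpow_of_nonneg ha)

/-- The Loomis–Whitney inequality for integrals along lines of different functions. -/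
theorem lintegral_prod_lintegral_line_rpow_le (hn : 2 ≤ n)
    {F : Fin n → (Fin n → ℝ) → ℝ≥0∞} (hF : ∀ i, Measurable (F i))
    (hfin : ∀ i, ∫⁻ x, F i x ≠ ⊤) :
    ∫⁻ x, ∏ i, (∫⁻ t, F i (Function.update x i t)) ^ ((1 : ℝ) / ((n : ℝ) - 1)) ≤
      (n : ℝ≥0∞) ^ ((n : ℝ) / ((n : ℝ) - 1)) *
        (∏ i, ∫⁻ x, F i x) ^ ((1 : ℝ) / ((n : ℝ) - 1)) := by
  set q : ℝ := (1 : ℝ) / ((n : ℝ) - 1) with hq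
  have hn1 : (0 : ℝ) < (n : ℝ) - 1 := by
    have : (2 : ℝ) ≤ n := by exact_mod_cast hn
    linarith
  have hq0 : 0 ≤ q := by positivity
  set A : Fin n → NNReal := fun i => (∫⁻ x, F i x).toNNReal with hAdef
  have hA : ∀ i, (A i : ℝ≥0∞) = ∫⁻ x, F i x := fun i => ENNReal.coe_toNNReal (hfin i)
  have main : ∀ ε : NNReal, 0 < ε →
      ∫⁻ x, ∏ i, (∫⁻ t, F i (Function.update x i t)) ^ q ≤
      (n : ℝ≥0∞) ^ ((n : ℝ) / ((n : ℝ) - 1)) * ((∏ i, (A i + ε) : NNReal) : ℝ≥0∞) ^ q := by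
    intro ε hε
    -- Normalising each F i reduces several functions to one: the sum f has integral at most n and
    -- dominates each lam i * F i. The shift by ε keeps the weights finite when F i has integral
    -- zero.
    set lam : Fin n → ℝ≥0∞ := fun i => ((A i + ε : NNReal) : ℝ≥0∞)⁻¹ with hlam
    set f : (Fin n → ℝ) → ℝ≥0∞ := fun x => ∑ i, lam i * F i x with hf
    have hfm : Measurable f := Finset.measurable_fun_sum _ fun i _ => (hF i).const_mul _
    have hconj : Real.HolderConjugate (Fintype.card (Fin n)) ((n : ℝ) / ((n : ℝ) - 1)) := by
      rw [Fintype.card_fin]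
      exact Real.HolderConjugate.conjExponent (by linarith)
    have h1 := lintegral_prod_lintegral_pow_le (fun _ : Fin n => (volume : Measure ℝ)) hconj hfm
    rw [Fintype.card_fin] at h1
    have h2 : ∫⁻ x, f x ≤ n := by
      rw [hf, lintegral_finsetSum _ fun i _ => (hF i).const_mul _]
      calc ∑ i, ∫⁻ x, lam i * F i x ≤ ∑ i : Fin n, 1 := by
            refine Finset.sum_le_sum fun i _ => ?_
            rw [lintegral_const_mul _ (hF i), ← hA i, hlam]
            simp only
            rw [mul_comm, ← div_eq_mul_inv]
            refine ENNReal.div_le_of_le_mul ?_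
            rw [one_mul]
            exact_mod_cast le_self_add
        _ = n := by simp
    have h3 : (∏ i, lam i) ^ q * ∫⁻ x, ∏ i, (∫⁻ t, F i (Function.update x i t)) ^ q ≤
        (n : ℝ≥0∞) ^ ((n : ℝ) / ((n : ℝ) - 1)) := by
      calc (∏ i, lam i) ^ q * ∫⁻ x, ∏ i, (∫⁻ t, F i (Function.update x i t)) ^ q
          ≤ ∫⁻ x, (∏ i, lam i) ^ q * ∏ i, (∫⁻ t, F i (Function.update x i t)) ^ q :=
            lintegral_const_mul_le _ _
        _ ≤ ∫⁻ x, ∏ i, (∫⁻ t, f (Function.update x i t)) ^ q := by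
            refine lintegral_mono fun x => ?_
            rw [← prod_rpow _ _ hq0, ← Finset.prod_mul_distrib]
            refine Finset.prod_le_prod' fun i _ => ?_
            rw [← ENNReal.mul_rpow_of_nonneg _ _ hq0]
            refine ENNReal.rpow_le_rpow ?_ hq0
            refine (lintegral_const_mul_le _ _).trans (lintegral_mono fun t => ?_)
            exact Finset.single_le_sum (f := fun j => lam j * F j (Function.update x i t))
              (fun _ _ => zero_le) (Finset.mem_univ i)
        _ ≤ (∫⁻ x, f x) ^ ((n : ℝ) / ((n : ℝ) - 1)) := h1
        _ ≤ _ := ENNReal.rpow_le_rpow h2 (by positivity)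
    have h4 : (∏ i, lam i) = ((∏ i, (A i + ε) : NNReal) : ℝ≥0∞)⁻¹ := by
      rw [ENNReal.ofNNReal_finsetProd, ENNReal.prod_inv_distrib]
      intro i _ j _ _
      left
      exact_mod_cast (by positivity : A i + ε ≠ 0)
    have h5 : (∏ i, (A i + ε) : NNReal) ≠ 0 := Finset.prod_ne_zero_iff.2 fun i _ => by positivity
    rw [h4, ENNReal.inv_rpow] at h3
    rw [mul_comm]
    rw [mul_comm, ← div_eq_mul_inv, ENNReal.div_le_iff_le_mul] at h3
    · rwa [mul_comm] at h3
    · left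
      exact (ENNReal.rpow_pos (by exact_mod_cast pos_iff_ne_zero.2 h5) ENNReal.coe_ne_top).ne'
    · left
      exact ENNReal.rpow_ne_top_of_nonneg hq0 ENNReal.coe_ne_top
  have hcont : Continuous (fun ε : NNReal => (n : ℝ≥0∞) ^ ((n : ℝ) / ((n : ℝ) - 1)) *
      ((∏ i, (A i + ε) : NNReal) : ℝ≥0∞) ^ q) := by
    refine ENNReal.continuous_const_mul ?_ |>.comp ?_
    · exact ENNReal.rpow_ne_top_of_nonneg (by positivity) (ENNReal.natCast_ne_top n)
    · refine ENNReal.continuous_rpow_const.comp (ENNReal.continuous_coe.comp ?_)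
      fun_prop
  -- The bound does not degenerate as ε → 0, so the normalisation is removed by continuity.
  have hlim := (hcont.tendsto 0).mono_left (nhdsWithin_le_nhds (s := Ioi 0))
  have := ge_of_tendsto hlim (eventually_nhdsWithin_of_forall fun ε hε => main ε hε)
  simpa [← hA] using this

/-- The exponent which scales like the gradient norm in the elliptic Sobolev inequality. -/
noncomputable def sobExp (n : ℕ) (S m : ℝ) : ℝ := ((n : ℝ) + S * (m - 2)) / (S - 1)

/-- The power of the solution which is differentiated in the direction with exponent `p`. -/
noncomputable def dirExp (n : ℕ) (S m p : ℝ) : ℝ := 1 + (m - 2) / p + sobExp n S m * (1 - 1 / p)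

/-- The exponents are dictated by three demands, with s = `sobExp`. The powers γ_i = `dirExp`
satisfy Σ γ_i/(n-1) = s, so that Loomis–Whitney reproduces ∫ v^s. The splitting γ_i - 1 = (m-2)/p_i
+ s(1 - 1/p_i) makes Hölder's inequality return the weighted energies and ∫ v^s again. Finally, v^r
interpolates between v^m and v^s with weights 1/S and 1 - 1/S. Finiteness of ∫ v^s is assumed so
that it can be cancelled. -/
theorem lintegral_rpow_le_of_line_bound (hn : 2 ≤ n) {p : Fin n → ℝ} (hp : ∀ i, 1 < p i)
    {S m : ℝ} (hS : S = ∑ i, 1 / p i) (hS1 : 1 < S) (hm : 2 < m) :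
    ∃ C : ℝ≥0∞, C ≠ ⊤ ∧ ∀ (v : (Fin n → ℝ) → ℝ≥0∞) (G : Fin n → (Fin n → ℝ) → ℝ≥0∞),
      Measurable v → (∀ i, Measurable (G i)) → ∫⁻ x, v x ^ sobExp n S m ≠ ⊤ →
      (∀ i, ∀ᵐ x, v x ^ dirExp n S m (p i) ≤ ∫⁻ t, (fun y => ENNReal.ofReal (dirExp n S m (p i)) *
        (v y ^ (dirExp n S m (p i) - 1) * G i y)) (Function.update x i t)) →
      ∫⁻ x, v x ^ (m / S + n / S + m - 2) ≤
        C * (∫⁻ x, v x ^ m) ^ (1 / S) * ∑ i, ∫⁻ x, v x ^ (m - 2) * G i x ^ p i := by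
  have hn2 : (2 : ℝ) ≤ n := by exact_mod_cast hn
  set q : ℝ := (1 : ℝ) / ((n : ℝ) - 1) with hq
  have hn1 : (0 : ℝ) < (n : ℝ) - 1 := by linarith
  have hq0 : 0 < q := by positivity
  set s := sobExp n S m with hs
  have hsS : s * (S - 1) = n + S * (m - 2) := by
    rw [hs, sobExp]; field_simp [(by linarith : S - 1 ≠ 0)]
  have hs0 : 0 < s := by
    rw [hs, sobExp]
    have : 0 < S * (m - 2) := mul_pos (by linarith) (by linarith)
    exact div_pos (by linarith) (by linarith)
  set γ : Fin n → ℝ := fun i => dirExp n S m (p i) with hγ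
  have hp0 : ∀ i, 0 < p i := fun i => by linarith [hp i]
  have hip : ∀ i, 0 < 1 - 1 / p i := fun i => by
    rw [sub_pos, div_lt_one (hp0 i)]; exact hp i
  have hγ1 : ∀ i, γ i - 1 = (m - 2) / p i + s * (1 - 1 / p i) := fun i => by
    simp only [hγ, dirExp]; ring
  have hmp : ∀ i, 0 < (m - 2) / p i := fun i => div_pos (by linarith) (hp0 i)
  have hγp : ∀ i, 0 < γ i := fun i => by
    have := mul_pos hs0 (hip i)
    linarith [hγ1 i, hmp i]
  have hsum1 : ∑ i, (1 - 1 / p i) = n - S := by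
    rw [Finset.sum_sub_distrib, ← hS]; simp
  have hγsum : ∑ i, γ i * q = s := by
    have h1 : ∑ i, γ i = n + (m - 2) * S + s * (n - S) := by
      rw [← hsum1, hS, Finset.mul_sum, Finset.mul_sum]
      simp only [hγ, dirExp, Finset.sum_add_distrib]
      simp only [Finset.sum_const, Finset.card_univ, Fintype.card_fin, nsmul_eq_mul, mul_one]
      congr 2
      exact Finset.sum_congr rfl fun i _ => by ring
    rw [← Finset.sum_mul, h1, hq, mul_one_div, div_eq_iff hn1.ne']
    linarith
  set C₀ : ℝ≥0∞ := (n : ℝ≥0∞) ^ ((n : ℝ) / ((n : ℝ) - 1)) *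
    (∏ i, ENNReal.ofReal (γ i)) ^ q with hC₀
  have hC₀t : C₀ ≠ ⊤ := ENNReal.mul_ne_top
    (ENNReal.rpow_ne_top_of_nonneg (by positivity) (ENNReal.natCast_ne_top n))
    (ENNReal.rpow_ne_top_of_nonneg hq0.le (ENNReal.prod_ne_top fun i _ => ENNReal.ofReal_ne_top))
  have hS0 : 0 < S := by linarith
  refine ⟨C₀ ^ (((n : ℝ) - 1) / S), ENNReal.rpow_ne_top_of_nonneg (by positivity) hC₀t, ?_⟩
  intro v G hv hG hfin hline
  set I := ∫⁻ x, v x ^ s with hI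
  set E : Fin n → ℝ≥0∞ := fun i => ∫⁻ x, v x ^ (m - 2) * G i x ^ p i with hE
  have hr : ∫⁻ x, v x ^ (m / S + n / S + m - 2) ≤ (∫⁻ x, v x ^ m) ^ (1 / S) * I ^ (1 - 1 / S) := by
    have e1 : m / S + n / S + m - 2 = m * (1 / S) + s * (1 - 1 / S) := by
      field_simp
      linarith
    have hS' : 0 < 1 - 1 / S := by rw [sub_pos, div_lt_one hS0]; exact hS1
    have h1 := ENNReal.lintegral_mul_le_Lp_mul_Lq (volume : Measure (Fin n → ℝ))
      (Real.HolderConjugate.conjExponent hS1) (f := fun x => v x ^ (m * (1 / S)))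
      (g := fun x => v x ^ (s * (1 - 1 / S))) (hv.pow_const _).aemeasurable
      (hv.pow_const _).aemeasurable
    have e2 : Real.conjExponent S = (1 - 1 / S)⁻¹ := by
      rw [Real.conjExponent]; field_simp
    simp only [Pi.mul_apply, e2, ← ENNReal.rpow_mul] at h1
    rw [mul_assoc, mul_assoc, one_div_mul_cancel hS0.ne', mul_inv_cancel₀ hS'.ne', mul_one,
      mul_one, one_div (1 - 1 / S)⁻¹, inv_inv] at h1
    rw [e1]
    refine le_trans (lintegral_mono fun x => ?_) h1
    rw [ENNReal.rpow_add_of_nonneg _ _ (by positivity) (by positivity)]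
  refine hr.trans ?_
  rw [mul_comm (C₀ ^ _), mul_assoc]
  gcongr
  -- If some energy is infinite there is nothing to prove, as C₀ ≠ 0. Otherwise Hölder's inequality
  -- makes the integrals of the F i finite, as Loomis–Whitney requires.
  by_cases hEt : ∃ i, E i = ⊤
  · obtain ⟨i, hi⟩ := hEt
    by_cases hC : C₀ = 0
    · have : (∏ i, ENNReal.ofReal (γ i)) ≠ 0 :=
        Finset.prod_ne_zero_iff.2 fun i _ => by simpa using hγp i
      rw [hC₀, mul_eq_zero] at hC
      rcases hC with hC | hC
      · simp at hC
        omega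
      · rw [ENNReal.rpow_eq_zero_iff_of_pos hq0] at hC
        exact absurd hC this
    · have h2 : ∑ i, E i = ⊤ := ENNReal.sum_eq_top.2 ⟨i, Finset.mem_univ i, hi⟩
      rw [h2, ENNReal.mul_top]
      · exact le_top
      · exact (ENNReal.rpow_pos (pos_iff_ne_zero.2 hC) hC₀t).ne'
  push Not at hEt
  by_cases hI0 : I = 0
  · rw [hI0, ENNReal.zero_rpow_of_pos]
    · exact zero_le
    · rw [sub_pos, div_lt_one hS0]; exact hS1
  -- Hölder's inequality for the line integrals
  set F : Fin n → (Fin n → ℝ) → ℝ≥0∞ := fun i y =>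
    ENNReal.ofReal (γ i) * (v y ^ (γ i - 1) * G i y) with hF
  have hFm : ∀ i, Measurable (F i) := fun i =>
    ((hv.pow_const _).mul (hG i)).const_mul _
  have hFle : ∀ i, ∫⁻ x, F i x ≤
      ENNReal.ofReal (γ i) * (E i ^ (1 / p i) * I ^ (1 - 1 / p i)) := by
    intro i
    have h0 : Measurable fun y => v y ^ (γ i - 1) * G i y := (hv.pow_const _).mul (hG i)
    simp only [hF]
    rw [lintegral_const_mul _ h0]
    gcongr
    have h1 := ENNReal.lintegral_mul_le_Lp_mul_Lq (volume : Measure (Fin n → ℝ))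
      (Real.HolderConjugate.conjExponent (hp i)) (f := fun x => v x ^ ((m - 2) / p i) * G i x)
      (g := fun x => v x ^ (s * (1 - 1 / p i))) ((hv.pow_const _).mul (hG i)).aemeasurable
      (hv.pow_const _).aemeasurable
    have e2 : Real.conjExponent (p i) = (1 - 1 / p i)⁻¹ := by
      rw [Real.conjExponent]
      have := hp0 i
      field_simp
    simp only [Pi.mul_apply, e2, ← ENNReal.rpow_mul, ENNReal.mul_rpow_of_nonneg _ _ (hp0 i).le] at h1
    rw [div_mul_cancel₀ _ (hp0 i).ne', mul_assoc s, mul_inv_cancel₀ (hip i).ne', mul_one,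
      one_div (1 - 1 / p i)⁻¹, inv_inv] at h1
    refine le_trans (lintegral_mono fun x => ?_) h1
    rw [hγ1, ENNReal.rpow_add_of_nonneg _ _ (hmp i).le (mul_pos hs0 (hip i)).le]
    rw [mul_right_comm]
  have hFfin : ∀ i, ∫⁻ x, F i x ≠ ⊤ := fun i => by
    refine ne_top_of_le_ne_top ?_ (hFle i)
    exact ENNReal.mul_ne_top ENNReal.ofReal_ne_top (ENNReal.mul_ne_top
      (ENNReal.rpow_ne_top_of_nonneg (by have := hp0 i; positivity) (hEt i))
      (ENNReal.rpow_ne_top_of_nonneg (hip i).le hfin))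
  have hLW := lintegral_prod_lintegral_line_rpow_le hn hFm hFfin
  have hI1 : I ≤ C₀ * (∏ i, E i ^ (1 / p i)) ^ q * (I ^ (n - S)) ^ q := by
    calc I ≤ ∫⁻ x, ∏ i, (∫⁻ t, F i (Function.update x i t)) ^ q := by
          refine lintegral_mono_ae ?_
          filter_upwards [ae_all_iff.2 hline] with x hx
          rw [← hγsum, ← prod_rpow_eq_rpow_sum _ _ _ fun i _ => mul_nonneg (hγp i).le hq0.le]
          refine Finset.prod_le_prod' fun i _ => ?_
          rw [ENNReal.rpow_mul]
          exact ENNReal.rpow_le_rpow (hx i) hq0.le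
      _ ≤ _ := hLW
      _ ≤ (n : ℝ≥0∞) ^ ((n : ℝ) / ((n : ℝ) - 1)) * (∏ i, ENNReal.ofReal (γ i) *
            (E i ^ (1 / p i) * I ^ (1 - 1 / p i))) ^ q := by
          gcongr with i
          exact hFle i
      _ = _ := by
          rw [Finset.prod_mul_distrib, Finset.prod_mul_distrib,
            prod_rpow_eq_rpow_sum _ _ _ fun i _ => (hip i).le, hsum1,
            ENNReal.mul_rpow_of_nonneg _ _ hq0.le, ENNReal.mul_rpow_of_nonneg _ _ hq0.le, hC₀]
          ring
  have hnS : 0 ≤ (n : ℝ) - S := by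
    rw [← hsum1]; exact Finset.sum_nonneg fun i _ => (hip i).le
  -- The absorption: n - 1 = (S - 1) + (n - S), and the factor I^(n-S) cancels since 0 < I < ∞.
  have hI2 : I ^ (S - 1) ≤ C₀ ^ ((n : ℝ) - 1) * ∏ i, E i ^ (1 / p i) := by
    have h1 := ENNReal.rpow_le_rpow hI1 hn1.le
    rw [ENNReal.mul_rpow_of_nonneg _ _ hn1.le, ENNReal.mul_rpow_of_nonneg _ _ hn1.le,
      ← ENNReal.rpow_mul, ← ENNReal.rpow_mul, hq, one_div_mul_cancel hn1.ne', ENNReal.rpow_one,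
      ENNReal.rpow_one, (by ring : (n : ℝ) - 1 = (S - 1) + (n - S)),
      ENNReal.rpow_add _ _ hI0 hfin] at h1
    rw [← (by ring : (n : ℝ) - 1 = (S - 1) + (n - S))] at h1
    refine (ENNReal.mul_le_mul_iff_left ?_ ?_).1 h1
    · exact (ENNReal.rpow_pos (pos_iff_ne_zero.2 hI0) hfin).ne'
    · exact ENNReal.rpow_ne_top_of_nonneg hnS hfin
  have h3 := ENNReal.rpow_le_rpow hI2 (by positivity : 0 ≤ 1 / S)
  rw [← ENNReal.rpow_mul, ENNReal.mul_rpow_of_nonneg _ _ (by positivity), ← ENNReal.rpow_mul,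
    mul_one_div, mul_one_div, sub_div, div_self hS0.ne', ← prod_rpow _ _ (by positivity)] at h3
  refine h3.trans ?_
  rw [sub_div]
  gcongr
  -- The exponents 1/(p_i S) sum to 1, so a product of powers of the energies is at most their sum.
  calc ∏ i, (E i ^ (1 / p i)) ^ (1 / S) ≤ ∏ i : Fin n, (∑ j, E j) ^ (1 / p i * (1 / S)) := by
        refine Finset.prod_le_prod' fun i _ => ?_
        rw [← ENNReal.rpow_mul]
        refine ENNReal.rpow_le_rpow (Finset.single_le_sum (fun _ _ => zero_le)
          (Finset.mem_univ i)) ?_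
        have := hp0 i
        positivity
    _ = ∑ j, E j := by
        rw [prod_rpow_eq_rpow_sum, ← Finset.sum_mul, ← hS, mul_one_div_cancel hS0.ne',
          ENNReal.rpow_one]
        intro i _
        have := hp0 i
        positivity

/-- The anisotropic Sobolev inequality for a truncation times a cut-off function. -/
theorem lintegral_truncation_rpow_le (hn : 2 ≤ n) {p : Fin n → ℝ} (hp : ∀ i, 1 < p i)
    {S m : ℝ} (hS : S = ∑ i, 1 / p i) (hS1 : 1 < S) (hm : 2 < m) :
    ∃ C : ℝ≥0∞, C ≠ ⊤ ∧ ∀ (l r : Fin n → ℝ) (f : (Fin n → ℝ) → ℝ)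
      (g : Fin n → (Fin n → ℝ) → ℝ) (χ : (Fin n → ℝ) → ℝ) (k : ℝ),
      Measurable f → (∀ i, Measurable (g i)) →
      IntegrableOn f (univ.pi fun j => Ioo (l j) (r j)) →
      (∀ i, IntegrableOn (g i) (univ.pi fun j => Ioo (l j) (r j))) →
      (∀ i, ∀ φ : (Fin n → ℝ) → ℝ, ContDiff ℝ ∞ φ → HasCompactSupport φ →
        tsupport φ ⊆ univ.pi (fun j => Ioo (l j) (r j)) →
        ∫ x in univ.pi (fun j => Ioo (l j) (r j)), f x * fderiv ℝ φ x (Pi.single i 1) =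
          -∫ x in univ.pi (fun j => Ioo (l j) (r j)), g i x * φ x) →
      ContDiff ℝ 1 χ → (∀ x, χ x ∈ Icc (0 : ℝ) 1) →
      (∀ x, x ∉ univ.pi (fun j => Ioo (l j) (r j)) → χ x = 0) →
      ∫⁻ x in univ.pi (fun j => Ioo (l j) (r j)),
          ENNReal.ofReal (max (f x - k) 0 * χ x) ^ (m / S + n / S + m - 2) ≤
        C * (∫⁻ x in univ.pi (fun j => Ioo (l j) (r j)),
            ENNReal.ofReal (max (f x - k) 0 * χ x) ^ m) ^ (1 / S) *
          ∑ i, ∫⁻ x in univ.pi (fun j => Ioo (l j) (r j)),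
            ENNReal.ofReal (max (f x - k) 0 * χ x) ^ (m - 2) *
              ENNReal.ofReal ({x | k < f x}.indicator (fun x => |g i x|) x * χ x +
                max (f x - k) 0 * |fderiv ℝ χ x (Pi.single i 1)|) ^ p i := by
  obtain ⟨C, hCt, hC⟩ := lintegral_rpow_le_of_line_bound hn hp hS hS1 hm
  refine ⟨C, hCt, ?_⟩
  intro l r f g χ k hf hg hfi hgi hw hχ hχ01 hχB
  set B : Set (Fin n → ℝ) := univ.pi (fun j => Ioo (l j) (r j)) with hB
  have hBm : MeasurableSet B := MeasurableSet.univ_pi fun _ => measurableSet_Ioo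
  have hBfin : volume B ≠ ⊤ := by
    rw [hB, Real.volume_pi_Ioo]
    exact ENNReal.prod_ne_top fun _ _ => ENNReal.ofReal_ne_top
  have hS0 : 0 < S := by linarith
  have hχ0 : ∀ x, 0 ≤ χ x := fun x => (hχ01 x).1
  have hdχ : ∀ i, Measurable fun x => fderiv ℝ χ x (Pi.single i 1) := fun i =>
    ((hχ.continuous_fderiv one_ne_zero).clm_apply continuous_const).measurable
  set W : (Fin n → ℝ) → ℝ≥0∞ := fun x => ENNReal.ofReal (max (f x - k) 0 * χ x) with hW
  set H : Fin n → (Fin n → ℝ) → ℝ≥0∞ := fun i x =>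
    ENNReal.ofReal ({x | k < f x}.indicator (fun x => |g i x|) x * χ x +
      max (f x - k) 0 * |fderiv ℝ χ x (Pi.single i 1)|) with hH
  have hWm : Measurable W :=
    (((hf.sub_const k).max measurable_const).mul hχ.continuous.measurable).ennreal_ofReal
  have hHm : ∀ i, Measurable (H i) := fun i => by
    refine Measurable.ennreal_ofReal ?_
    refine ((Measurable.indicator (hg i).abs ?_).mul hχ.continuous.measurable).add
      (((hf.sub_const k).max measurable_const).mul (hdχ i).abs)
    exact measurableSet_lt measurable_const hf
  have hWB : ∀ x, x ∉ B → W x = 0 := fun x hx => by simp [hW, hχB x hx]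
  have hsp : 0 < sobExp n S m := by
    have : 0 < S * (m - 2) := mul_pos hS0 (by linarith)
    have hn2 : (0 : ℝ) < n := by exact_mod_cast (by omega : 0 < n)
    exact div_pos (by linarith) (by linarith)
  -- Truncation at height N makes ∫ v^s finite on the bounded box, while the right side does not
  -- involve N. Monotone convergence then removes N.
  have step : ∀ N : ℕ, ∫⁻ x, (B.indicator (fun x =>
      ENNReal.ofReal (trunc k N (f x) * χ x)) x) ^ (m / S + n / S + m - 2) ≤
      C * (∫⁻ x in B, W x ^ m) ^ (1 / S) * ∑ i, ∫⁻ x in B, W x ^ (m - 2) * H i x ^ p i := by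
    intro N
    have hN : (0 : ℝ) ≤ N := Nat.cast_nonneg N
    set v : (Fin n → ℝ) → ℝ≥0∞ := B.indicator fun x =>
      ENNReal.ofReal (trunc k N (f x) * χ x) with hv
    have hvm : Measurable v := by
      refine Measurable.indicator ?_ hBm
      refine (Measurable.mul ?_ hχ.continuous.measurable).ennreal_ofReal
      exact ((hf.sub_const k).max measurable_const).min measurable_const
    have hvW : ∀ x, v x ≤ B.indicator W x := fun x => by
      refine indicator_le_indicator (ENNReal.ofReal_le_ofReal ?_)
      exact mul_le_mul_of_nonneg_right (trunc_le_pos _ _ _) (hχ0 x)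
    have hvN : ∀ x, v x ≤ B.indicator (fun _ => ENNReal.ofReal N) x := fun x => by
      refine indicator_le_indicator (ENNReal.ofReal_le_ofReal ?_)
      calc trunc k N (f x) * χ x ≤ N * 1 :=
            mul_le_mul (trunc_le _ _ _) (hχ01 x).2 (hχ0 x) hN
        _ = N := mul_one _
    have hind : ∀ (F : (Fin n → ℝ) → ℝ≥0∞) (a : ℝ), 0 < a → ∀ x,
        B.indicator F x ^ a = B.indicator (fun x => F x ^ a) x := by
      intro F a ha x
      by_cases hx : x ∈ B <;> simp [hx, ha]
    have hfin : ∫⁻ x, v x ^ sobExp n S m ≠ ⊤ := by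
      refine ne_top_of_le_ne_top ?_ (lintegral_mono fun x => ENNReal.rpow_le_rpow (hvN x) hsp.le)
      simp only [hind _ _ hsp]
      rw [lintegral_indicator hBm, setLIntegral_const]
      exact ENNReal.mul_ne_top (ENNReal.rpow_ne_top_of_nonneg hsp.le ENNReal.ofReal_ne_top) hBfin
    have hline : ∀ i, ∀ᵐ x, v x ^ dirExp n S m (p i) ≤
        ∫⁻ t, (fun y => ENNReal.ofReal (dirExp n S m (p i)) *
        (v y ^ (dirExp n S m (p i) - 1) * H i y)) (Function.update x i t) := by
      intro i
      have hpi : 0 < p i := by linarith [hp i]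
      have hγ : 1 < dirExp n S m (p i) := by
        have h1 : 0 < (m - 2) / p i := div_pos (by linarith) hpi
        have h2 : 0 < 1 - 1 / p i := by rw [sub_pos, div_lt_one hpi]; exact hp i
        have := mul_pos hsp h2
        rw [dirExp]
        linarith
      -- Extension by zero gives functions integrable on the whole space. It need not be weakly
      -- differentiable across the boundary, since only test functions supported in B are used.
      have h1 := ofReal_rpow_trunc_le_lintegral_line (l := l) (r := r) (f := B.indicator f)
        (g := B.indicator (g i)) ((integrable_indicator_iff hBm).2 hfi)
        ((integrable_indicator_iff hBm).2 (hgi i)) (hf.indicator hBm) ((hg i).indicator hBm) i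
        ?_ hχ hχ0 hχB (k := k) hN hγ.le
      · filter_upwards [h1] with x hx
        have e1 : ∀ y, ENNReal.ofReal (trunc k N (B.indicator f y) * χ y) = v y := fun y => by
          by_cases hy : y ∈ B
          · simp [hv, hy]
          · simp [hv, hy, hχB y hy]
        have nn : ∀ y, 0 ≤ trunc k N (B.indicator f y) * χ y := fun y =>
          mul_nonneg (trunc_nonneg hN _) (hχ0 y)
        rw [← ENNReal.ofReal_rpow_of_nonneg (nn x) (by linarith), e1] at hx
        refine hx.trans (lintegral_mono fun t => ?_)
        generalize Function.update x i t = y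
        simp only
        rw [mul_assoc, ENNReal.ofReal_mul (by linarith),
          ENNReal.ofReal_mul (Real.rpow_nonneg (nn y) _),
          ← ENNReal.ofReal_rpow_of_nonneg (nn y) (by linarith), e1]
        refine mul_le_mul' le_rfl ?_
        -- Elsewhere v vanishes, and so does its positive power γ - 1. This is why the gradient may
        -- be restricted to the superlevel set.
        by_cases hy : y ∈ B ∧ k < f y
        · refine mul_le_mul' le_rfl (ENNReal.ofReal_le_ofReal ?_)
          simp only [indicator_of_mem hy.1]
          rw [indicator_of_mem (show y ∈ {x | k < f x} from hy.2)]
          gcongr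
          exact trunc_le_pos _ _ _
        · have hv0 : v y = 0 := by
            by_cases hyB : y ∈ B
            · have : f y ≤ k := not_lt.1 fun h => hy ⟨hyB, h⟩
              simp [hv, hyB, trunc, this]
            · simp [hv, hyB]
          rw [hv0, ENNReal.zero_rpow_of_pos (by linarith), zero_mul, zero_mul]
      · intro φ h1 h2 h3
        have h4 := hw i φ h1 h2 h3
        rw [← integral_indicator hBm, ← integral_indicator hBm] at h4
        simpa only [indicator_mul_left] using h4
    refine (hC v H hvm hHm hfin hline).trans ?_
    refine mul_le_mul' (mul_le_mul' le_rfl (ENNReal.rpow_le_rpow ?_ (by positivity)))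
      (Finset.sum_le_sum fun i _ => ?_)
    · rw [← lintegral_indicator hBm]
      refine lintegral_mono fun x => ?_
      rw [← hind _ _ (by linarith)]
      exact ENNReal.rpow_le_rpow (hvW x) (by linarith)
    · rw [← lintegral_indicator hBm]
      refine lintegral_mono fun x => ?_
      simp only
      rw [indicator_mul_left (s := B) (fun x => W x ^ (m - 2)), ← hind _ _ (by linarith)]
      exact mul_le_mul' (ENNReal.rpow_le_rpow (hvW x) (by linarith)) le_rfl
  have hre : 0 ≤ m / S + n / S + m - 2 := by
    have : 0 ≤ m / S + n / S := by positivity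
    linarith
  have htend : ∀ x, Filter.Tendsto (fun N : ℕ => (B.indicator (fun x =>
      ENNReal.ofReal (trunc k N (f x) * χ x)) x) ^ (m / S + n / S + m - 2)) Filter.atTop
      (nhds (B.indicator W x ^ (m / S + n / S + m - 2))) := by
    intro x
    refine tendsto_const_nhds.congr' ?_
    obtain ⟨N₀, hN₀⟩ := exists_nat_ge (max (f x - k) 0)
    filter_upwards [Filter.eventually_ge_atTop N₀] with N hN
    have h1 : trunc k N (f x) = max (f x - k) 0 :=
      min_eq_left (hN₀.trans (by exact_mod_cast hN))
    by_cases hx : x ∈ B <;> simp [hx, hW, h1]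
  have hmono : ∀ x, Monotone (fun N : ℕ => (B.indicator (fun x =>
      ENNReal.ofReal (trunc k N (f x) * χ x)) x) ^ (m / S + n / S + m - 2)) := by
    intro x N M hNM
    refine ENNReal.rpow_le_rpow (indicator_le_indicator (ENNReal.ofReal_le_ofReal ?_)) hre
    refine mul_le_mul_of_nonneg_right (min_le_min_left _ ?_) (hχ0 x)
    exact_mod_cast hNM
  have hlim := lintegral_tendsto_of_tendsto_of_monotone (μ := volume)
    (fun N => Measurable.aemeasurable (Measurable.pow_const (Measurable.indicator
      (Measurable.ennreal_ofReal (Measurable.mul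
        (((hf.sub_const k).max measurable_const).min measurable_const)
          hχ.continuous.measurable)) hBm) _))
    (Filter.Eventually.of_forall hmono) (Filter.Eventually.of_forall htend)
  refine le_trans (le_of_eq ?_) (le_of_tendsto' hlim step)
  rw [← lintegral_indicator hBm]
  refine lintegral_congr fun x => ?_
  by_cases hx : x ∈ B
  · rw [indicator_of_mem hx, indicator_of_mem hx]
  · simp only [indicator_of_notMem hx]
    rw [ENNReal.zero_rpow_of_pos]
    have : 0 < m / S := by positivity
    have : 0 ≤ n / S := by positivity
    linarith

/-! ### Cut-off functions -/

/-- For x > 0 this is exp(-1/x)^p = exp(-1/(x/p)). A real power of the glue function is a rescaled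
glue function, hence smooth even where it vanishes. -/
theorem expNegInvGlue_rpow {p : ℝ} (hp : 0 < p) (x : ℝ) :
    expNegInvGlue x ^ p = expNegInvGlue (x / p) := by
  unfold expNegInvGlue
  by_cases hx : x ≤ 0
  · rw [if_pos hx, if_pos (div_nonpos_of_nonpos_of_nonneg hx hp.le), Real.zero_rpow hp.ne']
  · have hx' : 0 < x := not_le.1 hx
    rw [if_neg hx, if_neg (not_le.2 (div_pos hx' hp)), ← Real.exp_mul]
    congr 1
    field_simp

/-- The cut-offs contain factors η_i^(p_i) with non-integer p_i, for which smoothness at the zeros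
of η_i is not automatic. Here the numerator's power is again a glue function and the denominator is
positive. -/
theorem contDiff_smoothTransition_rpow {p : ℝ} (hp : 0 < p) :
    ContDiff ℝ ∞ (fun x => Real.smoothTransition x ^ p) := by
  have h : (fun x => Real.smoothTransition x ^ p) = fun x =>
      expNegInvGlue (x / p) * (expNegInvGlue x + expNegInvGlue (1 - x)) ^ (-p) := by
    ext x
    have := Real.smoothTransition.pos_denom x
    rw [Real.smoothTransition, Real.div_rpow (expNegInvGlue.nonneg _) this.le,
      expNegInvGlue_rpow hp, Real.rpow_neg this.le, div_eq_mul_inv]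
  rw [h]
  refine ContDiff.mul (expNegInvGlue.contDiff.comp (contDiff_id.div_const p)) ?_
  refine ContDiff.rpow_const_of_ne ?_ fun x => (Real.smoothTransition.pos_denom x).ne'
  exact expNegInvGlue.contDiff.add (expNegInvGlue.contDiff.comp (contDiff_const.sub contDiff_id))

theorem exists_abs_deriv_smoothTransition_le :
    ∃ A : ℝ, 0 < A ∧ ∀ x, |deriv Real.smoothTransition x| ≤ A := by
  have hc : Continuous (deriv Real.smoothTransition) :=
    (Real.smoothTransition.contDiff (n := 1)).continuous_deriv le_rfl
  obtain ⟨A, hA⟩ := isCompact_Icc.exists_bound_of_continuousOn (s := Icc (0 : ℝ) 1) hc.continuousOn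
  refine ⟨max A 1, by positivity, fun x => ?_⟩
  rcases lt_or_ge x 0 with hx | hx
  · have : Real.smoothTransition =ᶠ[nhds x] fun _ => 0 := by
      filter_upwards [gt_mem_nhds hx] with y hy
      exact Real.smoothTransition.zero_of_nonpos hy.le
    rw [this.deriv_eq]
    simp
  rcases lt_or_ge 1 x with hx' | hx'
  · have : Real.smoothTransition =ᶠ[nhds x] fun _ => 1 := by
      filter_upwards [lt_mem_nhds hx'] with y hy
      exact Real.smoothTransition.one_of_one_le hy.le
    rw [this.deriv_eq]
    simp
  · exact (hA x ⟨hx, hx'⟩).trans (le_max_left _ _)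

/-- A smooth function which is `1` on `[c - (a - d), c + (a - d)]` and `0` outside
`(c - a, c + a)`. -/
noncomputable def bump (c a d s : ℝ) : ℝ :=
  Real.smoothTransition ((c + a - s) / d) * Real.smoothTransition ((s - (c - a)) / d)

theorem contDiff_bump (c a d : ℝ) : ContDiff ℝ ∞ (bump c a d) :=
  (Real.smoothTransition.contDiff.comp ((contDiff_const.sub contDiff_id).div_const d)).mul
    (Real.smoothTransition.contDiff.comp ((contDiff_id.sub contDiff_const).div_const d))

theorem contDiff_bump_rpow (c a d : ℝ) {p : ℝ} (hp : 0 < p) :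
    ContDiff ℝ ∞ (fun s => bump c a d s ^ p) := by
  have h : (fun s => bump c a d s ^ p) = fun s =>
      Real.smoothTransition ((c + a - s) / d) ^ p *
        Real.smoothTransition ((s - (c - a)) / d) ^ p := by
    ext s
    exact Real.mul_rpow (Real.smoothTransition.nonneg _) (Real.smoothTransition.nonneg _)
  rw [h]
  exact ((contDiff_smoothTransition_rpow hp).comp
    ((contDiff_const.sub contDiff_id).div_const d)).mul ((contDiff_smoothTransition_rpow hp).comp
      ((contDiff_id.sub contDiff_const).div_const d))

theorem bump_mem_Icc (c a d s : ℝ) : bump c a d s ∈ Icc (0 : ℝ) 1 :=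
  ⟨mul_nonneg (Real.smoothTransition.nonneg _) (Real.smoothTransition.nonneg _),
    mul_le_one₀ (Real.smoothTransition.le_one _) (Real.smoothTransition.nonneg _)
      (Real.smoothTransition.le_one _)⟩

theorem bump_eq_zero {c a d s : ℝ} (hd : 0 < d) (hs : s ∉ Ioo (c - a) (c + a)) :
    bump c a d s = 0 := by
  rw [mem_Ioo, not_and_or, not_lt, not_lt] at hs
  rcases hs with hs | hs
  · rw [bump, Real.smoothTransition.zero_of_nonpos (x := (s - (c - a)) / d), mul_zero]
    exact div_nonpos_of_nonpos_of_nonneg (by linarith) hd.le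
  · rw [bump, Real.smoothTransition.zero_of_nonpos (x := (c + a - s) / d), zero_mul]
    exact div_nonpos_of_nonpos_of_nonneg (by linarith) hd.le

theorem bump_eq_one {c a d s : ℝ} (hd : 0 < d) (hs : s ∈ Icc (c - (a - d)) (c + (a - d))) :
    bump c a d s = 1 := by
  rw [bump, Real.smoothTransition.one_of_one_le, Real.smoothTransition.one_of_one_le, mul_one]
  · rw [le_div_iff₀ hd]; linarith [hs.1]
  · rw [le_div_iff₀ hd]; linarith [hs.2]

theorem tsupport_bump_subset {c a d : ℝ} (hd : 0 < d) :
    tsupport (bump c a d) ⊆ Icc (c - a) (c + a) := by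
  refine closure_minimal (fun s hs => ?_) isClosed_Icc
  by_contra h
  exact hs (bump_eq_zero hd fun h' => h (Ioo_subset_Icc_self h'))

theorem abs_deriv_bump_le {A c a d : ℝ} (hd : 0 < d)
    (hA : ∀ x, |deriv Real.smoothTransition x| ≤ A) (s : ℝ) :
    |deriv (bump c a d) s| ≤ 2 * A / d := by
  have hdiff : Differentiable ℝ Real.smoothTransition :=
    (Real.smoothTransition.contDiff (n := 1)).differentiable one_ne_zero
  have h1 : HasDerivAt (fun s => Real.smoothTransition ((c + a - s) / d))
      (deriv Real.smoothTransition ((c + a - s) / d) * (-1 / d)) s := by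
    have h : HasDerivAt (fun s : ℝ => (c + a - s) / d) (-1 / d) s :=
      ((hasDerivAt_id s).const_sub (c + a)).div_const d
    exact (hdiff _).hasDerivAt.comp s h
  have h2 : HasDerivAt (fun s => Real.smoothTransition ((s - (c - a)) / d))
      (deriv Real.smoothTransition ((s - (c - a)) / d) * (1 / d)) s := by
    have h : HasDerivAt (fun s : ℝ => (s - (c - a)) / d) (1 / d) s :=
      ((hasDerivAt_id s).sub_const (c - a)).div_const d
    exact (hdiff _).hasDerivAt.comp s h
  have h3 : HasDerivAt (bump c a d) _ s := h1.mul h2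
  rw [h3.deriv]
  have hd' : |d| = d := abs_of_pos hd
  refine (abs_add_le _ _).trans ?_
  rw [abs_mul, abs_mul, abs_mul, abs_mul, abs_div, abs_div, abs_neg, abs_one, hd',
    abs_of_nonneg (Real.smoothTransition.nonneg _), abs_of_nonneg (Real.smoothTransition.nonneg _)]
  have hA0 : 0 ≤ A := (abs_nonneg _).trans (hA 0)
  calc _ ≤ A * (1 / d) * 1 + 1 * (A * (1 / d)) := by
        gcongr
        all_goals first
          | exact hA _
          | exact Real.smoothTransition.le_one _
          | exact Real.smoothTransition.nonneg _
    _ = 2 * A / d := by ring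

/-- The box with half-sides `σ ρ ^ (1 / p i)`. -/
def sbox (p x₀ : Fin n → ℝ) (ρ σ : ℝ) : Set (Fin n → ℝ) :=
  univ.pi fun i => Ioo (x₀ i - σ * ρ ^ (1 / p i)) (x₀ i + σ * ρ ^ (1 / p i))

/-- The cylinder over `sbox` of height `σ ρ`. -/
def scyl (p x₀ : Fin n → ℝ) (t₀ ρ σ : ℝ) : Set ((Fin n → ℝ) × ℝ) :=
  sbox p x₀ ρ σ ×ˢ Ioo (t₀ - σ * ρ) t₀

theorem sbox_one (p x₀ : Fin n → ℝ) (ρ : ℝ) : sbox p x₀ ρ 1 = box p x₀ ρ := by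
  simp [sbox, box]

theorem scyl_one (p x₀ : Fin n → ℝ) (t₀ ρ : ℝ) : scyl p x₀ t₀ ρ 1 = Q p x₀ t₀ ρ := by
  simp [scyl, Q, sbox_one]

theorem measurableSet_sbox (p x₀ : Fin n → ℝ) (ρ σ : ℝ) : MeasurableSet (sbox p x₀ ρ σ) :=
  MeasurableSet.univ_pi fun _ => measurableSet_Ioo

theorem measurableSet_scyl (p x₀ : Fin n → ℝ) (t₀ ρ σ : ℝ) : MeasurableSet (scyl p x₀ t₀ ρ σ) :=
  (measurableSet_sbox p x₀ ρ σ).prod measurableSet_Ioo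

theorem sbox_mono (p x₀ : Fin n → ℝ) {ρ σ σ' : ℝ} (hρ : 0 < ρ) (h : σ' ≤ σ) :
    sbox p x₀ ρ σ' ⊆ sbox p x₀ ρ σ := by
  refine pi_mono fun i _ => Ioo_subset_Ioo ?_ ?_ <;>
  · have := mul_le_mul_of_nonneg_right h (Real.rpow_pos_of_pos hρ (1 / p i)).le
    linarith

theorem scyl_mono (p x₀ : Fin n → ℝ) (t₀ : ℝ) {ρ σ σ' : ℝ} (hρ : 0 < ρ) (h : σ' ≤ σ) :
    scyl p x₀ t₀ ρ σ' ⊆ scyl p x₀ t₀ ρ σ := by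
  refine prod_mono (sbox_mono p x₀ hρ h) (Ioo_subset_Ioo_left ?_)
  nlinarith

/-- Because p < 2, one has 4/3 < √2 < 2^(1/p). Dilations σ ≤ 4/3 of the box of radius ρ therefore
stay in the box of radius 2ρ, and strictness leaves room for the closed supports of the cut-offs. -/
theorem mul_rpow_lt_two_mul_rpow {p ρ σ : ℝ} (hp : 1 < p) (hp2 : p < 2) (hρ : 0 < ρ)
    (hσ : σ ≤ 4 / 3) : σ * ρ ^ (1 / p) < (2 * ρ) ^ (1 / p) := by
  rw [Real.mul_rpow (by norm_num) hρ.le]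
  refine mul_lt_mul_of_pos_right (lt_of_le_of_lt hσ ?_) (Real.rpow_pos_of_pos hρ _)
  have h1 : (4 / 3 : ℝ) < 2 ^ (1 / 2 : ℝ) := by
    rw [← Real.sqrt_eq_rpow]
    exact Real.lt_sqrt_of_sq_lt (by norm_num)
  refine h1.trans_le (Real.rpow_le_rpow_of_exponent_le (by norm_num) ?_)
  exact one_div_le_one_div_of_le (by linarith) hp2.le

theorem sbox_subset_box {p : Fin n → ℝ} (hp : ∀ i, 1 < p i) (hp2 : ∀ i, p i < 2)
    (x₀ : Fin n → ℝ) {ρ σ : ℝ} (hρ : 0 < ρ) (hσ : σ ≤ 4 / 3) :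
    sbox p x₀ ρ σ ⊆ box p x₀ (2 * ρ) := by
  refine pi_mono fun i _ => Ioo_subset_Ioo ?_ ?_ <;>
  · have := mul_rpow_lt_two_mul_rpow (hp i) (hp2 i) hρ hσ
    linarith

theorem scyl_subset_Q {p : Fin n → ℝ} (hp : ∀ i, 1 < p i) (hp2 : ∀ i, p i < 2)
    (x₀ : Fin n → ℝ) (t₀ : ℝ) {ρ σ : ℝ} (hρ : 0 < ρ) (hσ : σ ≤ 4 / 3) :
    scyl p x₀ t₀ ρ σ ⊆ Q p x₀ t₀ (2 * ρ) := by
  refine prod_mono (sbox_subset_box hp hp2 x₀ hρ hσ) (Ioo_subset_Ioo_left ?_)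
  nlinarith

theorem prod_update_eq (F : Fin n → ℝ → ℝ) (x : Fin n → ℝ) (i : Fin n) (s : ℝ) :
    ∏ j, F j (Function.update x i s j) = F i s * ∏ j ∈ Finset.univ.erase i, F j (x j) := by
  rw [← Finset.mul_prod_erase _ _ (Finset.mem_univ i)]
  congr 1
  · simp
  · refine Finset.prod_congr rfl fun j hj => ?_
    rw [Function.update_of_ne (Finset.ne_of_mem_erase hj)]

/-- Cut-off functions between two concentric cylinders, with bounds for their derivatives. -/
theorem exists_cutoff : ∃ A : ℝ, 1 ≤ A ∧ ∀ (n : ℕ) (p x₀ : Fin n → ℝ) (t₀ ρ σ σ' : ℝ),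
    (∀ i, 1 < p i) → (∀ i, p i < 2) → 0 < ρ → 1 ≤ σ' → σ' < σ → σ ≤ 4 / 3 →
    ∃ (ζ : (Fin n → ℝ) × ℝ → ℝ) (χ : (Fin n → ℝ) → ℝ),
      IsCutoff p x₀ t₀ (2 * ρ) ζ ∧ ContDiff ℝ 1 χ ∧ (∀ x, χ x ∈ Icc (0 : ℝ) 1) ∧
      (∀ x ∈ sbox p x₀ ρ σ', χ x = 1) ∧ (∀ x, x ∉ sbox p x₀ ρ σ → χ x = 0) ∧
      (∀ x t, t₀ - σ' * ρ ≤ t → ∀ e : ℝ, 1 ≤ e → χ x ^ e ≤ ζ (x, t)) ∧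
      (∀ x i, |fderiv ℝ χ x (Pi.single i 1)| ≤ A / ((σ - σ') * ρ ^ (1 / p i))) ∧
      (∀ z, 0 ≤ ζ z) ∧
      (∀ z : (Fin n → ℝ) × ℝ, z.2 < t₀ → z ∉ scyl p x₀ t₀ ρ σ → ζ z = 0) ∧
      (∀ z : (Fin n → ℝ) × ℝ, deriv (fun s => ζ (z.1, s)) z.2 ≤ A / ((σ - σ') * ρ)) ∧
      (∀ (z : (Fin n → ℝ) × ℝ) i,
        |deriv (fun s => ζ (Function.update z.1 i s, z.2) ^ (1 / p i)) (z.1 i)| ≤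
          A / ((σ - σ') * ρ ^ (1 / p i))) := by
  obtain ⟨A, hA0, hA⟩ := exists_abs_deriv_smoothTransition_le
  -- Differentiating η² costs 2 times the bound 2A for η'. The extra 1 ensures that the constant is
  -- at least 1.
  refine ⟨4 * A + 1, by linarith, ?_⟩
  intro n p x₀ t₀ ρ σ σ' hp hp2 hρ hσ' hσσ hσ
  have hp0 : ∀ i, 0 < p i := fun i => by linarith [hp i]
  have hδ : 0 < σ - σ' := by linarith
  set η : Fin n → ℝ → ℝ := fun i =>
    bump (x₀ i) (σ * ρ ^ (1 / p i)) ((σ - σ') * ρ ^ (1 / p i)) with hη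
  have hρp : ∀ i, 0 < ρ ^ (1 / p i) := fun i => Real.rpow_pos_of_pos hρ _
  have hd : ∀ i, 0 < (σ - σ') * ρ ^ (1 / p i) := fun i => mul_pos hδ (hρp i)
  have hη01 : ∀ i s, η i s ∈ Icc (0 : ℝ) 1 := fun i s => bump_mem_Icc _ _ _ _
  have hηd : ∀ i s, |deriv (η i) s| ≤ 2 * A / ((σ - σ') * ρ ^ (1 / p i)) := fun i s =>
    abs_deriv_bump_le (hd i) hA s
  have hηs : ∀ i, ContDiff ℝ ∞ (η i) := fun i => contDiff_bump _ _ _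
  have hηdiff : ∀ i s, HasDerivAt (η i) (deriv (η i) s) s := fun i s =>
    ((hηs i).differentiable (by simp) s).hasDerivAt
  set ψ : ℝ → ℝ := fun t => Real.smoothTransition ((t - (t₀ - σ * ρ)) / ((σ - σ') * ρ)) with hψ
  have hψs : ContDiff ℝ ∞ ψ :=
    Real.smoothTransition.contDiff.comp ((contDiff_id.sub contDiff_const).div_const _)
  have hψ01 : ∀ t, ψ t ∈ Icc (0 : ℝ) 1 := fun t =>
    ⟨Real.smoothTransition.nonneg _, Real.smoothTransition.le_one _⟩
  have hψ0 : ∀ t ≤ t₀ - σ * ρ, ψ t = 0 := fun t ht =>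
    Real.smoothTransition.zero_of_nonpos
      (div_nonpos_of_nonpos_of_nonneg (by linarith) (by positivity))
  have hψ1 : ∀ t, t₀ - σ' * ρ ≤ t → ψ t = 1 := fun t ht =>
    Real.smoothTransition.one_of_one_le (by rw [le_div_iff₀ (by positivity)]; linarith)
  have hψd : ∀ t, HasDerivAt ψ (deriv ψ t) t := fun t =>
    (hψs.differentiable (by simp) t).hasDerivAt
  have hψdle : ∀ t, |deriv ψ t| ≤ A / ((σ - σ') * ρ) := fun t => by
    have h : HasDerivAt (fun s : ℝ => (s - (t₀ - σ * ρ)) / ((σ - σ') * ρ)) (1 / ((σ - σ') * ρ)) t :=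
      ((hasDerivAt_id t).sub_const _).div_const _
    have hdiff : Differentiable ℝ Real.smoothTransition :=
      (Real.smoothTransition.contDiff (n := 1)).differentiable one_ne_zero
    have h2 : HasDerivAt ψ _ t := (hdiff _).hasDerivAt.comp t h
    rw [h2.deriv, abs_mul, abs_of_pos (by positivity : 0 < 1 / ((σ - σ') * ρ)), mul_one_div]
    gcongr
    exact hA _
  have hP01 : ∀ x : Fin n → ℝ, ∏ i, η i (x i) ^ p i ∈ Icc (0 : ℝ) 1 := fun x =>
    ⟨Finset.prod_nonneg fun i _ => Real.rpow_nonneg (hη01 _ _).1 _,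
      Finset.prod_le_one (fun i _ => Real.rpow_nonneg (hη01 _ _).1 _) fun i _ =>
        Real.rpow_le_one (hη01 _ _).1 (hη01 _ _).2 (hp0 i).le⟩
  have hηout : ∀ x, x ∉ sbox p x₀ ρ σ → ∃ i, η i (x i) = 0 := by
    intro x hx
    simp only [sbox, mem_pi, mem_univ, true_implies, not_forall] at hx
    obtain ⟨i, hi⟩ := hx
    exact ⟨i, bump_eq_zero (hd i) hi⟩
  -- The squares in χ give η^(2e) ≤ η^(p_i) for all e ≥ 1, as p_i < 2, so every power of χ needed
  -- later is dominated by ζ. The choice ε = (2 - σ')ρ puts the end of the time ramp at t₀ - σ'ρ;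
  -- its start t₀ - σρ is admissible because σ ≤ 4/3 ≤ 1 + σ'/2.
  refine ⟨fun z => ψ z.2 * ∏ i, η i (z.1 i) ^ p i, fun x => ∏ i, η i (x i) ^ 2,
    ⟨?_, (2 - σ') * ρ, ψ, η, ?_, hψs, hψ01, ?_, ?_, ?_, ?_, fun z => rfl⟩,
    ?_, ?_, ?_, ?_, ?_, ?_, ?_, ?_, ?_, ?_⟩
  · refine (hψs.comp contDiff_snd).mul (contDiff_prod fun i _ => ?_)
    exact (contDiff_bump_rpow _ _ _ (hp0 i)).comp ((contDiff_apply ℝ ℝ i).comp contDiff_fst)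
  · constructor <;> nlinarith
  · intro s t hst
    exact Real.smoothTransition.monotone (by gcongr)
  · intro t ht
    refine hψ0 t (ht.trans ?_)
    nlinarith
  · intro t ht
    refine hψ1 t (le_trans ?_ ht)
    nlinarith
  · intro i
    have hsub : tsupport (η i) ⊆ Icc _ _ := tsupport_bump_subset (hd i)
    refine ⟨hηs i, ?_, hη01 i, hsub.trans ?_⟩
    · exact isCompact_Icc.of_isClosed_subset (isClosed_tsupport _) hsub
    · have := mul_rpow_lt_two_mul_rpow (hp i) (hp2 i) hρ hσ
      exact Icc_subset_Ioo (by linarith) (by linarith)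
  · refine contDiff_prod fun i _ => ?_
    exact (((hηs i).of_le (by simp)).comp (contDiff_apply ℝ ℝ i)).pow 2
  · intro x
    exact ⟨Finset.prod_nonneg fun i _ => sq_nonneg _,
      Finset.prod_le_one (fun i _ => sq_nonneg _) fun i _ =>
        pow_le_one₀ (hη01 _ _).1 (hη01 _ _).2⟩
  · intro x hx
    refine Finset.prod_eq_one fun i _ => ?_
    have := hx i (mem_univ i)
    rw [hη]
    simp only
    rw [bump_eq_one (hd i), one_pow]
    constructor
    · nlinarith [this.1]
    · nlinarith [this.2]
  · intro x hx
    obtain ⟨i, hi⟩ := hηout x hx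
    exact Finset.prod_eq_zero (Finset.mem_univ i) (by rw [hi]; norm_num)
  · intro x t ht e he
    simp only
    rw [hψ1 t ht, one_mul, ← Real.finsetProd_rpow _ _ fun i _ => sq_nonneg _]
    refine Finset.prod_le_prod (fun i _ => Real.rpow_nonneg (sq_nonneg _) _) fun i _ => ?_
    rw [← Real.rpow_natCast, ← Real.rpow_mul (hη01 _ _).1]
    rcases (hη01 i (x i)).1.eq_or_lt with h0 | h0
    · rw [← h0, Real.zero_rpow (by push_cast; positivity), Real.zero_rpow (hp0 i).ne']
    · refine Real.rpow_le_rpow_of_exponent_ge h0 (hη01 _ _).2 ?_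
      push_cast
      linarith [hp2 i]
  · intro x i
    have hcd : ContDiff ℝ 1 (fun x : Fin n → ℝ => ∏ i, η i (x i) ^ 2) := by
      refine contDiff_prod fun i _ => ?_
      exact (((hηs i).of_le (by simp)).comp (contDiff_apply ℝ ℝ i)).pow 2
    have h1 : HasDerivAt (fun s => ∏ j, η j (Function.update x i s j) ^ 2)
        (fderiv ℝ (fun x : Fin n → ℝ => ∏ i, η i (x i) ^ 2) x (Pi.single i 1)) (x i) := by
      have h2 := hasDerivAt_update x i (x i)
      have h3 := (hcd.differentiable one_ne_zero (Function.update x i (x i))).hasFDerivAt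
      have h4 := h3.comp_hasDerivAt (x i) h2
      rw [Function.update_eq_self] at h4
      exact h4
    have h5 : (fun s => ∏ j, η j (Function.update x i s j) ^ 2) = fun s =>
        η i s ^ 2 * ∏ j ∈ Finset.univ.erase i, η j (x j) ^ 2 := by
      ext s
      exact prod_update_eq (fun j s => η j s ^ 2) x i s
    rw [h5] at h1
    have h6 := ((hηdiff i (x i)).pow 2).mul_const (∏ j ∈ Finset.univ.erase i, η j (x j) ^ 2)
    rw [h1.unique h6]
    have h7 : ∏ j ∈ Finset.univ.erase i, η j (x j) ^ 2 ∈ Icc (0 : ℝ) 1 :=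
      ⟨Finset.prod_nonneg fun i _ => sq_nonneg _,
      Finset.prod_le_one (fun i _ => sq_nonneg _) fun i _ =>
        pow_le_one₀ (hη01 _ _).1 (hη01 _ _).2⟩
    rw [abs_mul, abs_mul, abs_of_nonneg h7.1]
    have h8 : |((2 : ℕ) : ℝ) * η i (x i) ^ (2 - 1)| ≤ 2 := by
      rw [abs_of_nonneg (by have := (hη01 i (x i)).1; positivity)]
      have := (hη01 i (x i)).2
      norm_num
      linarith
    calc _ ≤ 2 * (2 * A / ((σ - σ') * ρ ^ (1 / p i))) * 1 := by
          refine mul_le_mul (mul_le_mul h8 (hηd i _) (abs_nonneg _) zero_le_two) h7.2 h7.1 ?_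
          have := hd i
          positivity
      _ = (4 * A) / ((σ - σ') * ρ ^ (1 / p i)) := by ring
      _ ≤ _ := by
          have := hd i
          gcongr
          linarith
  · intro z
    exact mul_nonneg (hψ01 _).1 (hP01 _).1
  · intro z hz hzn
    by_cases hx : z.1 ∈ sbox p x₀ ρ σ
    · have : z.2 ≤ t₀ - σ * ρ := by
        by_contra h
        exact hzn ⟨hx, not_le.1 h, hz⟩
      simp [hψ0 _ this]
    · obtain ⟨i, hi⟩ := hηout _ hx
      simp only
      rw [Finset.prod_eq_zero (Finset.mem_univ i), mul_zero]
      rw [hi, Real.zero_rpow (hp0 i).ne']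
  · intro z
    simp only
    rw [((hψd z.2).mul_const _).deriv]
    calc _ ≤ |deriv ψ z.2| * 1 := by
          have h := hP01 z.1
          refine mul_le_mul (le_abs_self _) h.2 h.1 (abs_nonneg _)
      _ ≤ A / ((σ - σ') * ρ) := by rw [mul_one]; exact hψdle _
      _ ≤ _ := by gcongr; linarith
  · intro z i
    set P := ψ z.2 * ∏ j ∈ Finset.univ.erase i, η j (z.1 j) ^ p j with hP
    have hPn : ∏ j ∈ Finset.univ.erase i, η j (z.1 j) ^ p j ∈ Icc (0 : ℝ) 1 :=
      ⟨Finset.prod_nonneg fun i _ => Real.rpow_nonneg (hη01 _ _).1 _,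
      Finset.prod_le_one (fun i _ => Real.rpow_nonneg (hη01 _ _).1 _) fun i _ =>
        Real.rpow_le_one (hη01 _ _).1 (hη01 _ _).2 (hp0 i).le⟩
    have hP1 : P ∈ Icc (0 : ℝ) 1 :=
      ⟨mul_nonneg (hψ01 _).1 hPn.1, mul_le_one₀ (hψ01 _).2 hPn.1 hPn.2⟩
    have h5 : (fun s => (ψ z.2 * ∏ j, η j (Function.update z.1 i s j) ^ p j) ^ (1 / p i)) =
        fun s => η i s * P ^ (1 / p i) := by
      ext s
      rw [prod_update_eq (fun j s => η j s ^ p j) z.1 i s, mul_left_comm, ← hP,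
        Real.mul_rpow (Real.rpow_nonneg (hη01 _ _).1 _) hP1.1, ← Real.rpow_mul (hη01 _ _).1,
        mul_one_div_cancel (hp0 i).ne', Real.rpow_one]
    simp only
    rw [h5, ((hηdiff i (z.1 i)).mul_const _).deriv, abs_mul,
      abs_of_nonneg (Real.rpow_nonneg hP1.1 _)]
    have hip : 0 < 1 / p i := one_div_pos.2 (hp0 i)
    calc _ ≤ 2 * A / ((σ - σ') * ρ ^ (1 / p i)) * 1 := by
          have := hd i
          refine mul_le_mul (hηd _ _) (Real.rpow_le_one hP1.1 hP1.2 hip.le)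
            (Real.rpow_nonneg hP1.1 _) (by positivity)
      _ ≤ _ := by
          have := hd i
          rw [mul_one]
          gcongr
          linarith

/-! ### Energy inequalities for powers of truncations -/

/-- Layer cake formula on both sides. With f = w it upgrades an inequality on all superlevel sets to
one carrying the weight w^b. -/
theorem lintegral_rpow_mono_of_superlevel {α β : Type*} [MeasurableSpace α] [MeasurableSpace β]
    {μ : Measure α} {ν : Measure β} {f : α → ℝ} {w : β → ℝ} (hf : Measurable f)
    (hf0 : ∀ x, 0 ≤ f x) (hw : Measurable w) (hw0 : ∀ x, 0 ≤ w x) {b : ℝ} (hb : 0 < b)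
    (h : ∀ s, 0 < s → μ {x | s < f x} ≤ ν {x | s < w x}) :
    ∫⁻ x, ENNReal.ofReal (f x ^ b) ∂μ ≤ ∫⁻ x, ENNReal.ofReal (w x ^ b) ∂ν := by
  rw [lintegral_rpow_eq_lintegral_meas_lt_mul μ (Filter.Eventually.of_forall hf0) hf.aemeasurable hb,
    lintegral_rpow_eq_lintegral_meas_lt_mul ν (Filter.Eventually.of_forall hw0) hw.aemeasurable hb]
  refine mul_le_mul' le_rfl (setLIntegral_mono' measurableSet_Ioi fun s hs => ?_)
  exact mul_le_mul' (h s hs) le_rfl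

/-- Two powers of the level are traded: in the layer cake formula t^(m-1) = t² t^(m-3), and t² is
absorbed by the weak-type hypothesis. Only rational levels are assumed, so that later a single null
set of times suffices. -/
theorem lintegral_rpow_le_of_weak_superlevel {α β : Type*} [MeasurableSpace α] [MeasurableSpace β]
    {μ : Measure α} {ν : Measure β} {f : α → ℝ} {w : β → ℝ} (hf : Measurable f)
    (hf0 : ∀ x, 0 ≤ f x) (hw : Measurable w) (hw0 : ∀ x, 0 ≤ w x) {m : ℝ} (hm : 2 < m)
    (h : ∀ q : ℚ, 0 < q →
      ENNReal.ofReal ((q : ℝ) ^ 2) * μ {x | 2 * (q : ℝ) < f x} ≤ ν {x | (q : ℝ) < w x}) :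
    ∫⁻ x, ENNReal.ofReal (f x ^ m) ∂μ ≤
      ENNReal.ofReal (16 * 4 ^ (m - 2) * m / (m - 2)) * ∫⁻ x, ENNReal.ofReal (w x ^ (m - 2)) ∂ν := by
  have hm2 : 0 < m - 2 := by linarith
  have h4 : ∫⁻ x, ENNReal.ofReal ((4 * w x) ^ (m - 2)) ∂ν =
      ENNReal.ofReal (4 ^ (m - 2)) * ∫⁻ x, ENNReal.ofReal (w x ^ (m - 2)) ∂ν := by
    rw [← lintegral_const_mul _ (hw.pow_const _).ennreal_ofReal]
    refine lintegral_congr fun x => ?_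
    rw [← ENNReal.ofReal_mul (by positivity), Real.mul_rpow (by norm_num) (hw0 x)]
  rw [lintegral_rpow_eq_lintegral_meas_lt_mul ν (f := fun x => 4 * w x)
    (Filter.Eventually.of_forall fun x => mul_nonneg (by norm_num) (hw0 x))
    (hw.const_mul 4).aemeasurable hm2] at h4
  rw [lintegral_rpow_eq_lintegral_meas_lt_mul μ (Filter.Eventually.of_forall hf0) hf.aemeasurable
    (by linarith : 0 < m)]
  have key : ∫⁻ t in Ioi 0, μ {a | t < f a} * ENNReal.ofReal (t ^ (m - 1)) ≤
      ENNReal.ofReal 16 *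
        ∫⁻ t in Ioi 0, ν {a | t < 4 * w a} * ENNReal.ofReal (t ^ (m - 2 - 1)) := by
    rw [← lintegral_const_mul' _ _ ENNReal.ofReal_ne_top]
    refine setLIntegral_mono' measurableSet_Ioi fun t ht => ?_
    rw [mem_Ioi] at ht
    -- With t/4 < q < t/2, the set {f > t} lies in {f > 2q}, the set {w > q} lies in {4w > t}, and
    -- t² ≤ 16 q².
    obtain ⟨q, hq1, hq2⟩ := exists_rat_btwn (by linarith : t / 4 < t / 2)
    have hq0 : (0 : ℝ) < q := by linarith
    have h1 := h q (by exact_mod_cast hq0)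
    have h2 : μ {a | t < f a} ≤ μ {x | 2 * (q : ℝ) < f x} :=
      measure_mono fun x (hx : t < f x) => show 2 * (q : ℝ) < f x by linarith
    have h3 : ν {x | (q : ℝ) < w x} ≤ ν {a | t < 4 * w a} :=
      measure_mono fun x (hx : (q : ℝ) < w x) => show t < 4 * w x by linarith
    have e : t ^ (m - 1) = t ^ 2 * t ^ (m - 2 - 1) := by
      rw [← Real.rpow_natCast, ← Real.rpow_add ht]
      congr 1
      push_cast
      ring
    have h5 : t ^ 2 ≤ 16 * (q : ℝ) ^ 2 := by nlinarith
    calc μ {a | t < f a} * ENNReal.ofReal (t ^ (m - 1))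
        = ENNReal.ofReal (t ^ 2) * μ {a | t < f a} * ENNReal.ofReal (t ^ (m - 2 - 1)) := by
          rw [e, ENNReal.ofReal_mul (by positivity)]; ring
      _ ≤ ENNReal.ofReal (16 * (q : ℝ) ^ 2) * μ {x | 2 * (q : ℝ) < f x} *
          ENNReal.ofReal (t ^ (m - 2 - 1)) := by gcongr
      _ = ENNReal.ofReal 16 * ((ENNReal.ofReal ((q : ℝ) ^ 2) * μ {x | 2 * (q : ℝ) < f x}) *
          ENNReal.ofReal (t ^ (m - 2 - 1))) := by
          rw [ENNReal.ofReal_mul (by norm_num)]; ring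
      _ ≤ _ := by gcongr; exact h1.trans h3
  set J := ∫⁻ t in Ioi 0, ν {a | t < 4 * w a} * ENNReal.ofReal (t ^ (m - 2 - 1))
  calc ENNReal.ofReal m * ∫⁻ t in Ioi 0, μ {a | t < f a} * ENNReal.ofReal (t ^ (m - 1))
      ≤ ENNReal.ofReal m * (ENNReal.ofReal 16 * J) := by gcongr
    _ = ENNReal.ofReal (16 * m / (m - 2)) * (ENNReal.ofReal (m - 2) * J) := by
        rw [← mul_assoc, ← mul_assoc, ← ENNReal.ofReal_mul (by linarith),
          ← ENNReal.ofReal_mul (by positivity)]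
        congr 2
        field_simp
    _ = _ := by
        rw [h4, ← mul_assoc, ← ENNReal.ofReal_mul (by positivity)]
        congr 2
        ring

/-- A measurable function on a cylinder with integrable weak gradient on almost every time slice,
which satisfies the energy inequalities on this cylinder. -/
structure LocalSubsolution (p δ : Fin n → ℝ) (c : ℝ) (x₀ : Fin n → ℝ) (t₀ R : ℝ)
    (u : (Fin n → ℝ) × ℝ → ℝ) (g : Fin n → (Fin n → ℝ) × ℝ → ℝ) : Prop where
  measurable : Measurable u
  measurable_grad : ∀ i, Measurable (g i)
  slices : ∀ᵐ t ∂(volume.restrict (Ioo (t₀ - R) t₀)),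
    IntegrableOn (fun x => u (x, t)) (box p x₀ R) ∧
      ∀ i, IntegrableOn (fun x => g i (x, t)) (box p x₀ R) ∧
        ∀ φ : (Fin n → ℝ) → ℝ, ContDiff ℝ ∞ φ → HasCompactSupport φ → tsupport φ ⊆ box p x₀ R →
          ∫ x in box p x₀ R, u (x, t) * fderiv ℝ φ x (Pi.single i 1) =
            -∫ x in box p x₀ R, g i (x, t) * φ x
  energy : ∀ ζ, IsCutoff p x₀ t₀ R ζ → ∀ k : ℝ,
    EnergyIneq p δ c x₀ t₀ R (fun z => max (u z - k) 0) {z | k < u z} g ζ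

theorem deriv_eq_zero_of_nonneg {f : ℝ → ℝ} {s : ℝ} (hf : ∀ t, 0 ≤ f t) (hs : f s = 0) :
    deriv f s = 0 := by
  have h : IsLocalMin f s := Filter.Eventually.of_forall fun t => by rw [hs]; exact hf t
  exact h.deriv_eq_zero

/-- The measure which controls the energy of the truncations at all higher levels. -/
noncomputable def energyMeasure (p x₀ : Fin n → ℝ) (t₀ ρ σ c M : ℝ)
    (w : (Fin n → ℝ) × ℝ → ℝ) : Measure ((Fin n → ℝ) × ℝ) :=
  (volume.restrict (scyl p x₀ t₀ ρ σ)).withDensity fun z =>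
    ENNReal.ofReal c * ENNReal.ofReal (M * w z ^ 2) +
      ENNReal.ofReal c * ∑ i, ENNReal.ofReal (M * w z ^ p i)

/-- One measure controls all higher levels: the truncation at level k + s is at most the one at
level k, and is zero unless the latter exceeds s. Off the smaller cylinder the derivatives of ζ and
ζ^(1/p_i) vanish, because these nonnegative functions attain their minimum 0 there. -/
theorem energyIneq_rhs_le {p x₀ : Fin n → ℝ} (hp : ∀ i, 1 < p i) {t₀ ρ σ c M k s : ℝ}
    {u : (Fin n → ℝ) × ℝ → ℝ} (hu : Measurable u) (hM : 0 ≤ M) (hs : 0 ≤ s)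
    {ζ : (Fin n → ℝ) × ℝ → ℝ} (hζ0 : ∀ z, 0 ≤ ζ z)
    (hζs : ∀ z : (Fin n → ℝ) × ℝ, z.2 < t₀ → z ∉ scyl p x₀ t₀ ρ σ → ζ z = 0)
    (hζt : ∀ z : (Fin n → ℝ) × ℝ, deriv (fun s => ζ (z.1, s)) z.2 ≤ M)
    (hζx : ∀ (z : (Fin n → ℝ) × ℝ) i,
      |deriv (fun s => ζ (Function.update z.1 i s, z.2) ^ (1 / p i)) (z.1 i)| ^ p i ≤ M) :
    ENNReal.ofReal c * (∫⁻ z in Q p x₀ t₀ (2 * ρ),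
        ENNReal.ofReal (max (u z - (k + s)) 0 ^ 2 * deriv (fun s => ζ (z.1, s)) z.2))
      + ENNReal.ofReal c * ∑ i, ∫⁻ z in Q p x₀ t₀ (2 * ρ),
        ENNReal.ofReal (max (u z - (k + s)) 0 ^ p i *
          |deriv (fun s => ζ (Function.update z.1 i s, z.2) ^ (1 / p i)) (z.1 i)| ^ p i) ≤
    energyMeasure p x₀ t₀ ρ σ c M (fun z => max (u z - k) 0) {z | s < max (u z - k) 0} := by
  have hp0 : ∀ i, 0 < p i := fun i => by linarith [hp i]
  have hw : Measurable fun z => max (u z - k) 0 := (hu.sub_const k).max measurable_const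
  have hA : MeasurableSet {z | s < max (u z - k) 0} := measurableSet_lt measurable_const hw
  have hsc := measurableSet_scyl p x₀ t₀ ρ σ
  have hQ : MeasurableSet (Q p x₀ t₀ (2 * ρ)) :=
    (MeasurableSet.univ_pi fun _ => measurableSet_Ioo).prod measurableSet_Ioo
  have hzero : ∀ z : (Fin n → ℝ) × ℝ, max (u z - (k + s)) 0 ≤ max (u z - k) 0 := fun z =>
    max_le_max (by linarith) le_rfl
  have hnot : ∀ z : (Fin n → ℝ) × ℝ, ¬ s < max (u z - k) 0 → max (u z - (k + s)) 0 = 0 := by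
    intro z hz
    have := (le_max_left (u z - k) 0).trans (not_lt.1 hz)
    exact max_eq_right (by linarith)
  have h2 : ∀ i, Measurable fun z => ENNReal.ofReal (M * max (u z - k) 0 ^ p i) := fun i =>
    ((hw.pow_const (p i)).const_mul M).ennreal_ofReal
  rw [energyMeasure, withDensity_apply _ hA, Measure.restrict_restrict hA,
    lintegral_add_left (((hw.pow_const 2).const_mul M).ennreal_ofReal.const_mul _),
    lintegral_const_mul _ (((hw.pow_const 2).const_mul M).ennreal_ofReal),
    lintegral_const_mul _ (Finset.measurable_fun_sum _ fun i _ => h2 i),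
    lintegral_finsetSum _ fun i _ => h2 i]
  refine add_le_add (mul_le_mul' le_rfl ?_)
    (mul_le_mul' le_rfl (Finset.sum_le_sum fun i _ => ?_))
  · rw [← lintegral_indicator (hA.inter hsc)]
    refine (setLIntegral_mono' hQ fun z hz => ?_).trans (setLIntegral_le_lintegral _ _)
    by_cases h : z ∈ {z | s < max (u z - k) 0} ∩ scyl p x₀ t₀ ρ σ
    · rw [indicator_of_mem h, mul_comm M]
      refine ENNReal.ofReal_le_ofReal ?_
      calc max (u z - (k + s)) 0 ^ 2 * deriv (fun s => ζ (z.1, s)) z.2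
          ≤ max (u z - (k + s)) 0 ^ 2 * M := by gcongr; exact hζt z
        _ ≤ _ := by gcongr; linarith
    · rw [indicator_of_notMem h]
      by_cases h' : s < max (u z - k) 0
      · have h0 : ζ z = 0 := hζs z hz.2.2 fun h'' => h ⟨h', h''⟩
        rw [deriv_eq_zero_of_nonneg (f := fun s => ζ (z.1, s)) (fun t => hζ0 _) h0]
        simp
      · simp [hnot z h']
  · rw [← lintegral_indicator (hA.inter hsc)]
    refine (setLIntegral_mono' hQ fun z hz => ?_).trans (setLIntegral_le_lintegral _ _)
    by_cases h : z ∈ {z | s < max (u z - k) 0} ∩ scyl p x₀ t₀ ρ σ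
    · rw [indicator_of_mem h, mul_comm M]
      refine ENNReal.ofReal_le_ofReal ?_
      exact mul_le_mul (Real.rpow_le_rpow (le_max_right _ _) (hzero z) (hp0 i).le) (hζx z i)
        (Real.rpow_nonneg (abs_nonneg _) _) (Real.rpow_nonneg (le_max_right _ _) _)
    · rw [indicator_of_notMem h]
      by_cases h' : s < max (u z - k) 0
      · have h0 : ζ z = 0 := hζs z hz.2.2 fun h'' => h ⟨h', h''⟩
        have h1 : ζ (Function.update z.1 i (z.1 i), z.2) ^ (1 / p i) = 0 := by
          rw [Function.update_eq_self, Prod.mk.eta, h0, Real.zero_rpow (one_div_pos.2 (hp0 i)).ne']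
        rw [deriv_eq_zero_of_nonneg
          (f := fun s => ζ (Function.update z.1 i s, z.2) ^ (1 / p i))
          (fun t => Real.rpow_nonneg (hζ0 _) _) h1]
        simp [(hp0 i).ne']
      · simp [hnot z h', (hp0 i).ne']

/-- The energy inequality for the power `m - 2` of the truncation as a weight. -/
theorem power_energy {p δ x₀ : Fin n → ℝ} (hp : ∀ i, 1 < p i) {t₀ ρ σ c M k m : ℝ}
    {u : (Fin n → ℝ) × ℝ → ℝ} {g : Fin n → (Fin n → ℝ) × ℝ → ℝ}
    (hsub : LocalSubsolution p δ c x₀ t₀ (2 * ρ) u g) (hM : 0 ≤ M) (hm : 2 < m)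
    {ζ : (Fin n → ℝ) × ℝ → ℝ} (hζ : IsCutoff p x₀ t₀ (2 * ρ) ζ) (hζ0 : ∀ z, 0 ≤ ζ z)
    (hζs : ∀ z : (Fin n → ℝ) × ℝ, z.2 < t₀ → z ∉ scyl p x₀ t₀ ρ σ → ζ z = 0)
    (hζt : ∀ z : (Fin n → ℝ) × ℝ, deriv (fun s => ζ (z.1, s)) z.2 ≤ M)
    (hζx : ∀ (z : (Fin n → ℝ) × ℝ) i,
      |deriv (fun s => ζ (Function.update z.1 i s, z.2) ^ (1 / p i)) (z.1 i)| ^ p i ≤ M) :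
    (∀ᵐ τ ∂(volume.restrict (Ioo (t₀ - 2 * ρ) t₀)), ∫⁻ x in box p x₀ (2 * ρ),
        ENNReal.ofReal (max (u (x, τ) - k) 0 ^ m) * ENNReal.ofReal (ζ (x, τ)) ≤
      ENNReal.ofReal (16 * 4 ^ (m - 2) * m / (m - 2)) *
        ∫⁻ z, ENNReal.ofReal (max (u z - k) 0 ^ (m - 2))
          ∂(energyMeasure p x₀ t₀ ρ σ c M (fun z => max (u z - k) 0))) ∧
    ∀ i, ∫⁻ z in Q p x₀ t₀ (2 * ρ), ENNReal.ofReal (max (u z - k) 0 ^ (m - 2)) *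
        ENNReal.ofReal (max (|g i z| - δ i) 0 ^ p i * ζ z) ≤
      ∫⁻ z, ENNReal.ofReal (max (u z - k) 0 ^ (m - 2))
        ∂(energyMeasure p x₀ t₀ ρ σ c M (fun z => max (u z - k) 0)) := by
  have hu := hsub.measurable
  have hw : Measurable fun z => max (u z - k) 0 := (hu.sub_const k).max measurable_const
  have hw0 : ∀ z, 0 ≤ max (u z - k) 0 := fun z => le_max_right _ _
  have hζm : Measurable ζ := hζ.1.continuous.measurable
  set ν := energyMeasure p x₀ t₀ ρ σ c M (fun z => max (u z - k) 0) with hν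
  have main : ∀ s, 0 ≤ s →
      essSup (fun τ => ∫⁻ x in box p x₀ (2 * ρ),
        ENNReal.ofReal (max (u (x, τ) - (k + s)) 0 ^ 2 * ζ (x, τ)))
        (volume.restrict (Ioo (t₀ - 2 * ρ) t₀))
      + ∑ i, ∫⁻ z in Q p x₀ t₀ (2 * ρ), {z | k + s < u z}.indicator
          (fun z => ENNReal.ofReal (max (|g i z| - δ i) 0 ^ p i * ζ z)) z ≤
      ν {z | s < max (u z - k) 0} := fun s hs =>
    (hsub.energy ζ hζ (k + s)).trans (energyIneq_rhs_le hp hu hM hs hζ0 hζs hζt hζx)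
  have hset : ∀ s, 0 ≤ s → {z | k + s < u z} = {z | s < max (u z - k) 0} := by
    intro s hs
    ext z
    simp only [mem_ofPred_eq, lt_max_iff, not_lt.2 hs, or_false]
    constructor <;> intro h <;> linarith
  constructor
  · have hae : ∀ᵐ τ ∂(volume.restrict (Ioo (t₀ - 2 * ρ) t₀)), ∀ q : ℚ, 0 < q →
        ∫⁻ x in box p x₀ (2 * ρ),
          ENNReal.ofReal (max (u (x, τ) - (k + q)) 0 ^ 2 * ζ (x, τ)) ≤
        ν {z | (q : ℝ) < max (u z - k) 0} := by
      rw [ae_all_iff]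
      intro q
      by_cases hq : 0 < q
      · have hq' : (0 : ℝ) ≤ q := by exact_mod_cast hq.le
        filter_upwards [ENNReal.ae_le_essSup (fun τ => ∫⁻ x in box p x₀ (2 * ρ),
          ENNReal.ofReal (max (u (x, τ) - (k + q)) 0 ^ 2 * ζ (x, τ)))] with τ hτ _
        exact hτ.trans (le_self_add.trans (main q hq'))
      · exact Filter.Eventually.of_forall fun τ h => absurd h hq
    filter_upwards [hae] with τ hτ
    have hζτ : Measurable fun x => ENNReal.ofReal (ζ (x, τ)) :=
      (hζm.comp measurable_prodMk_right).ennreal_ofReal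
    have hwτ : Measurable fun x => max (u (x, τ) - k) 0 := hw.comp measurable_prodMk_right
    have h1 := lintegral_rpow_le_of_weak_superlevel (m := m)
      (μ := (volume.restrict (box p x₀ (2 * ρ))).withDensity fun x => ENNReal.ofReal (ζ (x, τ)))
      (ν := ν) hwτ (fun x => le_max_right _ _) hw hw0 hm ?_
    · rw [lintegral_withDensity_eq_lintegral_mul _ hζτ (hwτ.pow_const _).ennreal_ofReal] at h1
      simpa only [Pi.mul_apply, mul_comm] using h1
    · intro q hq
      have hq0 : (0 : ℝ) < q := by exact_mod_cast hq
      refine le_trans ?_ (hτ q hq)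
      have hm1 : MeasurableSet {x | 2 * (q : ℝ) < max (u (x, τ) - k) 0} :=
        measurableSet_lt measurable_const hwτ
      rw [withDensity_apply _ hm1, ← lintegral_const_mul _ hζτ, ← lintegral_indicator hm1]
      refine lintegral_mono fun x => ?_
      by_cases hx : x ∈ {x | 2 * (q : ℝ) < max (u (x, τ) - k) 0}
      · rw [indicator_of_mem hx, ← ENNReal.ofReal_mul (by positivity)]
        refine ENNReal.ofReal_le_ofReal (mul_le_mul_of_nonneg_right ?_ (hζ0 _))
        rw [mem_ofPred_eq, lt_max_iff] at hx
        -- Chebyshev's inequality with a level gap: where the truncation at k exceeds 2q, the one at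
        -- k + q is at least q.
        have h3 : (q : ℝ) ≤ max (u (x, τ) - (k + q)) 0 := by
          rcases hx with hx | hx
          · exact le_max_of_le_left (by linarith)
          · linarith
        gcongr
      · rw [indicator_of_notMem hx]
        exact zero_le
  · intro i
    have hgm : Measurable fun z => ENNReal.ofReal (max (|g i z| - δ i) 0 ^ p i * ζ z) :=
      (((((hsub.measurable_grad i).abs.sub_const _).max measurable_const).pow_const _).mul
        hζm).ennreal_ofReal
    have h1 := lintegral_rpow_mono_of_superlevel (b := m - 2)
      (μ := (volume.restrict (Q p x₀ t₀ (2 * ρ))).withDensity fun z =>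
        ENNReal.ofReal (max (|g i z| - δ i) 0 ^ p i * ζ z))
      (ν := ν) hw hw0 hw hw0 (by linarith) ?_
    · rw [lintegral_withDensity_eq_lintegral_mul _ hgm (hw.pow_const _).ennreal_ofReal] at h1
      simpa only [Pi.mul_apply, mul_comm] using h1
    · intro s hs
      have hA : MeasurableSet {z | s < max (u z - k) 0} := measurableSet_lt measurable_const hw
      refine le_trans ?_ ((le_add_self).trans (main s hs.le))
      rw [withDensity_apply _ hA, ← lintegral_indicator hA, hset s hs.le]
      exact Finset.single_le_sum (f := fun i => ∫⁻ z in Q p x₀ t₀ (2 * ρ),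
        {z | s < max (u z - k) 0}.indicator
          (fun z => ENNReal.ofReal (max (|g i z| - δ i) 0 ^ p i * ζ z)) z)
        (fun _ _ => zero_le) (Finset.mem_univ i)

/-! ### The De Giorgi step -/

/-- Above level k + h one has v - k > h ≥ 1/lam, so the missing power 2 - e can be inserted at the
cost of lam^(2-e) ≤ lam². This puts all powers between m - 2 and m on the same footing. -/
theorem rpow_le_of_level_gap {v k h lam m e : ℝ} (hlam : 1 ≤ lam) (hh : 0 < h)
    (hlh : 1 ≤ lam * h) (hm : 2 < m) (he0 : 0 ≤ e) (he2 : e ≤ 2) :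
    max (v - (k + h)) 0 ^ (m - 2 + e) ≤ lam ^ 2 * max (v - k) 0 ^ m := by
  have hw0 : 0 ≤ max (v - k) 0 := le_max_right _ _
  rcases le_or_gt (v - (k + h)) 0 with h1 | h1
  · rw [max_eq_right h1, Real.zero_rpow (by linarith)]
    positivity
  · have h2 : max (v - (k + h)) 0 = v - (k + h) := max_eq_left h1.le
    have h3 : max (v - k) 0 = v - k := max_eq_left (by linarith)
    have h4 : 0 < v - k := by linarith
    have h5 : 1 ≤ lam * (v - k) := hlh.trans (by gcongr; linarith)
    rw [h2, h3]
    calc (v - (k + h)) ^ (m - 2 + e) ≤ (v - k) ^ (m - 2 + e) :=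
          Real.rpow_le_rpow h1.le (by linarith) (by linarith)
      _ ≤ (v - k) ^ (m - 2 + e) * (lam * (v - k)) ^ (2 - e) :=
          le_mul_of_one_le_right (Real.rpow_nonneg h4.le _)
            (Real.one_le_rpow h5 (by linarith))
      _ = lam ^ (2 - e) * (v - k) ^ m := by
          rw [Real.mul_rpow (by linarith) h4.le, mul_left_comm, ← Real.rpow_add h4]
          congr 2
          ring
      _ ≤ lam ^ 2 * (v - k) ^ m := by
          gcongr
          rw [← Real.rpow_natCast]
          exact Real.rpow_le_rpow_of_exponent_le hlam (by push_cast; linarith)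

/-- Here two full powers are inserted together with a factor 1/ρ, which requires lam h ≥ √ρ. -/
theorem rpow_le_of_level_gap_scaled {v k h lam m ρ : ℝ} (hh : 0 < h)
    (hρ : 0 < ρ) (hρh : ρ ≤ lam ^ 2 * h ^ 2) (hm : 2 < m) :
    max (v - (k + h)) 0 ^ (m - 2) ≤ lam ^ 2 / ρ * max (v - k) 0 ^ m := by
  have hw0 : 0 ≤ max (v - k) 0 := le_max_right _ _
  rcases le_or_gt (v - (k + h)) 0 with h1 | h1
  · rw [max_eq_right h1, Real.zero_rpow (by linarith)]
    positivity
  · have h2 : max (v - (k + h)) 0 = v - (k + h) := max_eq_left h1.le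
    have h3 : max (v - k) 0 = v - k := max_eq_left (by linarith)
    have h4 : 0 < v - k := by linarith
    have h5 : 1 ≤ lam ^ 2 / ρ * (v - k) ^ 2 := by
      rw [div_mul_eq_mul_div, le_div_iff₀ hρ, one_mul]
      refine hρh.trans ?_
      gcongr
      linarith
    rw [h2, h3]
    calc (v - (k + h)) ^ (m - 2) ≤ (v - k) ^ (m - 2) :=
          Real.rpow_le_rpow h1.le (by linarith) (by linarith)
      _ ≤ (v - k) ^ (m - 2) * (lam ^ 2 / ρ * (v - k) ^ 2) :=
          le_mul_of_one_le_right (Real.rpow_nonneg h4.le _) h5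
      _ = lam ^ 2 / ρ * (v - k) ^ m := by
          rw [mul_left_comm, ← Real.rpow_natCast (v - k) 2, ← Real.rpow_add h4]
          congr 2
          push_cast
          ring

/-- Above level k + h the quotient (v - k)/h exceeds 1 and may be raised to the power r - m. This is
where integrability beyond m turns into decay in h. -/
theorem rpow_le_of_higher_level {v k h m r : ℝ} (hh : 0 < h) (hm : 0 < m) (hmr : m ≤ r) :
    max (v - (k + h)) 0 ^ m ≤ h ^ (-(r - m)) * max (v - k) 0 ^ r := by
  have hw0 : 0 ≤ max (v - k) 0 := le_max_right _ _
  rcases le_or_gt (v - (k + h)) 0 with h1 | h1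
  · rw [max_eq_right h1, Real.zero_rpow hm.ne']
    positivity
  · have h2 : max (v - (k + h)) 0 = v - (k + h) := max_eq_left h1.le
    have h3 : max (v - k) 0 = v - k := max_eq_left (by linarith)
    have h4 : 0 < v - k := by linarith
    rw [h2, h3]
    calc (v - (k + h)) ^ m ≤ (v - k) ^ m := Real.rpow_le_rpow h1.le (by linarith) hm.le
      _ ≤ (v - k) ^ m * ((v - k) / h) ^ (r - m) :=
          le_mul_of_one_le_right (Real.rpow_nonneg h4.le _)
            (Real.one_le_rpow ((one_le_div hh).2 (by linarith)) (by linarith))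
      _ = h ^ (-(r - m)) * (v - k) ^ r := by
          rw [Real.div_rpow h4.le hh.le, Real.rpow_neg hh.le, mul_div_assoc', ← Real.rpow_add h4,
            div_eq_inv_mul]
          congr 2
          ring

/-- The side lengths ρ^(1/p_i) are chosen so that every direction contributes the same factor 1/ρ.
Using p < 2, the remaining constants are bounded uniformly by a square. -/
theorem div_rpow_le_sq_div {A lam p ρ d : ℝ} (hA : 1 ≤ A) (hlam : 1 ≤ lam) (hp : 1 < p)
    (hp2 : p < 2) (hρ : 0 < ρ) (hd : 0 < d) (hld : 1 ≤ lam * d) :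
    (A / (d * ρ ^ (1 / p))) ^ p ≤ (A * lam) ^ 2 / ρ := by
  have h1 : (d * ρ ^ (1 / p)) ^ p = d ^ p * ρ := by
    rw [Real.mul_rpow hd.le (Real.rpow_nonneg hρ.le _), ← Real.rpow_mul hρ.le,
      one_div_mul_cancel (by linarith), Real.rpow_one]
  have h2 : A / d ≤ A * lam := by
    rw [div_le_iff₀ hd, mul_assoc]
    exact le_mul_of_one_le_right (by linarith) hld
  have hAl : 1 ≤ A * lam := one_le_mul_of_one_le_of_one_le hA hlam
  rw [Real.div_rpow (by linarith) (by positivity), h1, ← div_div,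
    ← Real.div_rpow (by linarith) hd.le]
  gcongr
  calc (A / d) ^ p ≤ (A * lam) ^ p := Real.rpow_le_rpow (by positivity) h2 (by linarith)
    _ ≤ (A * lam) ^ (2 : ℝ) := Real.rpow_le_rpow_of_exponent_le hAl hp2.le
    _ = (A * lam) ^ 2 := by rw [← Real.rpow_natCast]; norm_num

theorem add_add_rpow_le {a b c p : ℝ} (ha : 0 ≤ a) (hb : 0 ≤ b) (hc : 0 ≤ c) (hp : 0 < p)
    (hp2 : p ≤ 2) : (a + b + c) ^ p ≤ 9 * (a ^ p + b ^ p + c ^ p) := by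
  set M := max a (max b c)
  have hM : M ^ p ≤ a ^ p + b ^ p + c ^ p := by
    have h1 := Real.rpow_nonneg ha p
    have h2 := Real.rpow_nonneg hb p
    have h3 := Real.rpow_nonneg hc p
    rcases max_choice a (max b c) with h | h
    · simp only [M, h]; linarith
    · rcases max_choice b c with h' | h' <;> simp only [M, h, h'] <;> linarith
  have haM : a ≤ M := le_max_left _ _
  have hbM : b ≤ M := (le_max_left _ _).trans (le_max_right _ _)
  have hcM : c ≤ M := (le_max_right _ _).trans (le_max_right _ _)
  calc (a + b + c) ^ p ≤ (3 * M) ^ p := Real.rpow_le_rpow (by positivity) (by linarith) hp.le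
    _ = 3 ^ p * M ^ p := Real.mul_rpow (by norm_num) (ha.trans haM)
    _ ≤ 9 * M ^ p := by
        refine mul_le_mul_of_nonneg_right ?_ (Real.rpow_nonneg (ha.trans haM) _)
        calc (3 : ℝ) ^ p ≤ 3 ^ (2 : ℝ) := Real.rpow_le_rpow_of_exponent_le (by norm_num) hp2
          _ = 9 := by norm_num
    _ ≤ _ := by gcongr

theorem lintegral_energyMeasure_le {p x₀ : Fin n → ℝ} (hp : ∀ i, 1 < p i) (hp2 : ∀ i, p i < 2)
    {t₀ ρ σ c M k h lam m : ℝ} {u : (Fin n → ℝ) × ℝ → ℝ} (hu : Measurable u) (hc : 0 ≤ c)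
    (hM : 0 ≤ M) (hm : 2 < m) (hlam : 1 ≤ lam) (hh : 0 < h) (hlh : 1 ≤ lam * h) :
    ∫⁻ z, ENNReal.ofReal (max (u z - (k + h)) 0 ^ (m - 2))
        ∂(energyMeasure p x₀ t₀ ρ σ c M (fun z => max (u z - (k + h)) 0)) ≤
      ENNReal.ofReal (c * M * (n + 1) * lam ^ 2) *
        ∫⁻ z in scyl p x₀ t₀ ρ σ, ENNReal.ofReal (max (u z - k) 0 ^ m) := by
  have hw : Measurable fun z => max (u z - (k + h)) 0 := (hu.sub_const _).max measurable_const
  have hw' : Measurable fun z => max (u z - k) 0 := (hu.sub_const _).max measurable_const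
  have h2 : ∀ i, Measurable fun z => ENNReal.ofReal (M * max (u z - (k + h)) 0 ^ p i) := fun i =>
    ((hw.pow_const (p i)).const_mul M).ennreal_ofReal
  have hΦ : Measurable fun z => ENNReal.ofReal c * ENNReal.ofReal (M * max (u z - (k + h)) 0 ^ 2) +
      ENNReal.ofReal c * ∑ i, ENNReal.ofReal (M * max (u z - (k + h)) 0 ^ p i) :=
    (((hw.pow_const 2).const_mul M).ennreal_ofReal.const_mul _).add
      ((Finset.measurable_fun_sum _ fun i _ => h2 i).const_mul _)
  rw [energyMeasure, lintegral_withDensity_eq_lintegral_mul _ hΦ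
    (hw.pow_const _).ennreal_ofReal, ← lintegral_const_mul _ (hw'.pow_const _).ennreal_ofReal]
  refine lintegral_mono fun z => ?_
  simp only [Pi.mul_apply]
  have hw0 : 0 ≤ max (u z - (k + h)) 0 := le_max_right _ _
  set w := max (u z - (k + h)) 0 with hwdef
  set w' := max (u z - k) 0
  have hb : ∀ e : ℝ, 0 < e → e ≤ 2 → w ^ e * w ^ (m - 2) ≤ lam ^ 2 * w' ^ m := by
    intro e he he2
    have h3 := rpow_le_of_level_gap (v := u z) (k := k) hlam hh hlh hm he.le he2
    rcases hw0.eq_or_lt with h0 | h0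
    · rw [← h0, Real.zero_rpow he.ne', zero_mul]
      have : 0 ≤ w' := le_max_right _ _
      positivity
    · rw [← Real.rpow_add h0, add_comm e]
      exact h3
  have h4 : w ^ 2 * w ^ (m - 2) ≤ lam ^ 2 * w' ^ m := by
    have := hb 2 (by norm_num) le_rfl
    rwa [show w ^ (2 : ℝ) = w ^ 2 by rw [← Real.rpow_natCast]; norm_num] at this
  rw [← ENNReal.ofReal_sum_of_nonneg fun i _ => by positivity, ← ENNReal.ofReal_mul hc,
    ← ENNReal.ofReal_mul hc, ← ENNReal.ofReal_add (by positivity)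
      (mul_nonneg hc (Finset.sum_nonneg fun i _ => by positivity)),
    ← ENNReal.ofReal_mul (add_nonneg (by positivity)
      (mul_nonneg hc (Finset.sum_nonneg fun i _ => by positivity))),
    ← ENNReal.ofReal_mul (by positivity)]
  refine ENNReal.ofReal_le_ofReal ?_
  have h5 : ∑ i, w ^ p i * w ^ (m - 2) ≤ n * (lam ^ 2 * w' ^ m) := by
    calc ∑ i, w ^ p i * w ^ (m - 2) ≤ ∑ _i : Fin n, lam ^ 2 * w' ^ m :=
          Finset.sum_le_sum fun i _ => hb _ (by linarith [hp i]) (hp2 i).le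
      _ = _ := by simp
  calc (c * (M * w ^ 2) + c * ∑ i, M * w ^ p i) * w ^ (m - 2)
      = c * M * (w ^ 2 * w ^ (m - 2) + ∑ i, w ^ p i * w ^ (m - 2)) := by
        rw [← Finset.mul_sum, ← Finset.sum_mul]; ring
    _ ≤ c * M * (lam ^ 2 * w' ^ m + n * (lam ^ 2 * w' ^ m)) := by gcongr
    _ = _ := by ring

/-- Pointwise bound for the integrands of the Sobolev inequality. -/
theorem weighted_gradient_le {w w' a δ D g χ d ζ M lam ρ m p : ℝ} (hw : 0 ≤ w)
    (hδ : 0 ≤ δ) (hδD : δ ≤ D) (hχ : χ ∈ Icc (0 : ℝ) 1) (hp : 1 < p) (hp2 : p < 2) (hm : 2 < m)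
    (hζ : χ ^ (m - 2 + p) ≤ ζ) (hd : |d| ^ p ≤ M) (hM : 0 ≤ M) (ha0 : 0 ≤ a) (ha : a ≤ |g|)
    (h1 : w ^ (m - 2 + p) ≤ lam ^ 2 * w' ^ m)
    (h2 : w ^ (m - 2) ≤ lam ^ 2 / ρ * w' ^ m) :
    (w * χ) ^ (m - 2) * (a * χ + w * |d|) ^ p ≤
      9 * (w ^ (m - 2) * (max (|g| - δ) 0 ^ p * ζ) +
        (max D 1 ^ 2 * lam ^ 2 / ρ + M * lam ^ 2) * w' ^ m) := by
  have hp0 : 0 < p := by linarith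
  have hm2 : 0 < m - 2 := by linarith
  have hG : 0 ≤ max (|g| - δ) 0 := le_max_right _ _
  have hgG : |g| ≤ max (|g| - δ) 0 + δ := by linarith [le_max_left (|g| - δ) 0]
  have hD1 : 1 ≤ max D 1 := le_max_right _ _
  have hwχ : 0 ≤ w * χ := mul_nonneg hw hχ.1
  have e1 : (a * χ + w * |d|) ^ p ≤
      9 * ((max (|g| - δ) 0 * χ) ^ p + (δ * χ) ^ p + (w * |d|) ^ p) := by
    refine le_trans (Real.rpow_le_rpow ?_ ?_ hp0.le) (add_add_rpow_le
      (mul_nonneg hG hχ.1) (mul_nonneg hδ hχ.1) (mul_nonneg hw (abs_nonneg _)) hp0 hp2.le)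
    · exact add_nonneg (mul_nonneg ha0 hχ.1) (mul_nonneg hw (abs_nonneg _))
    · rw [← add_mul]
      gcongr
      · exact hχ.1
      · exact ha.trans hgG
  have hχm : χ ^ (m - 2) ≤ 1 := Real.rpow_le_one hχ.1 hχ.2 hm2.le
  have hχp : χ ^ p ≤ 1 := Real.rpow_le_one hχ.1 hχ.2 hp0.le
  have hχm0 : 0 ≤ χ ^ (m - 2) := Real.rpow_nonneg hχ.1 _
  have hχp0 : 0 ≤ χ ^ p := Real.rpow_nonneg hχ.1 _
  have hwm0 : 0 ≤ w ^ (m - 2) := Real.rpow_nonneg hw _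
  have hG0 : 0 ≤ max (|g| - δ) 0 ^ p := Real.rpow_nonneg hG _
  have hδp : δ ^ p ≤ max D 1 ^ 2 := by
    calc δ ^ p ≤ max D 1 ^ p := Real.rpow_le_rpow hδ (hδD.trans (le_max_left _ _)) hp0.le
      _ ≤ max D 1 ^ (2 : ℝ) := Real.rpow_le_rpow_of_exponent_le hD1 hp2.le
      _ = _ := by rw [← Real.rpow_natCast]; norm_num
  have t1 : (w * χ) ^ (m - 2) * (max (|g| - δ) 0 * χ) ^ p ≤
      w ^ (m - 2) * (max (|g| - δ) 0 ^ p * ζ) := by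
    rw [Real.mul_rpow hw hχ.1, Real.mul_rpow hG hχ.1]
    have e2 : χ ^ (m - 2) * χ ^ p ≤ ζ := by
      rwa [← Real.rpow_add_of_nonneg hχ.1 hm2.le hp0.le]
    calc _ = w ^ (m - 2) * (max (|g| - δ) 0 ^ p * (χ ^ (m - 2) * χ ^ p)) := by ring
      _ ≤ _ := by gcongr
  -- The offset is the one term without a cut-off derivative, so its factor 1/ρ has to come from
  -- `h2`. It is the source of √ρ in the final bound.
  have t2 : (w * χ) ^ (m - 2) * (δ * χ) ^ p ≤ max D 1 ^ 2 * lam ^ 2 / ρ * w' ^ m := by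
    rw [Real.mul_rpow hw hχ.1, Real.mul_rpow hδ hχ.1]
    calc w ^ (m - 2) * χ ^ (m - 2) * (δ ^ p * χ ^ p)
        ≤ w ^ (m - 2) * 1 * (max D 1 ^ 2 * 1) := by gcongr
      _ = max D 1 ^ 2 * w ^ (m - 2) := by ring
      _ ≤ max D 1 ^ 2 * (lam ^ 2 / ρ * w' ^ m) := by gcongr
      _ = _ := by ring
  have t3 : (w * χ) ^ (m - 2) * (w * |d|) ^ p ≤ M * lam ^ 2 * w' ^ m := by
    rw [Real.mul_rpow hw hχ.1, Real.mul_rpow hw (abs_nonneg _)]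
    calc w ^ (m - 2) * χ ^ (m - 2) * (w ^ p * |d| ^ p)
        ≤ w ^ (m - 2) * 1 * (w ^ p * M) := by gcongr
      _ = M * w ^ (m - 2 + p) := by
          rw [Real.rpow_add_of_nonneg hw hm2.le hp0.le]; ring
      _ ≤ M * (lam ^ 2 * w' ^ m) := by gcongr
      _ = _ := by ring
  calc (w * χ) ^ (m - 2) * (a * χ + w * |d|) ^ p
      ≤ (w * χ) ^ (m - 2) *
        (9 * ((max (|g| - δ) 0 * χ) ^ p + (δ * χ) ^ p + (w * |d|) ^ p)) := by gcongr
    _ = 9 * ((w * χ) ^ (m - 2) * (max (|g| - δ) 0 * χ) ^ p + (w * χ) ^ (m - 2) * (δ * χ) ^ p +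
        (w * χ) ^ (m - 2) * (w * |d|) ^ p) := by ring
    _ ≤ 9 * (w ^ (m - 2) * (max (|g| - δ) 0 ^ p * ζ) + max D 1 ^ 2 * lam ^ 2 / ρ * w' ^ m +
        M * lam ^ 2 * w' ^ m) := by gcongr
    _ = _ := by ring

theorem lintegral_slices_le {F : (Fin n → ℝ) × ℝ → ℝ≥0∞} (hF : Measurable F)
    (B : Set (Fin n → ℝ)) {I J : Set ℝ} (hIJ : I ⊆ J) :
    ∫⁻ τ in I, ∫⁻ x in B, F (x, τ) ≤ ∫⁻ z in B ×ˢ J, F z := by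
  have h : (volume : Measure ((Fin n → ℝ) × ℝ)).restrict (B ×ˢ J) =
      (volume.restrict B).prod (volume.restrict J) := (Measure.prod_restrict B J).symm
  rw [h, lintegral_prod_symm' _ hF]
  exact lintegral_mono' (Measure.restrict_mono hIJ le_rfl) le_rfl

theorem lintegral_prod_eq_slices {F : (Fin n → ℝ) × ℝ → ℝ≥0∞} (hF : Measurable F)
    (B : Set (Fin n → ℝ)) (J : Set ℝ) :
    ∫⁻ z in B ×ˢ J, F z = ∫⁻ τ in J, ∫⁻ x in B, F (x, τ) := by
  have h : (volume : Measure ((Fin n → ℝ) × ℝ)).restrict (B ×ˢ J) =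
      (volume.restrict B).prod (volume.restrict J) := (Measure.prod_restrict B J).symm
  rw [h, lintegral_prod_symm' _ hF]

/-- The gain of integrability and the decay of the truncations on shrinking cylinders. -/
theorem deGiorgi_step (hn : 2 ≤ n) {p : Fin n → ℝ} (hp : ∀ i, 1 < p i) (hp2 : ∀ i, p i < 2)
    {S m c D : ℝ} (hS : S = ∑ i, 1 / p i) (hS1 : 1 < S) (hm : 2 < m)
    (hr : m ≤ m / S + n / S + m - 2) (hc : 0 < c) :
    ∃ C : ℝ≥0∞, C ≠ ⊤ ∧ ∀ (δ : Fin n → ℝ), (∀ i, 0 ≤ δ i ∧ δ i ≤ D) →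
      ∀ (x₀ : Fin n → ℝ) (t₀ ρ : ℝ) (u : (Fin n → ℝ) × ℝ → ℝ)
        (g : Fin n → (Fin n → ℝ) × ℝ → ℝ), 0 < ρ → LocalSubsolution p δ c x₀ t₀ (2 * ρ) u g →
      ∀ (σ σ' k h lam : ℝ), 1 ≤ σ' → σ' < σ → σ ≤ 4 / 3 → 0 < h → 1 ≤ lam →
        1 ≤ lam * (σ - σ') → 1 ≤ lam * h → ρ ≤ lam ^ 2 * h ^ 2 →
      ∫⁻ z in scyl p x₀ t₀ ρ σ', ENNReal.ofReal (max (u z - (k + h + h)) 0 ^ m) ≤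
        C * ENNReal.ofReal (h ^ (-(m / S + n / S + m - 2 - m))) *
          (ENNReal.ofReal (lam ^ 4 / ρ) *
            ∫⁻ z in scyl p x₀ t₀ ρ σ, ENNReal.ofReal (max (u z - k) 0 ^ m)) ^ (1 + 1 / S) := by
  obtain ⟨A, hA1, hcut⟩ := exists_cutoff
  obtain ⟨Cs, hCst, hsob⟩ := lintegral_truncation_rpow_le hn hp hS hS1 hm
  have hS0 : 0 < S := by linarith
  set r := m / S + n / S + m - 2 with hrdef
  -- K₁ comes from the weak-type layer cake, K₂ from the n + 1 terms of the energy measure, and K₃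
  -- from the offsets and the derivative of χ. The factor 9 bounds 3^(p_i).
  set K₁ : ℝ≥0∞ := ENNReal.ofReal (16 * 4 ^ (m - 2) * m / (m - 2)) with hK₁
  set K₂ : ℝ≥0∞ := ENNReal.ofReal (c * A ^ 2 * (n + 1)) with hK₂
  set K₃ : ℝ≥0∞ := ENNReal.ofReal (max D 1 ^ 2 + A ^ 2) with hK₃
  refine ⟨Cs * (K₁ * K₂) ^ (1 / S) * (n * (9 * (K₂ + K₃))), ?_, ?_⟩
  · refine ENNReal.mul_ne_top (ENNReal.mul_ne_top hCst (ENNReal.rpow_ne_top_of_nonneg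
      (by positivity) (ENNReal.mul_ne_top ENNReal.ofReal_ne_top ENNReal.ofReal_ne_top)))
      (ENNReal.mul_ne_top (ENNReal.natCast_ne_top n) (ENNReal.mul_ne_top (by norm_num)
        (ENNReal.add_ne_top.2 ⟨ENNReal.ofReal_ne_top, ENNReal.ofReal_ne_top⟩)))
  intro δ hδ x₀ t₀ ρ u g hρ hsub σ σ' k h lam hσ' hσσ hσ hh hlam hld hlh hρh
  obtain ⟨ζ, χ, hζ, hχ, hχ01, hχ1, hχ0, hχζ, hχd, hζ0, hζs, hζt, hζx⟩ :=
    hcut n p x₀ t₀ ρ σ σ' hp hp2 hρ hσ' hσσ hσ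
  have hu := hsub.measurable
  have hd : 0 < σ - σ' := by linarith
  have hp0 : ∀ i, 0 < p i := fun i => by linarith [hp i]
  set M := (A * lam) ^ 2 / ρ with hM
  have hM0 : 0 ≤ M := by positivity
  have hAl : 1 ≤ A * lam := one_le_mul_of_one_le_of_one_le hA1 hlam
  have hζt' : ∀ z : (Fin n → ℝ) × ℝ, deriv (fun s => ζ (z.1, s)) z.2 ≤ M := fun z => by
    refine (hζt z).trans ?_
    rw [hM, ← div_div]
    gcongr
    rw [div_le_iff₀ hd]
    calc A ≤ A * (lam * (σ - σ')) := le_mul_of_one_le_right (by linarith) hld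
      _ = (A * lam) * (σ - σ') := by ring
      _ ≤ (A * lam) ^ 2 * (σ - σ') := by
          gcongr
          nlinarith
  have hζx' : ∀ (z : (Fin n → ℝ) × ℝ) i,
      |deriv (fun s => ζ (Function.update z.1 i s, z.2) ^ (1 / p i)) (z.1 i)| ^ p i ≤ M :=
    fun z i => (Real.rpow_le_rpow (abs_nonneg _) (hζx z i) (hp0 i).le).trans
      (div_rpow_le_sq_div hA1 hlam (hp i) (hp2 i) hρ hd hld)
  have hχd' : ∀ x i, |fderiv ℝ χ x (Pi.single i 1)| ^ p i ≤ M :=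
    fun x i => (Real.rpow_le_rpow (abs_nonneg _) (hχd x i) (hp0 i).le).trans
      (div_rpow_le_sq_div hA1 hlam (hp i) (hp2 i) hρ hd hld)
  -- Three levels are in play: k carries the given L^m norm, k + h the energy and Sobolev estimates,
  -- and k + 2h the conclusion.
  obtain ⟨hE1, hE2⟩ := power_energy hp hsub hM0 hm hζ hζ0 hζs hζt' hζx' (k := k + h)
  set w : (Fin n → ℝ) × ℝ → ℝ := fun z => max (u z - (k + h)) 0 with hw
  set w' : (Fin n → ℝ) × ℝ → ℝ := fun z => max (u z - k) 0 with hw'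
  have hwm : Measurable w := (hu.sub_const _).max measurable_const
  have hwm' : Measurable w' := (hu.sub_const _).max measurable_const
  have hw0 : ∀ z, 0 ≤ w z := fun z => le_max_right _ _
  have hw0' : ∀ z, 0 ≤ w' z := fun z => le_max_right _ _
  set Y := ∫⁻ z in scyl p x₀ t₀ ρ σ, ENNReal.ofReal (w' z ^ m) with hY
  set Z := ENNReal.ofReal (lam ^ 4 / ρ) * Y with hZ
  set X := ∫⁻ z, ENNReal.ofReal (w z ^ (m - 2)) ∂(energyMeasure p x₀ t₀ ρ σ c M w) with hX
  have hXZ : X ≤ K₂ * Z := by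
    refine (lintegral_energyMeasure_le hp hp2 hu hc.le hM0 hm hlam hh hlh).trans (le_of_eq ?_)
    rw [hK₂, hZ, ← mul_assoc, ← ENNReal.ofReal_mul (by positivity)]
    congr 2
    rw [hM]
    ring
  -- the integrand controlling the gradient
  set M' := max D 1 ^ 2 * lam ^ 2 / ρ + M * lam ^ 2 with hM'
  have hM'0 : 0 ≤ M' := by positivity
  set F : Fin n → (Fin n → ℝ) × ℝ → ℝ≥0∞ := fun i z =>
    9 * (ENNReal.ofReal (w z ^ (m - 2)) * ENNReal.ofReal (max (|g i z| - δ i) 0 ^ p i * ζ z) +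
      (scyl p x₀ t₀ ρ σ).indicator (fun z => ENNReal.ofReal M' * ENNReal.ofReal (w' z ^ m)) z)
    with hF
  have hsc := measurableSet_scyl p x₀ t₀ ρ σ
  have hF1 : ∀ i, Measurable fun z => ENNReal.ofReal (w z ^ (m - 2)) *
      ENNReal.ofReal (max (|g i z| - δ i) 0 ^ p i * ζ z) := fun i =>
    (hwm.pow_const _).ennreal_ofReal.mul (((((hsub.measurable_grad i).abs.sub_const _).max
      measurable_const).pow_const _).mul hζ.1.continuous.measurable).ennreal_ofReal
  have hF2 : Measurable ((scyl p x₀ t₀ ρ σ).indicator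
      (fun z => ENNReal.ofReal M' * ENNReal.ofReal (w' z ^ m))) :=
    ((hwm'.pow_const _).ennreal_ofReal.const_mul _).indicator hsc
  have hFm : ∀ i, Measurable (F i) := fun i => ((hF1 i).add hF2).const_mul _
  have hFint : ∀ i, ∫⁻ z in Q p x₀ t₀ (2 * ρ), F i z ≤ 9 * (K₂ + K₃) * Z := by
    intro i
    have hF3 := (hF1 i).add hF2
    simp only [Pi.add_def] at hF3
    simp only [hF]
    rw [lintegral_const_mul _ hF3, lintegral_add_left (hF1 i), mul_assoc]
    refine mul_le_mul' le_rfl ?_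
    rw [add_mul]
    refine add_le_add ((hE2 i).trans hXZ) ?_
    refine (setLIntegral_le_lintegral _ _).trans ?_
    rw [lintegral_indicator hsc, lintegral_const_mul _ (hwm'.pow_const _).ennreal_ofReal, hZ,
      ← mul_assoc, hK₃, ← ENNReal.ofReal_mul (by positivity)]
    refine mul_le_mul' (ENNReal.ofReal_le_ofReal ?_) le_rfl
    have hl : lam ^ 2 ≤ lam ^ 4 := pow_le_pow_right₀ hlam (by norm_num)
    calc M' = max D 1 ^ 2 * lam ^ 2 / ρ + A ^ 2 * lam ^ 4 / ρ := by rw [hM', hM]; ring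
      _ ≤ max D 1 ^ 2 * lam ^ 4 / ρ + A ^ 2 * lam ^ 4 / ρ := by gcongr
      _ = _ := by ring
  -- the Sobolev inequality on time slices
  have hIJ : Ioo (t₀ - σ' * ρ) t₀ ⊆ Ioo (t₀ - 2 * ρ) t₀ := Ioo_subset_Ioo_left (by nlinarith)
  have hslice : ∀ᵐ τ ∂(volume.restrict (Ioo (t₀ - σ' * ρ) t₀)),
      ∫⁻ x in sbox p x₀ ρ σ', ENNReal.ofReal (w (x, τ) ^ r) ≤
        Cs * (K₁ * X) ^ (1 / S) * ∑ i, ∫⁻ x in box p x₀ (2 * ρ), F i (x, τ) := by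
    filter_upwards [ae_restrict_of_ae_restrict_of_subset hIJ hE1,
      ae_restrict_of_ae_restrict_of_subset hIJ hsub.slices,
      ae_restrict_mem measurableSet_Ioo] with τ h1 h2 hτ
    have h3 := hsob (fun i => x₀ i - (2 * ρ) ^ (1 / p i)) (fun i => x₀ i + (2 * ρ) ^ (1 / p i))
      (fun x => u (x, τ)) (fun i x => g i (x, τ)) χ (k + h) (hu.comp measurable_prodMk_right)
      (fun i => (hsub.measurable_grad i).comp measurable_prodMk_right) h2.1
      (fun i => (h2.2 i).1) (fun i => (h2.2 i).2) hχ hχ01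
      (fun x hx => hχ0 x fun hx' => hx (sbox_subset_box hp hp2 x₀ hρ hσ hx'))
    change ∫⁻ x in box p x₀ (2 * ρ), ENNReal.ofReal (w (x, τ) * χ x) ^ r ≤
      Cs * (∫⁻ x in box p x₀ (2 * ρ), ENNReal.ofReal (w (x, τ) * χ x) ^ m) ^ (1 / S) *
        ∑ i, ∫⁻ x in box p x₀ (2 * ρ), ENNReal.ofReal (w (x, τ) * χ x) ^ (m - 2) *
          ENNReal.ofReal ({x | k + h < u (x, τ)}.indicator (fun x => |g i (x, τ)|) x * χ x +
            w (x, τ) * |fderiv ℝ χ x (Pi.single i 1)|) ^ p i at h3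
    have hWnn : ∀ x, 0 ≤ w (x, τ) * χ x := fun x => mul_nonneg (hw0 _) (hχ01 x).1
    have h4 : ∫⁻ x in sbox p x₀ ρ σ', ENNReal.ofReal (w (x, τ) ^ r) ≤
        ∫⁻ x in box p x₀ (2 * ρ), ENNReal.ofReal (w (x, τ) * χ x) ^ r := by
      refine le_trans (setLIntegral_mono' (measurableSet_sbox p x₀ ρ σ') fun x hx => ?_)
        (lintegral_mono_set (sbox_subset_box hp hp2 x₀ hρ (by linarith)))
      rw [hχ1 x hx, mul_one, ENNReal.ofReal_rpow_of_nonneg (hw0 _) (by linarith)]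
    refine h4.trans (h3.trans (mul_le_mul' (mul_le_mul' le_rfl (ENNReal.rpow_le_rpow ?_
      (by positivity))) (Finset.sum_le_sum fun i _ => lintegral_mono fun x => ?_)))
    · refine le_trans (lintegral_mono fun x => ?_) h1
      rw [ENNReal.ofReal_rpow_of_nonneg (hWnn x) (by linarith),
        ← ENNReal.ofReal_mul (Real.rpow_nonneg (le_max_right _ _) _),
        Real.mul_rpow (hw0 _) (hχ01 x).1]
      exact ENNReal.ofReal_le_ofReal (mul_le_mul_of_nonneg_left
        (hχζ x τ hτ.1.le m (by linarith)) (Real.rpow_nonneg (hw0 _) _))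
    -- Outside this box χ = 0, and the positive power m - 2 kills the whole integrand.
    · by_cases hx : x ∈ sbox p x₀ ρ σ
      · have hz : (x, τ) ∈ scyl p x₀ t₀ ρ σ := ⟨hx, by nlinarith [hτ.1], hτ.2⟩
        have ha0 : 0 ≤ {x | k + h < u (x, τ)}.indicator (fun x => |g i (x, τ)|) x :=
          indicator_nonneg (fun _ _ => abs_nonneg _) _
        have hin : 0 ≤ {x | k + h < u (x, τ)}.indicator (fun x => |g i (x, τ)|) x * χ x +
            w (x, τ) * |fderiv ℝ χ x (Pi.single i 1)| :=
          add_nonneg (mul_nonneg ha0 (hχ01 x).1) (mul_nonneg (hw0 _) (abs_nonneg _))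
        have hG : 0 ≤ max (|g i (x, τ)| - δ i) 0 ^ p i := Real.rpow_nonneg (le_max_right _ _) _
        have hwn : 0 ≤ w (x, τ) ^ (m - 2) := Real.rpow_nonneg (hw0 _) _
        simp only [hF, indicator_of_mem hz]
        rw [ENNReal.ofReal_rpow_of_nonneg (hWnn x) (by linarith),
          ENNReal.ofReal_rpow_of_nonneg hin (hp0 i).le,
          ← ENNReal.ofReal_mul (Real.rpow_nonneg (hWnn x) _), ← ENNReal.ofReal_mul hwn,
          ← ENNReal.ofReal_mul hM'0, ← ENNReal.ofReal_add (mul_nonneg hwn (mul_nonneg hG (hζ0 _)))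
            (mul_nonneg hM'0 (Real.rpow_nonneg (hw0' _) _)),
          show (9 : ℝ≥0∞) = ENNReal.ofReal 9 by norm_num, ← ENNReal.ofReal_mul (by norm_num)]
        refine ENNReal.ofReal_le_ofReal ?_
        refine weighted_gradient_le (hw0 _) (hδ i).1 (hδ i).2 (hχ01 x) (hp i) (hp2 i) hm
          (hχζ x τ hτ.1.le _ (by linarith [hp i])) (hχd' x i) hM0 ha0 ?_ ?_ ?_
        · exact indicator_le_self' (fun _ _ => abs_nonneg _) _
        · exact rpow_le_of_level_gap hlam hh hlh hm (hp0 i).le (hp2 i).le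
        · exact rpow_le_of_level_gap_scaled hh hρ hρh hm
      · rw [hχ0 x hx, mul_zero, ENNReal.ofReal_zero, ENNReal.zero_rpow_of_pos (by linarith),
          zero_mul]
        exact zero_le
  have hmain : ∫⁻ z in scyl p x₀ t₀ ρ σ', ENNReal.ofReal (w z ^ r) ≤
      Cs * (K₁ * K₂) ^ (1 / S) * (n * (9 * (K₂ + K₃))) * Z ^ (1 + 1 / S) := by
    rw [scyl, lintegral_prod_eq_slices (hwm.pow_const _).ennreal_ofReal]
    calc ∫⁻ τ in Ioo (t₀ - σ' * ρ) t₀, ∫⁻ x in sbox p x₀ ρ σ', ENNReal.ofReal (w (x, τ) ^ r)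
        ≤ ∫⁻ τ in Ioo (t₀ - σ' * ρ) t₀, Cs * (K₁ * X) ^ (1 / S) *
            ∑ i, ∫⁻ x in box p x₀ (2 * ρ), F i (x, τ) := lintegral_mono_ae hslice
      _ = Cs * (K₁ * X) ^ (1 / S) * ∑ i, ∫⁻ τ in Ioo (t₀ - σ' * ρ) t₀,
            ∫⁻ x in box p x₀ (2 * ρ), F i (x, τ) := by
          have hms : ∀ i, Measurable fun τ => ∫⁻ x in box p x₀ (2 * ρ), F i (x, τ) := fun i =>
            (hFm i).lintegral_prod_left'
          rw [lintegral_const_mul _ (Finset.measurable_fun_sum _ fun i _ => hms i),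
            lintegral_finsetSum _ fun i _ => hms i]
      _ ≤ Cs * (K₁ * (K₂ * Z)) ^ (1 / S) * ∑ _i : Fin n, 9 * (K₂ + K₃) * Z := by
          gcongr with i
          exact (lintegral_slices_le (hFm i) _ hIJ).trans (hFint i)
      _ = _ := by
          rw [Finset.sum_const, Finset.card_univ, Fintype.card_fin, nsmul_eq_mul, ← mul_assoc K₁,
            ENNReal.mul_rpow_of_nonneg _ _ (by positivity : 0 ≤ 1 / S),
            ENNReal.rpow_add_of_nonneg _ _ zero_le_one (by positivity), ENNReal.rpow_one]
          ring
  calc ∫⁻ z in scyl p x₀ t₀ ρ σ', ENNReal.ofReal (max (u z - (k + h + h)) 0 ^ m)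
      ≤ ∫⁻ z in scyl p x₀ t₀ ρ σ',
          ENNReal.ofReal (h ^ (-(r - m))) * ENNReal.ofReal (w z ^ r) := by
        refine lintegral_mono fun z => ?_
        rw [← ENNReal.ofReal_mul (by positivity)]
        exact ENNReal.ofReal_le_ofReal (rpow_le_of_higher_level hh (by linarith) hr)
    _ = ENNReal.ofReal (h ^ (-(r - m))) *
          ∫⁻ z in scyl p x₀ t₀ ρ σ', ENNReal.ofReal (w z ^ r) :=
        lintegral_const_mul _ (hwm.pow_const _).ennreal_ofReal
    _ ≤ ENNReal.ofReal (h ^ (-(r - m))) *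
          (Cs * (K₁ * K₂) ^ (1 / S) * (n * (9 * (K₂ + K₃))) * Z ^ (1 + 1 / S)) := by gcongr
    _ = _ := by ring

/-! ### The iteration -/

theorem pow_rpow_comm {x : ℝ} (hx : 0 ≤ x) (j : ℕ) (a : ℝ) : (x ^ j) ^ a = (x ^ a) ^ j := by
  rw [← Real.rpow_natCast, ← Real.rpow_mul hx, mul_comm, Real.rpow_mul hx, Real.rpow_natCast]

/-- Fast geometric convergence. -/
theorem fast_geometric_convergence {y : ℕ → ℝ} {Γ a b : ℝ} (hy : ∀ j, 0 ≤ y j) (ha : 0 < a)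
    (hb : 1 < b) (hΓ : 0 ≤ Γ) (hstep : ∀ j, y (j + 1) ≤ Γ * (b ^ a) ^ j * y j ^ (1 + a))
    (h0 : Γ * y 0 ^ a ≤ b⁻¹) (j : ℕ) : y j ≤ y 0 * (b⁻¹) ^ j := by
  have hb0 : 0 < b := by linarith
  induction j with
  | zero => simp
  | succ j ih =>
    have hy0 := hy 0
    -- The rate b⁻¹ is chosen so that the extra power a of the decay exactly compensates the growth
    -- of the coefficients.
    have e : (b ^ a) ^ j * ((b⁻¹) ^ j) ^ a = 1 := by
      rw [pow_rpow_comm (inv_nonneg.2 hb0.le), Real.inv_rpow hb0.le, ← mul_pow, mul_inv_cancel₀ (Real.rpow_pos_of_pos hb0 _).ne', one_pow]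
    calc y (j + 1) ≤ Γ * (b ^ a) ^ j * y j ^ (1 + a) := hstep j
      _ ≤ Γ * (b ^ a) ^ j * (y 0 * (b⁻¹) ^ j) ^ (1 + a) := by
          gcongr
          exact hy j
      _ = (Γ * y 0 ^ a) * (y 0 * (b⁻¹) ^ j) * ((b ^ a) ^ j * ((b⁻¹) ^ j) ^ a) := by
          rw [Real.rpow_add_of_nonneg (by positivity) zero_le_one ha.le, Real.rpow_one,
            Real.mul_rpow hy0 (by positivity)]
          ring
      _ ≤ b⁻¹ * (y 0 * (b⁻¹) ^ j) * ((b ^ a) ^ j * ((b⁻¹) ^ j) ^ a) := by gcongr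
      _ = y 0 * (b⁻¹) ^ (j + 1) := by rw [e]; ring
-- The coefficients grow like B^j with B = 2^d 16^(1+a), from h = K 2^(-j)/4 and (6·2^j)^4 =
-- 1296·16^j. Taking b = B^(1/a) matches the fast convergence lemma, and the lower bound on K is its
-- smallness condition.
theorem tendsto_zero_of_deGiorgi_step {Y : ℕ → ℝ≥0∞} {C : ℝ≥0∞} (hC : C ≠ ⊤) {K ρ a d V A : ℝ}
    (hK0 : 0 < K) (hρ : 0 < ρ) (ha0 : 0 < a) (hd0 : 0 < d) (hV : 0 ≤ V) (hA : 0 ≤ A)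
    (hstep : ∀ j, Y (j + 1) ≤ C * ENNReal.ofReal ((K * (1 / 2) ^ j / 4) ^ (-d)) *
      (ENNReal.ofReal ((6 * 2 ^ j) ^ 4 / ρ) * Y j) ^ (1 + a))
    (h0 : Y 0 ≤ ENNReal.ofReal (A * (V * ρ ^ (1 / a + 1))))
    (hK : C.toReal * 4 ^ d * 1296 ^ (1 + a) * V ^ a * (2 ^ d * 16 ^ (1 + a)) ^ (1 / a) * A ^ a ≤
      K ^ d) :
    Filter.Tendsto Y Filter.atTop (nhds 0) := by
  obtain ⟨C', hC'⟩ : ∃ C' : ℝ, C' = C.toReal * 4 ^ d * 1296 ^ (1 + a) := ⟨_, rfl⟩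
  have hC'0 : 0 ≤ C' := by rw [hC']; positivity
  obtain ⟨B, hB⟩ : ∃ B : ℝ, B = 2 ^ d * 16 ^ (1 + a) := ⟨_, rfl⟩
  have hB1 : 1 < B := by
    have h1 : (1 : ℝ) < 2 ^ d := Real.one_lt_rpow (by norm_num) hd0
    have h2 : (1 : ℝ) < 16 ^ (1 + a) := Real.one_lt_rpow (by norm_num) (by linarith)
    rw [hB]
    exact one_lt_mul_of_lt_of_le h1 h2.le
  obtain ⟨b, hb⟩ : ∃ b : ℝ, b = B ^ (1 / a) := ⟨_, rfl⟩
  have hb1 : 1 < b := hb ▸ Real.one_lt_rpow hB1 (by positivity)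
  have hba : b ^ a = B := by
    rw [hb, ← Real.rpow_mul (by linarith), one_div_mul_cancel ha0.ne', Real.rpow_one]
  rw [← hC', ← hB, ← hb] at hK
  have hhalf : ∀ j : ℕ, (0 : ℝ) < (1 / 2) ^ j := fun j => by positivity
  have hYfin : ∀ j, Y j ≠ ⊤ := by
    intro j
    induction j with
    | zero => exact ne_top_of_le_ne_top ENNReal.ofReal_ne_top h0
    | succ j ih =>
      refine ne_top_of_le_ne_top ?_ (hstep j)
      exact ENNReal.mul_ne_top (ENNReal.mul_ne_top hC ENNReal.ofReal_ne_top)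
        (ENNReal.rpow_ne_top_of_nonneg (by linarith)
          (ENNReal.mul_ne_top ENNReal.ofReal_ne_top ih))
  obtain ⟨Γ, hΓ⟩ : ∃ Γ : ℝ, Γ = C' * K ^ (-d) * ρ ^ (-(1 + a)) := ⟨_, rfl⟩
  have hy : ∀ j, (Y (j + 1)).toReal ≤ Γ * (b ^ a) ^ j * (Y j).toReal ^ (1 + a) := by
    intro j
    have h1 := ENNReal.toReal_mono (ENNReal.mul_ne_top (ENNReal.mul_ne_top hC ENNReal.ofReal_ne_top)
        (ENNReal.rpow_ne_top_of_nonneg (by linarith)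
          (ENNReal.mul_ne_top ENNReal.ofReal_ne_top (hYfin j)))) (hstep j)
    rw [ENNReal.toReal_mul, ENNReal.toReal_mul, ← ENNReal.toReal_rpow, ENNReal.toReal_mul,
      ENNReal.toReal_ofReal (by have := hhalf j; positivity),
      ENNReal.toReal_ofReal (by positivity)] at h1
    refine h1.trans (le_of_eq ?_)
    have e1 : (K * (1 / 2) ^ j / 4) ^ (-d) = K ^ (-d) * 4 ^ d * (2 ^ d) ^ j := by
      have : K * (1 / 2) ^ j / 4 = K * (4 * 2 ^ j)⁻¹ := by
        rw [one_div, inv_pow, mul_inv]; ring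
      rw [this, Real.mul_rpow hK0.le (by positivity), Real.inv_rpow (by positivity),
        Real.rpow_neg (x := 4 * 2 ^ j) (by positivity), inv_inv,
        Real.mul_rpow (by norm_num) (by positivity), pow_rpow_comm (by norm_num),
        mul_assoc]
    have e2 : ((6 * 2 ^ j) ^ 4 / ρ * (Y j).toReal) ^ (1 + a) =
        1296 ^ (1 + a) * (16 ^ (1 + a)) ^ j * ρ ^ (-(1 + a)) * (Y j).toReal ^ (1 + a) := by
      have : ((6 : ℝ) * 2 ^ j) ^ 4 / ρ = 1296 * 16 ^ j * ρ⁻¹ := by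
        rw [mul_pow, ← pow_mul, mul_comm j 4, pow_mul]
        norm_num
        ring
      rw [this, Real.mul_rpow (by positivity) ENNReal.toReal_nonneg,
        Real.mul_rpow (by positivity) (by positivity), Real.mul_rpow (by norm_num) (by positivity),
        Real.inv_rpow hρ.le, ← Real.rpow_neg hρ.le, pow_rpow_comm (by norm_num)]
    rw [e1, e2, hba, hΓ, hC', hB, mul_pow]
    ring
  have hΓ0 : 0 ≤ Γ := by rw [hΓ]; positivity
  -- Scale invariance: (1/a + 1) a = 1 + a, so the powers of ρ cancel.
  have hinit : Γ * (Y 0).toReal ^ a ≤ b⁻¹ := by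
    have h1 : (Y 0).toReal ≤ A * (V * ρ ^ (1 / a + 1)) :=
      ENNReal.toReal_le_of_le_ofReal (by positivity) h0
    have h2 : (A * (V * ρ ^ (1 / a + 1))) ^ a = A ^ a * V ^ a * ρ ^ (1 + a) := by
      rw [Real.mul_rpow hA (by positivity), Real.mul_rpow (by positivity) (by positivity),
        ← Real.rpow_mul hρ.le, mul_assoc]
      congr 3
      field_simp
    have h3 : ρ ^ (-(1 + a)) * ρ ^ (1 + a) = 1 := by
      rw [← Real.rpow_add hρ]; simp
    have h4 : K ^ (-d) * K ^ d = 1 := by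
      rw [← Real.rpow_add hK0]; simp
    calc Γ * (Y 0).toReal ^ a ≤ Γ * (A * (V * ρ ^ (1 / a + 1))) ^ a := by
          gcongr
      _ = (C' * V ^ a * b * A ^ a) * K ^ (-d) * b⁻¹ * (ρ ^ (-(1 + a)) * ρ ^ (1 + a)) := by
          rw [h2, hΓ]
          field_simp
      _ ≤ K ^ d * K ^ (-d) * b⁻¹ * 1 := by
          rw [h3]
          gcongr
      _ = b⁻¹ := by rw [mul_comm (K ^ d), h4]; ring
  have hdecay := fast_geometric_convergence (y := fun j => (Y j).toReal)
    (fun j => ENNReal.toReal_nonneg) ha0 hb1 hΓ0 hy hinit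
  have hlim : Filter.Tendsto (fun j : ℕ => ENNReal.ofReal ((Y 0).toReal * (b⁻¹) ^ j))
      Filter.atTop (nhds 0) := by
    rw [← ENNReal.ofReal_zero]
    refine ENNReal.tendsto_ofReal ?_
    have h1 := tendsto_pow_atTop_nhds_zero_of_lt_one (r := b⁻¹) (by positivity)
      (inv_lt_one_of_one_lt₀ hb1)
    simpa using h1.const_mul (Y 0).toReal
  refine tendsto_of_tendsto_of_tendsto_of_le_of_le tendsto_const_nhds hlim
    (fun j => zero_le) fun j => ?_
  rw [← ENNReal.ofReal_toReal (hYfin j)]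
  exact ENNReal.ofReal_le_ofReal (hdecay j)

theorem volume_Q (p x₀ : Fin n → ℝ) (t₀ : ℝ) {R : ℝ} (hR : 0 < R) :
    volume (Q p x₀ t₀ R) = ENNReal.ofReal (2 ^ n * R ^ (∑ i, 1 / p i) * R) := by
  rw [Q, Measure.volume_eq_prod, Measure.prod_prod, box, Real.volume_pi_Ioo, Real.volume_Ioo,
    ← ENNReal.ofReal_prod_of_nonneg, ← ENNReal.ofReal_mul]
  · congr 1
    have h : ∀ i, x₀ i + R ^ (1 / p i) - (x₀ i - R ^ (1 / p i)) = 2 * R ^ (1 / p i) := fun i => by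
      ring
    simp only [h]
    rw [Finset.prod_mul_distrib, Finset.prod_const, Finset.card_univ, Fintype.card_fin,
      ← Real.rpow_sum_of_pos hR]
    ring
  · refine Finset.prod_nonneg fun i _ => ?_
    have := Real.rpow_pos_of_pos hR (1 / p i)
    linarith
  · intro i _
    have := Real.rpow_pos_of_pos hR (1 / p i)
    linarith
/-- If one De Giorgi step holds on all the cylinders between `Q_ρ` and `Q_{2ρ}`, then `u ≤ K`
on `Q_ρ` for all large `K`. -/
theorem LocalSubsolution.ae_le_of_step {p δ x₀ : Fin n → ℝ} {c t₀ ρ : ℝ}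
    {u : (Fin n → ℝ) × ℝ → ℝ} {g : Fin n → (Fin n → ℝ) × ℝ → ℝ}
    (hsub : LocalSubsolution p δ c x₀ t₀ (2 * ρ) u g)
    (hp : ∀ i, 1 < p i) (hp2 : ∀ i, p i < 2) (hρ : 0 < ρ) {S m a d K V₀ avg : ℝ} {C : ℝ≥0∞}
    (hS : S = ∑ i, 1 / p i) (hm : 0 < m) (ha0 : 0 < a) (haS : 1 / a = S) (hd0 : 0 < d)
    (hK1 : 1 ≤ K) (hKρ2 : ρ ≤ K ^ 2) (hCt : C ≠ ⊤) (hV₀ : V₀ = 2 ^ n * 2 ^ S * 2)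
    (havg : 0 ≤ avg)
    (hstep : ∀ (σ σ' k h lam : ℝ), 1 ≤ σ' → σ' < σ → σ ≤ 4 / 3 → 0 < h → 1 ≤ lam →
        1 ≤ lam * (σ - σ') → 1 ≤ lam * h → ρ ≤ lam ^ 2 * h ^ 2 →
      ∫⁻ z in scyl p x₀ t₀ ρ σ', ENNReal.ofReal (max (u z - (k + h + h)) 0 ^ m) ≤
        C * ENNReal.ofReal (h ^ (-d)) *
          (ENNReal.ofReal (lam ^ 4 / ρ) *
            ∫⁻ z in scyl p x₀ t₀ ρ σ, ENNReal.ofReal (max (u z - k) 0 ^ m)) ^ (1 + a))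
    (hint : ∫⁻ z in Q p x₀ t₀ (2 * ρ), ENNReal.ofReal (max (u z) 0 ^ m) ≤
        ENNReal.ofReal avg * volume (Q p x₀ t₀ (2 * ρ)))
    (hKd : C.toReal * 4 ^ d * 1296 ^ (1 + a) * V₀ ^ a * (2 ^ d * 16 ^ (1 + a)) ^ (1 / a) *
      avg ^ a ≤ K ^ d) :
    ∀ᵐ z ∂(volume.restrict (Q p x₀ t₀ ρ)), u z ≤ K := by
  have hu := hsub.measurable
  have hV₀0 : 0 ≤ V₀ := by rw [hV₀]; positivity
  have hK0 : 0 < K := by linarith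
  have hhalf : ∀ j : ℕ, (0 : ℝ) < (1 / 2) ^ j := fun j => by positivity
  have hhalf1 : ∀ j : ℕ, ((1 : ℝ) / 2) ^ j ≤ 1 := fun j =>
    pow_le_one₀ (by norm_num) (by norm_num)
  have h22 : ∀ j : ℕ, (2 : ℝ) ^ j * (1 / 2) ^ j = 1 := fun j => by
    rw [← mul_pow]; norm_num
  -- Dilations decrease from 4/3 to 1 while levels increase from 0 to K. Consecutive levels differ
  -- by K 2^(-j)/2, twice the gap h used in one step.
  obtain ⟨Y, hY⟩ : ∃ Y : ℕ → ℝ≥0∞, ∀ j, Y j = ∫⁻ z in scyl p x₀ t₀ ρ (1 + (1 / 2) ^ j / 3),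
    ENNReal.ofReal (max (u z - K * (1 - (1 / 2) ^ j)) 0 ^ m) := ⟨_, fun j => rfl⟩
  have hYstep : ∀ j, Y (j + 1) ≤ C * ENNReal.ofReal ((K * (1 / 2) ^ j / 4) ^ (-d)) *
      (ENNReal.ofReal ((6 * 2 ^ j) ^ 4 / ρ) * Y j) ^ (1 + a) := by
    intro j
    have hj := hhalf j
    have hj1 := hhalf (j + 1)
    have h2j : (1 : ℝ) ≤ 2 ^ j := one_le_pow₀ (by norm_num)
    have c1 : (1 : ℝ) ≤ 1 + (1 / 2) ^ (j + 1) / 3 := by linarith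
    have c2 : (1 : ℝ) + (1 / 2) ^ (j + 1) / 3 < 1 + (1 / 2) ^ j / 3 := by
      rw [pow_succ]; linarith
    have c3 : (1 : ℝ) + (1 / 2) ^ j / 3 ≤ 4 / 3 := by linarith [hhalf1 j]
    -- Consecutive dilations differ by exactly 2^(-j)/6, whence lam = 6·2^j.
    have c4 : (1 : ℝ) ≤ 6 * 2 ^ j *
        ((1 + (1 / 2) ^ j / 3) - (1 + (1 / 2) ^ (j + 1) / 3)) := by
      have e : (6 : ℝ) * 2 ^ j * ((1 + (1 / 2) ^ j / 3) - (1 + (1 / 2) ^ (j + 1) / 3)) =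
          2 ^ j * (1 / 2) ^ j := by rw [pow_succ]; ring
      rw [e, h22]
    have c5 : (1 : ℝ) ≤ 6 * 2 ^ j * (K * (1 / 2) ^ j / 4) := by
      have e : (6 : ℝ) * 2 ^ j * (K * (1 / 2) ^ j / 4) = 3 / 2 * K * (2 ^ j * (1 / 2) ^ j) := by
        ring
      rw [e, h22]
      linarith
    have c6 : ρ ≤ (6 * 2 ^ j) ^ 2 * (K * (1 / 2) ^ j / 4) ^ 2 := by
      have e : (6 * 2 ^ j) ^ 2 * (K * (1 / 2) ^ j / 4) ^ 2 =
          9 / 4 * K ^ 2 * ((2 : ℝ) ^ j * (1 / 2) ^ j) ^ 2 := by ring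
      rw [e, h22]
      linarith [sq_nonneg K]
    have h1 := hstep _ _ (K * (1 - (1 / 2) ^ j)) _ _ c1 c2 c3
      (by positivity : 0 < K * (1 / 2) ^ j / 4) (by linarith) c4 c5 c6
    have e : K * (1 - (1 / 2) ^ j) + K * (1 / 2) ^ j / 4 + K * (1 / 2) ^ j / 4 =
        K * (1 - (1 / 2) ^ (j + 1)) := by
      rw [pow_succ]; ring
    rw [e, ← hY, ← hY] at h1
    exact h1
  have hvol := volume_Q p x₀ t₀ (by linarith : (0 : ℝ) < 2 * ρ)
  have hV : 2 ^ n * (2 * ρ) ^ (∑ i, 1 / p i) * (2 * ρ) = V₀ * ρ ^ (1 / a + 1) := by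
    rw [← hS, haS, Real.mul_rpow (by norm_num) hρ.le, Real.rpow_add hρ, Real.rpow_one, hV₀]
    ring
  rw [hV] at hvol
  have hY0 : Y 0 ≤ ENNReal.ofReal (avg * (V₀ * ρ ^ (1 / a + 1))) := by
    rw [ENNReal.ofReal_mul havg, ← hvol, hY]
    refine le_trans ?_ hint
    simp only [pow_zero, sub_self, mul_zero, sub_zero]
    exact lintegral_mono_set (scyl_subset_Q hp hp2 x₀ t₀ hρ (by norm_num))
  have hlim := tendsto_zero_of_deGiorgi_step hCt hK0 hρ ha0 hd0 hV₀0 havg hYstep hY0 hKd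
  have hm1 : Measurable fun z => ENNReal.ofReal (max (u z - K) 0 ^ m) :=
    (((hu.sub_const K).max measurable_const).pow_const m).ennreal_ofReal
  have hle : ∀ j, ∫⁻ z in Q p x₀ t₀ ρ, ENNReal.ofReal (max (u z - K) 0 ^ m) ≤ Y j := by
    intro j
    rw [← scyl_one, hY]
    refine le_trans (lintegral_mono_set (scyl_mono p x₀ t₀ hρ
      (by linarith [hhalf j] : (1 : ℝ) ≤ 1 + (1 / 2) ^ j / 3))) (lintegral_mono fun z => ?_)
    refine ENNReal.ofReal_le_ofReal (Real.rpow_le_rpow (le_max_right _ _) ?_ hm.le)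
    refine max_le_max (sub_le_sub_left ?_ _) le_rfl
    have := mul_pos hK0 (hhalf j)
    linarith
  have hzero : ∫⁻ z in Q p x₀ t₀ ρ, ENNReal.ofReal (max (u z - K) 0 ^ m) = 0 :=
    le_antisymm (ge_of_tendsto' hlim hle) zero_le
  rw [lintegral_eq_zero_iff hm1] at hzero
  filter_upwards [hzero] with z hz
  by_contra h
  rw [not_le] at h
  have h1 : 0 < max (u z - K) 0 := lt_max_of_lt_left (by linarith)
  have h2 : 0 < max (u z - K) 0 ^ m := Real.rpow_pos_of_pos h1 m
  exact absurd hz (ENNReal.ofReal_pos.2 h2).ne'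

/-- The local sup bound for measurable local subsolutions. -/
theorem LocalSubsolution.exists_sup_bound (hn : 2 ≤ n) {p : Fin n → ℝ} (hp : ∀ i, 1 < p i)
    (hp2 : ∀ i, p i < 2) {S m c D : ℝ} (hS : S = ∑ i, 1 / p i) (hS1 : 1 < S) (hm2 : 2 < m)
    (hm : 2 * S - n < m) (hc : 0 < c) :
    ∃ C : ℝ, 0 < C ∧ ∀ (δ : Fin n → ℝ), (∀ i, 0 ≤ δ i ∧ δ i ≤ D) →
      ∀ (x₀ : Fin n → ℝ) (t₀ ρ : ℝ) (u : (Fin n → ℝ) × ℝ → ℝ)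
        (g : Fin n → (Fin n → ℝ) × ℝ → ℝ), 0 < ρ → LocalSubsolution p δ c x₀ t₀ (2 * ρ) u g →
      ∀ avg : ℝ, 0 ≤ avg → ∫⁻ z in Q p x₀ t₀ (2 * ρ), ENNReal.ofReal (max (u z) 0 ^ m) ≤
        ENNReal.ofReal avg * volume (Q p x₀ t₀ (2 * ρ)) →
      ∀ᵐ z ∂(volume.restrict (Q p x₀ t₀ ρ)), u z ≤ C * (avg ^ (1 / (m - (2 * S - n))) + 1 + √ρ) := by
  have hS0 : 0 < S := by linarith
  obtain ⟨d, hd⟩ : ∃ d : ℝ, d = m / S + n / S + m - 2 - m := ⟨_, rfl⟩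
  have hdS : d = (m - (2 * S - n)) / S := by
    rw [hd]; field_simp; ring
  have hd0 : 0 < d := by rw [hdS]; exact div_pos (by linarith) hS0
  obtain ⟨a, ha⟩ : ∃ a : ℝ, a = 1 / S := ⟨_, rfl⟩
  have ha0 : 0 < a := by rw [ha]; positivity
  have haS : 1 / a = S := by rw [ha, one_div_one_div]
  obtain ⟨C, hCt, hstep⟩ := deGiorgi_step (D := D) hn hp hp2 hS hS1 hm2
    (by linarith : m ≤ m / S + n / S + m - 2) hc
  rw [← hd, ← ha] at hstep
  obtain ⟨V₀, hV₀⟩ : ∃ V₀ : ℝ, V₀ = 2 ^ n * 2 ^ S * 2 := ⟨_, rfl⟩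
  have hV₀0 : 0 ≤ V₀ := by rw [hV₀]; positivity
  obtain ⟨E, hE⟩ : ∃ E : ℝ, E = C.toReal * 4 ^ d * 1296 ^ (1 + a) * V₀ ^ a *
    (2 ^ d * 16 ^ (1 + a)) ^ (1 / a) := ⟨_, rfl⟩
  have hE0 : 0 ≤ E := by rw [hE]; positivity
  obtain ⟨C₁, hC₁⟩ : ∃ C₁ : ℝ, C₁ = max 1 (E ^ (1 / d)) := ⟨_, rfl⟩
  have hC₁1 : 1 ≤ C₁ := hC₁ ▸ le_max_left _ _
  have hC₁E : E ≤ C₁ ^ d := by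
    calc E = (E ^ (1 / d)) ^ d := by
          rw [← Real.rpow_mul hE0, one_div_mul_cancel hd0.ne', Real.rpow_one]
      _ ≤ C₁ ^ d := Real.rpow_le_rpow (by positivity) (hC₁ ▸ le_max_right _ _) hd0.le
  refine ⟨C₁, by linarith, ?_⟩
  intro δ hδ x₀ t₀ ρ u g hρ hsub avg havg hint
  have hav0 : 0 ≤ avg ^ (1 / (m - (2 * S - n))) := Real.rpow_nonneg havg _
  have hsq0 : 0 ≤ √ρ := Real.sqrt_nonneg _
  obtain ⟨w, hw⟩ : ∃ w, w = avg ^ (1 / (m - (2 * S - n))) := ⟨_, rfl⟩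
  rw [← hw] at hav0 ⊢
  -- Each summand meets one requirement: w the smallness of the initial integral, 1 the condition
  -- lam h ≥ 1, and √ρ the condition ρ ≤ lam² h².
  obtain ⟨K, hK⟩ : ∃ K, K = C₁ * (w + 1 + √ρ) := ⟨_, rfl⟩
  rw [← hK]
  have hKw : w + 1 + √ρ ≤ K := by
    rw [hK]; exact le_mul_of_one_le_left (by linarith) hC₁1
  have hK1 : 1 ≤ K := by linarith
  have hKρ2 : ρ ≤ K ^ 2 := by
    calc ρ = √ρ ^ 2 := (Real.sq_sqrt hρ.le).symm
      _ ≤ K ^ 2 := pow_le_pow_left₀ hsq0 (by linarith) 2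
  have hK0 : 0 < K := by linarith
  have hKd : E * avg ^ a ≤ K ^ d := by
    -- The exponent in the sup bound is a/d, since d = (m - (2S - n))/S and a = 1/S.
    have h1 : w ^ d = avg ^ a := by
      rw [hw, ← Real.rpow_mul havg]
      congr 1
      have : m - (2 * S - n) ≠ 0 := by linarith
      rw [hdS, ha]
      field_simp
    calc E * avg ^ a ≤ C₁ ^ d * w ^ d := by
          rw [h1]; exact mul_le_mul_of_nonneg_right hC₁E (Real.rpow_nonneg havg _)
      _ = (C₁ * w) ^ d := (Real.mul_rpow (by linarith) hav0).symm
      _ ≤ K ^ d := by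
          refine Real.rpow_le_rpow (mul_nonneg (by linarith) hav0) ?_ hd0.le
          rw [hK]
          exact mul_le_mul_of_nonneg_left (by linarith) (by linarith)
  exact hsub.ae_le_of_step hp hp2 hρ hS (by linarith) ha0 haS hd0 hK1 hKρ2 hCt hV₀ havg
    (hstep δ hδ x₀ t₀ ρ u g hρ hsub) hint (hE ▸ hKd)

/-! ### From the energy class to measurable local subsolutions -/

theorem ae_ae_slice_of_ae_prod {α β : Type*} [MeasurableSpace α] [MeasurableSpace β]
    {μ : Measure α} {ν : Measure β} [SFinite μ] [SFinite ν] {P : α × β → Prop}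
    (h : ∀ᵐ z ∂(μ.prod ν), P z) : ∀ᵐ t ∂ν, ∀ᵐ x ∂μ, P (x, t) := by
  have h' : ∀ᵐ z ∂(ν.prod μ), P z.swap :=
    (Measure.measurePreserving_swap (μ := ν) (ν := μ)).quasiMeasurePreserving.ae h
  exact Measure.ae_ae_of_ae_prod h'

theorem volume_restrict_Q (p x₀ : Fin n → ℝ) (t₀ R : ℝ) :
    (volume.restrict (Q p x₀ t₀ R)) =
      (volume.restrict (box p x₀ R)).prod (volume.restrict (Ioo (t₀ - R) t₀)) := by
  rw [Measure.prod_restrict, Q, Measure.volume_eq_prod]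

theorem ae_ae_slice_of_ae_Q {p x₀ : Fin n → ℝ} {t₀ R : ℝ} {P : (Fin n → ℝ) × ℝ → Prop}
    (h : ∀ᵐ z ∂(volume.restrict (Q p x₀ t₀ R)), P z) :
    ∀ᵐ t ∂(volume.restrict (Ioo (t₀ - R) t₀)), ∀ᵐ x ∂(volume.restrict (box p x₀ R)), P (x, t) := by
  rw [volume_restrict_Q] at h
  exact ae_ae_slice_of_ae_prod h

theorem isOpen_box (p x₀ : Fin n → ℝ) (R : ℝ) : IsOpen (box p x₀ R) :=
  isOpen_set_pi finite_univ fun _ _ => isOpen_Ioo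

theorem isOpen_Q (p x₀ : Fin n → ℝ) (t₀ R : ℝ) : IsOpen (Q p x₀ t₀ R) :=
  (isOpen_box p x₀ R).prod isOpen_Ioo

theorem center_mem_box (p x₀ : Fin n → ℝ) {R : ℝ} (hR : 0 < R) : x₀ ∈ box p x₀ R := fun i _ => by
  have := Real.rpow_pos_of_pos hR (1 / p i)
  exact ⟨by linarith, by linarith⟩

/-- Allows passage to Borel representatives. The supremum term sees time slices, where Fubini's
theorem gives equality for almost every time only; an essential supremum does not notice. -/
theorem EnergyIneq.congr_ae {p δ x₀ : Fin n → ℝ} {c t₀ ρ : ℝ} {w w' : (Fin n → ℝ) × ℝ → ℝ}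
    {A A' : Set ((Fin n → ℝ) × ℝ)} {g g' : Fin n → (Fin n → ℝ) × ℝ → ℝ}
    {ζ : (Fin n → ℝ) × ℝ → ℝ} (h : EnergyIneq p δ c x₀ t₀ ρ w A g ζ)
    (hw : ∀ᵐ z ∂(volume.restrict (Q p x₀ t₀ ρ)), w z = w' z)
    (hA : ∀ᵐ z ∂(volume.restrict (Q p x₀ t₀ ρ)), z ∈ A ↔ z ∈ A')
    (hg : ∀ i, ∀ᵐ z ∂(volume.restrict (Q p x₀ t₀ ρ)), g i z = g' i z) :
    EnergyIneq p δ c x₀ t₀ ρ w' A' g' ζ := by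
  unfold EnergyIneq at h ⊢
  have e1 : essSup (fun τ => ∫⁻ x in box p x₀ ρ, ENNReal.ofReal (w (x, τ) ^ 2 * ζ (x, τ)))
      (volume.restrict (Ioo (t₀ - ρ) t₀)) =
      essSup (fun τ => ∫⁻ x in box p x₀ ρ, ENNReal.ofReal (w' (x, τ) ^ 2 * ζ (x, τ)))
      (volume.restrict (Ioo (t₀ - ρ) t₀)) := by
    refine essSup_congr_ae ?_
    filter_upwards [ae_ae_slice_of_ae_Q hw] with t ht
    refine lintegral_congr_ae ?_
    filter_upwards [ht] with x hx
    rw [hx]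
  have e2 : ∀ i, ∫⁻ z in Q p x₀ t₀ ρ,
        A.indicator (fun z => ENNReal.ofReal (max (|g i z| - δ i) 0 ^ p i * ζ z)) z =
      ∫⁻ z in Q p x₀ t₀ ρ,
        A'.indicator (fun z => ENNReal.ofReal (max (|g' i z| - δ i) 0 ^ p i * ζ z)) z := by
    intro i
    refine lintegral_congr_ae ?_
    filter_upwards [hA, hg i] with z hz hgz
    by_cases hzA : z ∈ A
    · rw [indicator_of_mem hzA, indicator_of_mem (hz.1 hzA), hgz]
    · rw [indicator_of_notMem hzA, indicator_of_notMem fun h' => hzA (hz.2 h')]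
  have e3 : ∫⁻ z in Q p x₀ t₀ ρ, ENNReal.ofReal (w z ^ 2 * deriv (fun s => ζ (z.1, s)) z.2) =
      ∫⁻ z in Q p x₀ t₀ ρ, ENNReal.ofReal (w' z ^ 2 * deriv (fun s => ζ (z.1, s)) z.2) := by
    refine lintegral_congr_ae ?_
    filter_upwards [hw] with z hz
    rw [hz]
  have e4 : ∀ i, ∫⁻ z in Q p x₀ t₀ ρ, ENNReal.ofReal (w z ^ p i *
          |deriv (fun s => ζ (Function.update z.1 i s, z.2) ^ (1 / p i)) (z.1 i)| ^ p i) =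
      ∫⁻ z in Q p x₀ t₀ ρ, ENNReal.ofReal (w' z ^ p i *
          |deriv (fun s => ζ (Function.update z.1 i s, z.2) ^ (1 / p i)) (z.1 i)| ^ p i) := by
    intro i
    refine lintegral_congr_ae ?_
    filter_upwards [hw] with z hz
    rw [hz]
  rw [← e1, ← e3]
  simp only [← e2, ← e4]
  exact h

theorem setIntegral_mul_eq_of_tsupport_subset {α : Type*} [MeasurableSpace α] [TopologicalSpace α]
    {μ : Measure α} {B Ω : Set α} (hB : B ⊆ Ω) (hΩ : MeasurableSet Ω) {f ψ : α → ℝ}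
    (hψ : ∀ x ∉ B, ψ x = 0) : ∫ x in Ω, f x * ψ x ∂μ = ∫ x in B, f x * ψ x ∂μ := by
  refine setIntegral_eq_of_subset_of_forall_sdiff_eq_zero hΩ hB fun x hx => ?_
  rw [hψ x hx.2, mul_zero]

/-- Local integrability yields Borel representatives of u and g on the cylinder. Almost every slice
agrees with the original one, and the weak derivative identity on Ω localises to the box through the
supports of the test functions. -/
theorem DGplus.exists_localSubsolution {p δ x₀ : Fin n → ℝ} {Ω : Set (Fin n → ℝ)}
    {T c t₀ R : ℝ} {u : (Fin n → ℝ) × ℝ → ℝ} (hn : 0 < n) (hΩ : MeasurableSet Ω)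
    (hu : DGplus p δ Ω T c u) (hR : 0 < R)
    (hQ : CompactlyContained (Q p x₀ t₀ R) (cyl Ω T)) :
    ∃ u' g', LocalSubsolution p δ c x₀ t₀ R u' g' ∧
      ∀ᵐ z ∂(volume.restrict (Q p x₀ t₀ R)), u z = u' z := by
  obtain ⟨-, g, ⟨hu1, hg1, hw⟩, hE⟩ := hu
  have hloc : ∀ f : (Fin n → ℝ) × ℝ → ℝ, MemLpLoc f 1 (cyl Ω T) →
      AEStronglyMeasurable f (volume.restrict (Q p x₀ t₀ R)) := fun f hf =>
    (hf _ hQ.1 hQ.2).1.mono_measure (Measure.restrict_mono subset_closure le_rfl)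
  have hum := hloc u hu1
  have hgm := fun i => hloc (g i) (hg1 i).1
  have hue := hum.ae_eq_mk
  have hge := fun i => (hgm i).ae_eq_mk
  refine ⟨hum.mk u, fun i => (hgm i).mk (g i), ⟨hum.stronglyMeasurable_mk.measurable,
    fun i => (hgm i).stronglyMeasurable_mk.measurable, ?_, ?_⟩, hue⟩
  · have hne : (Ioo (t₀ - R) t₀).Nonempty := nonempty_Ioo.2 (by linarith)
    have hcl : closure (Q p x₀ t₀ R) = closure (box p x₀ R) ×ˢ closure (Ioo (t₀ - R) t₀) :=
      closure_prod_eq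
    have hbne : (closure (box p x₀ R)).Nonempty := ⟨x₀, subset_closure (center_mem_box p x₀ hR)⟩
    have hsub : closure (box p x₀ R) ⊆ Ω ∧ closure (Ioo (t₀ - R) t₀) ⊆ Ioo 0 T := by
      have h := hQ.2
      rw [hcl, cyl, prod_subset_prod_iff] at h
      rcases h with h | h | h
      · exact h
      · exact absurd h hbne.ne_empty
      · exact absurd h hne.closure.ne_empty
    have hcpt : IsCompact (closure (box p x₀ R)) := by
      have h := hQ.1.image continuous_fst
      rwa [hcl, fst_image_prod _ hne.closure] at h
    have hbΩ : box p x₀ R ⊆ Ω := subset_closure.trans hsub.1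
    have hw' : ∀ᵐ t ∂(volume.restrict (Ioo (t₀ - R) t₀)), ∀ i,
        HasWeakPartial Ω i (fun x => u (x, t)) (fun x => g i (x, t)) :=
      ae_mono (Measure.restrict_mono (subset_closure.trans hsub.2) le_rfl) hw
    have hge' : ∀ᵐ z ∂(volume.restrict (Q p x₀ t₀ R)), ∀ i, g i z = (hgm i).mk (g i) z :=
      ae_all_iff.2 hge
    have hint : ∀ f : (Fin n → ℝ) → ℝ, MemLpLoc f 1 Ω → IntegrableOn f (box p x₀ R) := by
      intro f hf
      have h := hf _ hcpt hsub.1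
      rw [ENNReal.ofReal_one, memLp_one_iff_integrable] at h
      exact h.mono_measure (Measure.restrict_mono subset_closure le_rfl)
    filter_upwards [hw', ae_ae_slice_of_ae_Q hge', ae_ae_slice_of_ae_Q hue]
      with t ht htg htu
    -- Integrability of the slice of u is part of each weak partial derivative statement, so some
    -- index is needed; n > 0 supplies it.
    refine ⟨(hint _ (ht ⟨0, hn⟩).1).congr htu, fun i => ?_⟩
    have htgi : (fun x => g i (x, t)) =ᵐ[volume.restrict (box p x₀ R)]
        fun x => (hgm i).mk (g i) (x, t) := htg.mono fun x hx => hx i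
    refine ⟨(hint _ (ht i).2.1).congr htgi, fun φ hφ hφc hφs => ?_⟩
    have h := (ht i).2.2 φ hφ hφc (hφs.trans hbΩ)
    rw [setIntegral_mul_eq_of_tsupport_subset (B := box p x₀ R) hbΩ hΩ (fun x hx => by
        rw [fderiv_of_notMem_tsupport ℝ fun h' => hx (hφs h')]; rfl),
      setIntegral_mul_eq_of_tsupport_subset (B := box p x₀ R) hbΩ hΩ
        (fun x hx => image_eq_zero_of_notMem_tsupport fun h' => hx (hφs h'))] at h
    have e1 : ∫ x in box p x₀ R, hum.mk u (x, t) * fderiv ℝ φ x (Pi.single i 1) =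
        ∫ x in box p x₀ R, u (x, t) * fderiv ℝ φ x (Pi.single i 1) :=
      integral_congr_ae (htu.mono fun x hx => by simp only [hx])
    have e2 : ∫ x in box p x₀ R, (hgm i).mk (g i) (x, t) * φ x =
        ∫ x in box p x₀ R, g i (x, t) * φ x :=
      integral_congr_ae (htgi.mono fun x hx => by simp only [← hx])
    rw [e1, e2]
    exact h
  · intro ζ hζ k
    refine (hE x₀ t₀ R hR hQ ζ hζ k).congr_ae ?_ ?_ hge
    · filter_upwards [hue] with z hz
      rw [hz]
    · filter_upwards [hue] with z hz
      show k < _ ↔ k < _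
      rw [hz]

theorem MemLpLoc.neg {X : Type*} [TopologicalSpace X] [MeasureSpace X] {f : X → ℝ} {q : ℝ}
    {U : Set X} (hf : MemLpLoc f q U) : MemLpLoc (fun z => -f z) q U :=
  fun K hK hKU => (hf K hK hKU).neg

/-- The truncation of u below level -k is that of -u above level k, and the energy sees the gradient
only through absolute values. -/
theorem DGminus.neg {p δ : Fin n → ℝ} {Ω : Set (Fin n → ℝ)} {T c : ℝ}
    {u : (Fin n → ℝ) × ℝ → ℝ} (hu : DGminus p δ Ω T c u) :
    DGplus p δ Ω T c (fun z => -u z) := by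
  obtain ⟨hP, g, ⟨hu1, hg1, hw⟩, hE⟩ := hu
  refine ⟨hP.neg, fun i z => -g i z, ⟨hu1.neg, fun i => ⟨(hg1 i).1.neg, (hg1 i).2.neg⟩, ?_⟩, ?_⟩
  · filter_upwards [hw] with t ht i
    refine ⟨(ht i).1.neg, (ht i).2.1.neg, fun φ hφ hφc hφs => ?_⟩
    have h := (ht i).2.2 φ hφ hφc hφs
    simp only [neg_mul, integral_neg, h]
  · intro x₀ t₀ ρ hρ hQ ζ hζ k
    have h := hE x₀ t₀ ρ hρ hQ ζ hζ (-k)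
    have e1 : (fun z => max (-(u z - -k)) 0) = fun z => max (-u z - k) 0 := by
      ext z; congr 1; ring
    have e2 : {z | u z < -k} = {z | k < -u z} := by
      ext z; exact lt_neg (a := u z) (b := k)
    rw [e1, e2] at h
    unfold EnergyIneq at h ⊢
    simpa only [abs_neg] using h

theorem locBddAbove_of_Q {p : Fin n → ℝ} (hp : ∀ i, 1 < p i) (hp2 : ∀ i, p i < 2)
    {Ω : Set (Fin n → ℝ)} (hΩ : IsOpen Ω) {T : ℝ} {u : (Fin n → ℝ) × ℝ → ℝ}
    (h : ∀ (x₀ : Fin n → ℝ) (t₀ ρ : ℝ), 0 < ρ →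
      CompactlyContained (Q p x₀ t₀ (2 * ρ)) (cyl Ω T) →
      ∃ M : ℝ, ∀ᵐ z ∂(volume.restrict (Q p x₀ t₀ ρ)), u z ≤ M) :
    LocBddAbove u (cyl Ω T) := by
  intro K hK hKU
  refine hK.induction_on (p := fun s => ∃ M : ℝ, ∀ᵐ z ∂(volume.restrict s), u z ≤ M)
    ⟨0, by simp⟩ ?_ ?_ ?_
  · rintro s t hst ⟨M, hM⟩
    exact ⟨M, ae_mono (Measure.restrict_mono hst le_rfl) hM⟩
  · rintro s t ⟨M, hM⟩ ⟨N, hN⟩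
    refine ⟨max M N, ?_⟩
    rw [ae_restrict_union_iff]
    exact ⟨hM.mono fun z hz => hz.trans (le_max_left _ _),
      hN.mono fun z hz => hz.trans (le_max_right _ _)⟩
  · rintro ⟨x, t⟩ hz
    obtain ⟨ε, hε, hball⟩ := Metric.isOpen_iff.1 (hΩ.prod isOpen_Ioo) (x, t) (hKU hz)
    -- The cylinder of radius r² fits in the ball of radius r, as (r²)^(1/p_i) ≤ r for p_i < 2 and r
    -- ≤ 1. Its vertex is moved forward in time by r²/4 so that the given point is interior to the
    -- backward cylinder of radius r²/2.
    obtain ⟨r, hr0, hrε, hr1⟩ : ∃ r : ℝ, 0 < r ∧ r < ε ∧ r ≤ 1 :=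
      ⟨min (ε / 2) 1, by positivity, (min_le_left _ _).trans_lt (by linarith), min_le_right _ _⟩
    have hρ : 0 < r ^ 2 / 2 := by positivity
    have h2ρ : 2 * (r ^ 2 / 2) = r ^ 2 := by ring
    have hr2 : r ^ 2 ≤ r := by nlinarith
    have hQ : Q p x (t + r ^ 2 / 4) (2 * (r ^ 2 / 2)) ⊆ Metric.closedBall (x, t) r := by
      rintro ⟨y, s⟩ ⟨hy, hs⟩
      rw [h2ρ] at hy hs
      rw [Metric.mem_closedBall, Prod.dist_eq]
      refine max_le ((dist_pi_le_iff hr0.le).2 fun i => ?_) ?_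
      · have hi := hy i (mem_univ i)
        have hpi := hp i
        have e : (r ^ 2) ^ (1 / p i) ≤ r := by
          calc (r ^ 2) ^ (1 / p i) ≤ (r ^ 2) ^ ((1 : ℝ) / 2) :=
                Real.rpow_le_rpow_of_exponent_ge (by positivity) (by nlinarith)
                  (one_div_le_one_div_of_le (by linarith) (hp2 i).le)
            _ = r := by rw [← Real.sqrt_eq_rpow, Real.sqrt_sq hr0.le]
        rw [Real.dist_eq, abs_le]
        exact ⟨by linarith [hi.1], by linarith [hi.2]⟩
      · rw [Real.dist_eq, abs_le]
        have hs1 := hs.1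
        have hs2 := hs.2
        simp only at hs1 hs2 ⊢
        exact ⟨by linarith, by linarith⟩
    have hcc : CompactlyContained (Q p x (t + r ^ 2 / 4) (2 * (r ^ 2 / 2))) (cyl Ω T) := by
      have hcl := closure_minimal hQ Metric.isClosed_closedBall
      exact ⟨(isCompact_closedBall _ _).of_isClosed_subset isClosed_closure hcl,
        hcl.trans ((Metric.closedBall_subset_ball hrε).trans hball)⟩
    refine ⟨Q p x (t + r ^ 2 / 4) (r ^ 2 / 2), mem_nhdsWithin_of_mem_nhds
      ((isOpen_Q p x _ _).mem_nhds ⟨center_mem_box p x hρ, ?_, ?_⟩), h _ _ _ hρ hcc⟩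
    · simp only; linarith
    · simp only; linarith

theorem lintegral_rpow_le_average {p x₀ : Fin n → ℝ} {t₀ R m : ℝ} (hR : 0 < R) (hm : 0 < m)
    {u : (Fin n → ℝ) × ℝ → ℝ}
    (hu : MemLp u (ENNReal.ofReal m) (volume.restrict (Q p x₀ t₀ R))) :
    ∫⁻ z in Q p x₀ t₀ R, ENNReal.ofReal (max (u z) 0 ^ m) ≤
      ENNReal.ofReal (⨍ z in Q p x₀ t₀ R, max (u z) 0 ^ m) * volume (Q p x₀ t₀ R) := by
  have hint : Integrable (fun z => max (u z) 0 ^ m) (volume.restrict (Q p x₀ t₀ R)) := by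
    have h := hu.integrable_norm_rpow (by simpa using hm) ENNReal.ofReal_ne_top
    rw [ENNReal.toReal_ofReal hm.le] at h
    refine h.mono' ((hu.1.aemeasurable.max aemeasurable_const).pow_const m).aestronglyMeasurable ?_
    refine Filter.Eventually.of_forall fun z => ?_
    rw [Real.norm_of_nonneg (Real.rpow_nonneg (le_max_right _ _) _), Real.norm_eq_abs]
    exact Real.rpow_le_rpow (le_max_right _ _) (max_le (le_abs_self _) (abs_nonneg _)) hm.le
  have hpos : 0 < 2 ^ n * R ^ (∑ i, 1 / p i) * R := by positivity
  rw [← ofReal_integral_eq_lintegral_ofReal hint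
    (Filter.Eventually.of_forall fun z => Real.rpow_nonneg (le_max_right _ _) _), setAverage_eq,
    Measure.real, volume_Q p x₀ t₀ hR, ENNReal.toReal_ofReal hpos.le, smul_eq_mul,
    ← ENNReal.ofReal_mul' hpos.le]
  refine le_of_eq (congrArg _ ?_)
  field_simp

/-- The local sup bound for functions of the class `DG⁺`, in almost everywhere form. -/
theorem DGplus.exists_ae_bound (hn : 2 ≤ n) {p : Fin n → ℝ} (hp : ∀ i, 1 < p i)
    (hp2 : ∀ i, p i < 2) {S m c D : ℝ} (hS : S = ∑ i, 1 / p i) (hS1 : 1 < S) (hm2 : 2 < m)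
    (hm : 2 * S - n < m) (hc : 0 < c) :
    ∃ C : ℝ, 0 < C ∧ ∀ (δ : Fin n → ℝ), (∀ i, 0 ≤ δ i ∧ δ i ≤ D) →
      ∀ (Ω : Set (Fin n → ℝ)), IsOpen Ω → ∀ (T : ℝ) (u : (Fin n → ℝ) × ℝ → ℝ),
      MemLpLoc u m (cyl Ω T) → DGplus p δ Ω T c u →
      ∀ (x₀ : Fin n → ℝ) (t₀ ρ : ℝ), 0 < ρ →
        CompactlyContained (Q p x₀ t₀ (2 * ρ)) (cyl Ω T) →
        ∀ᵐ z ∂(volume.restrict (Q p x₀ t₀ ρ)),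
          u z ≤ C * ((⨍ z in Q p x₀ t₀ (2 * ρ), max (u z) 0 ^ m) ^ (1 / (m - (2 * S - n))) +
            1 + √ρ) := by
  obtain ⟨C, hC, h⟩ := LocalSubsolution.exists_sup_bound (D := D) hn hp hp2 hS hS1 hm2 hm hc
  refine ⟨C, hC, fun δ hδ Ω hΩ T u hum hu x₀ t₀ ρ hρ hQ => ?_⟩
  have hR : 0 < 2 * ρ := by linarith
  obtain ⟨u', g', hsub, hue⟩ := hu.exists_localSubsolution (by omega) hΩ.measurableSet hR hQ
  have hmem : MemLp u (ENNReal.ofReal m) (volume.restrict (Q p x₀ t₀ (2 * ρ))) :=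
    (hum _ hQ.1 hQ.2).mono_measure (Measure.restrict_mono subset_closure le_rfl)
  have hint := lintegral_rpow_le_average hR (by linarith : 0 < m) hmem
  have e : ∫⁻ z in Q p x₀ t₀ (2 * ρ), ENNReal.ofReal (max (u z) 0 ^ m) =
      ∫⁻ z in Q p x₀ t₀ (2 * ρ), ENNReal.ofReal (max (u' z) 0 ^ m) :=
    lintegral_congr_ae (hue.mono fun z hz => by simp only [hz])
  rw [e] at hint
  have havg : 0 ≤ ⨍ z in Q p x₀ t₀ (2 * ρ), max (u z) 0 ^ m := by
    rw [setAverage_eq]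
    exact smul_nonneg (by positivity)
      (integral_nonneg fun z => Real.rpow_nonneg (le_max_right _ _) _)
  have hb := h δ hδ x₀ t₀ ρ u' g' hρ hsub _ havg hint
  have hQQ : Q p x₀ t₀ ρ ⊆ Q p x₀ t₀ (2 * ρ) := by
    rw [← scyl_one]
    exact scyl_subset_Q hp hp2 x₀ t₀ hρ (by norm_num)
  filter_upwards [hb, ae_mono (Measure.restrict_mono hQQ le_rfl) hue] with z hz hz'
  rw [hz']
  exact hz

theorem supBound_of_ae_le {p x₀ : Fin n → ℝ} {m C t₀ ρ : ℝ} {v : (Fin n → ℝ) × ℝ → ℝ}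
    (h : ∀ᵐ z ∂(volume.restrict (Q p x₀ t₀ ρ)), v z ≤
      C * ((⨍ z in Q p x₀ t₀ (2 * ρ), v z ^ m) ^
        (1 / (m - n / harmonicAvg p * (2 - harmonicAvg p))) + 1 + √ρ)) :
    SupBound p m C x₀ t₀ ρ v :=
  essSup_le_of_ae_le _ (h.mono fun _ hz => ENNReal.ofReal_le_ofReal hz)

theorem div_harmonicAvg_mul {p : Fin n → ℝ} (hn : 0 < n) (hp : ∀ i, 0 < p i) :
    0 < harmonicAvg p ∧ (n : ℝ) / harmonicAvg p = ∑ i, 1 / p i := by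
  have hS : 0 < ∑ i, 1 / p i :=
    Finset.sum_pos (fun i _ => one_div_pos.2 (hp i)) ⟨⟨0, hn⟩, Finset.mem_univ _⟩
  have hn' : (0 : ℝ) < n := by exact_mod_cast hn
  refine ⟨by rw [harmonicAvg]; positivity, ?_⟩
  rw [harmonicAvg]
  field_simp

end AnisoDG

/-! ### Conclusion: exponent conditions and both signs -/

theorem theorem3 (n : ℕ) (hn : 2 ≤ n) (p : Fin n → ℝ)
    (hp : ∀ i, 1 < p i ∧ p i < AnisoDG.harmonicAvg p * (1 + 2 / (n : ℝ)))
    (hpn : AnisoDG.harmonicAvg p < n)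
    (hsub : AnisoDG.harmonicAvg p ≤ 2 * (n : ℝ) / ((n : ℝ) + 2))
    (m : ℝ) (hm : (n : ℝ) / AnisoDG.harmonicAvg p * (2 - AnisoDG.harmonicAvg p) < m)
    (c : ℝ) (hc : 0 < c) (D : ℝ) :
    ∃ C : ℝ, 0 < C ∧
      ∀ (δ : Fin n → ℝ), (∀ i, 0 ≤ δ i ∧ δ i ≤ D) →
      ∀ (Ω : Set (Fin n → ℝ)), IsOpen Ω → IsConnected Ω → Bornology.IsBounded Ω →
      ∀ (T : ℝ), 0 < T →
      ∀ (u : (Fin n → ℝ) × ℝ → ℝ), AnisoDG.MemLpLoc u m (AnisoDG.cyl Ω T) →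
        (AnisoDG.DGplus p δ Ω T c u →
          AnisoDG.LocBddAbove u (AnisoDG.cyl Ω T) ∧
          ∀ (x₀ : Fin n → ℝ) (t₀ ρ : ℝ), 0 < ρ →
            AnisoDG.CompactlyContained (AnisoDG.Q p x₀ t₀ (2 * ρ)) (AnisoDG.cyl Ω T) →
            AnisoDG.SupBound p m C x₀ t₀ ρ (fun z => max (u z) 0)) ∧
        (AnisoDG.DGminus p δ Ω T c u →
          AnisoDG.LocBddBelow u (AnisoDG.cyl Ω T) ∧
          ∀ (x₀ : Fin n → ℝ) (t₀ ρ : ℝ), 0 < ρ →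
            AnisoDG.CompactlyContained (AnisoDG.Q p x₀ t₀ (2 * ρ)) (AnisoDG.cyl Ω T) →
            AnisoDG.SupBound p m C x₀ t₀ ρ (fun z => max (-u z) 0)) := by
  have hn0 : 0 < n := by omega
  have hnR : (0 : ℝ) < n := by exact_mod_cast hn0
  have hp1 : ∀ i, 1 < p i := fun i => (hp i).1
  obtain ⟨hpb, hS⟩ := AnisoDG.div_harmonicAvg_mul hn0 fun i => zero_lt_one.trans (hp1 i)
  have hp2 : ∀ i, p i < 2 := fun i => by
    refine (hp i).2.trans_le ?_
    calc AnisoDG.harmonicAvg p * (1 + 2 / (n : ℝ))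
        ≤ 2 * (n : ℝ) / ((n : ℝ) + 2) * (1 + 2 / (n : ℝ)) := by gcongr
      _ = 2 := by field_simp
  have hS1 : 1 < (n : ℝ) / AnisoDG.harmonicAvg p := (one_lt_div hpb).2 hpn
  have hexp : (n : ℝ) / AnisoDG.harmonicAvg p * (2 - AnisoDG.harmonicAvg p) =
      2 * ((n : ℝ) / AnisoDG.harmonicAvg p) - n := by
    field_simp
  -- Equivalent to 2S - n ≥ 2, so the lower bound on m forces m > 2, which the layer cake weights
  -- require.
  have hS2 : ((n : ℝ) + 2) / 2 ≤ (n : ℝ) / AnisoDG.harmonicAvg p := by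
    rw [le_div_iff₀ (by linarith : (0 : ℝ) < (n : ℝ) + 2)] at hsub
    rw [div_le_div_iff₀ two_pos hpb]
    linarith
  rw [hexp] at hm
  obtain ⟨C, hC, hbound⟩ := AnisoDG.DGplus.exists_ae_bound (D := D) hn hp1 hp2 hS hS1
    (by linarith) hm hc
  rw [← hexp] at hbound
  have hboth : ∀ (δ : Fin n → ℝ), (∀ i, 0 ≤ δ i ∧ δ i ≤ D) →
      ∀ (Ω : Set (Fin n → ℝ)), IsOpen Ω → ∀ (T : ℝ) (u : (Fin n → ℝ) × ℝ → ℝ),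
      AnisoDG.MemLpLoc u m (AnisoDG.cyl Ω T) → AnisoDG.DGplus p δ Ω T c u →
      AnisoDG.LocBddAbove u (AnisoDG.cyl Ω T) ∧
        ∀ (x₀ : Fin n → ℝ) (t₀ ρ : ℝ), 0 < ρ →
          AnisoDG.CompactlyContained (AnisoDG.Q p x₀ t₀ (2 * ρ)) (AnisoDG.cyl Ω T) →
          AnisoDG.SupBound p m C x₀ t₀ ρ (fun z => max (u z) 0) := by
    intro δ hδ Ω hΩ T u hum hu
    have hb := hbound δ hδ Ω hΩ T u hum hu
    refine ⟨AnisoDG.locBddAbove_of_Q hp1 hp2 hΩ fun x₀ t₀ ρ hρ hQ => ⟨_, hb x₀ t₀ ρ hρ hQ⟩,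
      fun x₀ t₀ ρ hρ hQ => AnisoDG.supBound_of_ae_le ?_⟩
    filter_upwards [hb x₀ t₀ ρ hρ hQ] with z hz
    -- The bound on u passes to its positive part because the right side is nonnegative.
    refine max_le hz (mul_nonneg hC.le ?_)
    have havg : 0 ≤ ⨍ z in AnisoDG.Q p x₀ t₀ (2 * ρ), max (u z) 0 ^ m := by
      rw [setAverage_eq]
      exact smul_nonneg (by positivity)
        (integral_nonneg fun z => Real.rpow_nonneg (le_max_right _ _) _)
    have := Real.rpow_nonneg havg
      (1 / (m - n / AnisoDG.harmonicAvg p * (2 - AnisoDG.harmonicAvg p)))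
    positivity
  refine ⟨C, hC, fun δ hδ Ω hΩ _ _ T _ u hum => ⟨hboth δ hδ Ω hΩ T u hum, fun hu => ?_⟩⟩
  obtain ⟨h1, h2⟩ := hboth δ hδ Ω hΩ T _ hum.neg hu.neg
  refine ⟨fun K hK hKU => ?_, h2⟩
  obtain ⟨M, hM⟩ := h1 K hK hKU
  exact ⟨-M, hM.mono fun z hz => by linarith⟩
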